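/- **Setting.** Let $G=(V,E)$ be a finite simple graph with $n=|V|\ge 1$ vertices, and let $q\ge 2$ be an integer. A $q$-spin system is given by a symmetric matrix $A\in\mathbb{R}_{\ge0}^{q\times q}$ and a vector $h\in\mathbb{R}_{>0}^q$. If $$Z=\sum_{\sigma\in[q]^V}\prod_{\{u,v\}\in E}A(\sigma_u,\sigma_v)\prod_{v\in V}h(\sigma_v)>0,$$ its Gibbs distribution is $\mu(\sigma)=\frac1Z\prod_{\{u,v\}\in E}A(\sigma_u,\sigma_v)\prod_{v\in V}h(\sigma_v)$ on $[q]^V$. Let $\Omega$ be the support of $\mu$. For $\Lambda\subseteq V$ let $\Omega_\Lambda$ be the set of $\tau\in[q]^\Lambda$ with $\mu(\sigma_\Lambda=\tau)>0$. For $\tau\in\Omega_\Lambda$ and $U\subseteq V\setminus\Lambda$ let $\Omega_U^\tau$ be the set of $x\in[q]^U$ with $\mu(\sigma_U=x\mid\sigma_\Lambda=\tau)>0$, and write $\Omega_v^\tau=\Omega_{\{v\}}^\tau$. * $\mu$ is *totally-connected* if for every nonempty $S\subseteq V$ and every $\tau\in\Omega_{V\setminus S}$, the set $\Omega_S^\tau$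 induces a connected subgraph of the graph on $[q]^S$ in which two configurations are adjacent iff they differ at exactly one vertex. * $\mu$ is *$b$-marginally bounded* if $\mu(\sigma_v=i\mid\sigma_\Lambda=\tau)\ge b$ for all $\Lambda\subsetneq V$, $\tau\in\Omega_\Lambda$, $v\in V\setminus\Lambda$ and $i\in\Omega_v^\tau$. * $\mu$ is *$\eta$-spectrally independent* if for all $\Lambda\subsetneq V$ and $\tau\in\Omega_\Lambda$, the largest eigenvalue of the matrix $\Psi^\tau$ indexed by $\{(u,i):u\in V\setminus\Lambda,\ i\in\Omega_u^\tau\}$ is at most $\eta$, where $\Psi^\tau((u,i),(v,j))=\mu(\sigma_v=j\mid\sigma_u=i,\sigma_\Lambda=\tau)-\mu(\sigma_v=j\mid\sigma_\Lambda=\tau)$ if $u\ne v$, and $\Psi^\tau((v,i),(v,j))=0$. (All eigenvalues of $\Psi^\tau$ are real.) The *Glauber dynamics* is the Markov chain on $\Omega$ with transition matrix $P$ which, in each step, picks $v\in V$ uniformly at random and resamples the spin at $v$ from its $\mu$-conditional distribution given the spins of all other vertices. It satisfies the *modified log-Sobolev inequality with constant $\rho$* if for every $f:\Omega\to\mathbb{R}_{\ge0}$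 $$\rho\,\bigl(\mu(f\log f)-\mu(f)\log\mu(f)\bigr)\le\frac12\sum_{x,y\in\Omega}\mu(x)P(x,y)\,(f(x)-f(y))(\log f(x)-\log f(y)).$$ Here $0\log0=0$ in the entropy on the left. On the right $\log 0=-\infty$: a term with $f(x)=f(y)=0$ or $\mu(x)P(x,y)=0$ is $0$, and any other term in which exactly one of $f(x),f(y)$ vanishes is $+\infty$. For $\varepsilon\in(0,1)$ the *mixing time* is $T_{\mathrm{mix}}(\varepsilon)=\max_{\sigma\in\Omega}\min\{t\ge0:\|P^t(\sigma,\cdot)-\mu\|_{TV}\le\varepsilon\}$. **Theorem.** There is an absolute constant $K>0$ such that the following holds. Let $\Delta\ge3$ be an integer and let $b,\eta>0$ be reals. Let $G$ be a graph with $n\ge1$ vertices and maximum degree at most $\Delta$, and let $\mu$ be the Gibbs distribution of a $q$-spin system on $G$ with $q\ge2$ and $Z>0$. If $\mu$ is totally-connected, $b$-marginally bounded and $\eta$-spectrally independent, then the Glauber dynamics for $\mu$ satisfies the modified log-Sobolev inequality with constant $$\frac1{C_1n},\qquad C_1=\Bigl(\frac{\Delta}{b}\Bigr)^{K\left(\frac{\eta}{b^2}+1\right)},$$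 and for every $\varepsilon\in(0,1)$ its mixing time is finite and satisfies $$T_{\mathrm{mix}}(\varepsilon)\le\Bigl(\frac{\Delta}{b}\Bigr)^{K\left(\frac{\eta}{b^2}+1\right)}\cdot K\,n\log\Bigl(\frac n\varepsilon\Bigr).$$ -/

import Mathlib

namespace SpinGlauber

universe u

/-- The parameters of a `q`-spin system: a symmetric nonnegative interaction matrix `A` and a
positive field vector `h`. The spins are the elements of `Fin q`. -/
structure SpinSystem (q : ℕ) where
  A : Matrix (Fin q) (Fin q) ℝ
  h : Fin q → ℝ
  symm : ∀ i j, A i j = A j i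
  nonneg : ∀ i j, 0 ≤ A i j
  pos : ∀ i, 0 < h i

section Gibbs

variable {V : Type u} [Fintype V] [DecidableEq V] {q : ℕ}

/-- The factor `A (σ u) (σ v)` contributed by an unordered pair `e = {u, v}`. -/
def SpinSystem.edgeFactor (X : SpinSystem q) (σ : V → Fin q) (e : Sym2 V) : ℝ :=
  Sym2.lift ⟨fun u v => X.A (σ u) (σ v), fun u v => X.symm (σ u) (σ v)⟩ e

/-- The weight of a configuration: the product of the interactions over the edges times the
product of the fields over the vertices. -/
def SpinSystem.weight (X : SpinSystem q) (G : SimpleGraph V) [DecidableRel G.Adj]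
    (σ : V → Fin q) : ℝ :=
  (∏ e ∈ G.edgeFinset, X.edgeFactor σ e) * ∏ v, X.h (σ v)

/-- The partition function `Z`. -/
def SpinSystem.partitionFunction (X : SpinSystem q) (G : SimpleGraph V) [DecidableRel G.Adj] : ℝ :=
  ∑ σ : V → Fin q, X.weight G σ

/-- The Gibbs distribution, as a mass function on configurations. It is a probability
distribution exactly when the partition function is positive. -/
noncomputable def SpinSystem.gibbs (X : SpinSystem q) (G : SimpleGraph V) [DecidableRel G.Adj]
    (σ : V → Fin q) : ℝ :=
  X.weight G σ / X.partitionFunction G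

end Gibbs

section Distributions

variable {V : Type u} [Fintype V] [DecidableEq V] {q : ℕ}

/-- The probability of the event `E` under the mass function `μ`. -/
noncomputable def prob (μ : (V → Fin q) → ℝ) (E : Set (V → Fin q)) : ℝ :=
  ∑ σ, E.indicator μ σ

/-- The conditional probability `μ(E | F)`; it is used only when `F` has positive probability. -/
noncomputable def condProb (μ : (V → Fin q) → ℝ) (E F : Set (V → Fin q)) : ℝ :=
  prob μ (E ∩ F) / prob μ F

/-- The event `σ_Λ = τ`. -/
def cylinder {Λ : Finset V} (τ : Λ → Fin q) : Set (V → Fin q) :=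
  {σ | ∀ v : Λ, σ v = τ v}

/-- The event `σ_v = i`. -/
def spinEvent (v : V) (i : Fin q) : Set (V → Fin q) :=
  {σ | σ v = i}

/-- `τ ∈ Ω_Λ`: the partial configuration `τ` on `Λ` has positive marginal probability. -/
def IsFeasible (μ : (V → Fin q) → ℝ) {Λ : Finset V} (τ : Λ → Fin q) : Prop :=
  0 < prob μ (cylinder τ)

/-- `Ω_U^τ`: the partial configurations on `U` of positive probability conditionally on `τ`. -/
def feasibleConfigs (μ : (V → Fin q) → ℝ) {Λ : Finset V} (τ : Λ → Fin q) (U : Finset V) :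
    Set (U → Fin q) :=
  {x | 0 < condProb μ (cylinder x) (cylinder τ)}

/-- `Ω_v^τ`: the spins at the vertex `v` of positive probability conditionally on `τ`. -/
def feasibleSpins (μ : (V → Fin q) → ℝ) {Λ : Finset V} (τ : Λ → Fin q) (v : V) : Set (Fin q) :=
  {i | 0 < condProb μ (spinEvent v i) (cylinder τ)}

/-- The Hamming graph on `[q]^S`: two configurations are adjacent iff they differ at exactly
one vertex. -/
def hammingGraph (S : Finset V) (q : ℕ) : SimpleGraph (S → Fin q) where
  Adj x y := ∃! v, x v ≠ y v
  symm := ⟨fun _ _ ⟨v, hv, hu⟩ => ⟨v, hv.symm, fun w hw => hu w (Ne.symm hw)⟩⟩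
  loopless := ⟨fun _ ⟨_, hv, _⟩ => hv rfl⟩

/-- `μ` is totally-connected: for every nonempty `S` and every feasible boundary condition `τ`
outside `S`, the set `Ω_S^τ` induces a connected subgraph of the Hamming graph. -/
def TotallyConnected (μ : (V → Fin q) → ℝ) : Prop :=
  ∀ S : Finset V, S.Nonempty → ∀ τ : (Sᶜ : Finset V) → Fin q, IsFeasible μ τ →
    ((hammingGraph S q).induce (feasibleConfigs μ τ S)).Connected

/-- `μ` is `b`-marginally bounded. -/
def MarginallyBounded (μ : (V → Fin q) → ℝ) (b : ℝ) : Prop :=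
  ∀ Λ : Finset V, Λ ≠ Finset.univ → ∀ τ : Λ → Fin q, IsFeasible μ τ →
    ∀ v, v ∉ Λ → ∀ i ∈ feasibleSpins μ τ v, b ≤ condProb μ (spinEvent v i) (cylinder τ)

/-- The index set of the influence matrix conditioned on `τ`: the pairs `(u, i)` with `u ∉ Λ`
and `i ∈ Ω_u^τ`. -/
abbrev InfluenceIndex (μ : (V → Fin q) → ℝ) {Λ : Finset V} (τ : Λ → Fin q) : Type u :=
  {p : V × Fin q // p.1 ∉ Λ ∧ p.2 ∈ feasibleSpins μ τ p.1}

/-- The pairwise influence matrix conditioned on `τ`. -/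
noncomputable def influenceMatrix (μ : (V → Fin q) → ℝ) {Λ : Finset V} (τ : Λ → Fin q) :
    Matrix (InfluenceIndex μ τ) (InfluenceIndex μ τ) ℝ :=
  fun x y =>
    if x.1.1 = y.1.1 then 0
    else condProb μ (spinEvent y.1.1 y.1.2) (spinEvent x.1.1 x.1.2 ∩ cylinder τ) -
      condProb μ (spinEvent y.1.1 y.1.2) (cylinder τ)

open Classical in
/-- `μ` is `η`-spectrally independent: every eigenvalue of every influence matrix is at most `η`.
(These matrices have only real eigenvalues.) -/
def SpectrallyIndependent (μ : (V → Fin q) → ℝ) (η : ℝ) : Prop :=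
  ∀ Λ : Finset V, Λ ≠ Finset.univ → ∀ τ : Λ → Fin q, IsFeasible μ τ →
    ∀ lam : ℝ, Module.End.HasEigenvalue (Matrix.toLin' (influenceMatrix μ τ)) lam → lam ≤ η

/-- `Ω`: the support of `μ`. -/
abbrev Support (μ : (V → Fin q) → ℝ) : Type u := {σ : V → Fin q // 0 < μ σ}

/-- The transition matrix of the Glauber dynamics on the support of `μ`: choose a vertex `v`
uniformly at random and resample its spin conditionally on the spins of all other vertices. -/
noncomputable def glauber (μ : (V → Fin q) → ℝ) : Matrix (Support μ) (Support μ) ℝ :=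
  fun σ σ' => (1 / (Fintype.card V : ℝ)) *
    ∑ v, if ∀ u, u ≠ v → σ'.1 u = σ.1 u then
        condProb μ (spinEvent v (σ'.1 v)) {ω | ∀ u, u ≠ v → ω u = σ.1 u}
      else 0

end Distributions

section MarkovChains

variable {S : Type u} [Fintype S] [DecidableEq S]

/-- Entropy of a nonnegative function `f`, namely `π(f log f) - π(f) log π(f)`, where
`0 log 0 = 0`. -/
noncomputable def entropy (π f : S → ℝ) : ℝ :=
  (∑ x, π x * (f x * Real.log (f x))) - (∑ x, π x * f x) * Real.log (∑ x, π x * f x)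

/-- The Dirichlet form of `P` with respect to `π`. It takes extended real arguments so that it
can be applied to `log f` when `f` vanishes somewhere. -/
noncomputable def dirichletForm (P : Matrix S S ℝ) (π : S → ℝ) (f g : S → EReal) : EReal :=
  ((1 / 2 : ℝ) : EReal) *
    ∑ x, ∑ y, ((π x * P x y : ℝ) : EReal) * ((f x - f y) * (g x - g y))

/-- The modified log-Sobolev inequality with constant `ρ`, for all `f ≥ 0`. Here `log 0 = -∞`, and
`0 * (±∞) = 0` in the Dirichlet form: a pair `x, y` contributes `0` if `f x = f y = 0`, and
contributes `+∞` if exactly one of `f x`, `f y` vanishes and `π x * P x y > 0`. -/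
def ModifiedLogSobolev (P : Matrix S S ℝ) (π : S → ℝ) (ρ : ℝ) : Prop :=
  ∀ f : S → ℝ, (∀ x, 0 ≤ f x) →
    ((ρ * entropy π f : ℝ) : EReal) ≤
      dirichletForm P π (fun x => (f x : EReal)) (fun x => ENNReal.log (ENNReal.ofReal (f x)))

/-- Total variation distance of two mass functions. -/
noncomputable def tvDist (p p' : S → ℝ) : ℝ :=
  (1 / 2) * ∑ x, |p x - p' x|

/-- The mixing time: the maximum over the initial state `x` of the least `t` such that
`P ^ t x` is within total variation distance `ε` of `π` (infinite if there is no such `t`). -/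
noncomputable def mixingTime (P : Matrix S S ℝ) (π : S → ℝ) (ε : ℝ) : ℕ∞ :=
  ⨆ x : S, ⨅ (t : ℕ) (_ : tvDist ((P ^ t) x) π ≤ ε), (t : ℕ∞)

end MarkovChains

end SpinGlauber

/-! Write `f_T` for the conditional expectation of `f` given the spins in `T`, and `H(T) = E[f log
f_T]` (`entOn`). Then `H(V) - H(∅)` is the entropy of `f`, and `H(V) - H(Tᶜ)` is the average entropy
left on the block `T` once everything outside is fixed. The core is approximate tensorization: `H(V)
- H(∅) ≤ C ∑ v, (H(V) - H({v}ᶜ))` with `C` independent of `n` (`approximate_tensorization`).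

Local step. Second differences of `H` at `T` are bounded below by minus the covariances of the
increments `f_{T∪u} - f_T`, weighted by `1 / f_T` (`entOn_supermodular`). Spectral independence
bounds the sum of these covariances by their diagonal, and marginal boundedness compares the
diagonal with the first differences of `H`, at the cost of a factor `κ = 4η/b`
(`local_entropy_contraction`). Averaged over all `T` of equal size, this is a recursion for the mean
of `H` on each level, and a discrete Grönwall argument compares the whole entropy with the average
entropy of uniformly random blocks of size `l` (`increment_le_block_increment`).

From blocks to sites. With `l ≈ θn` and `θ = b³/(4Δ²)`, a random block shatters into small connected
components. By the Markov property entropy is subadditive over components. Inside a component of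
size `k`, total-connectedness gives a crude bound with constant `16 b^(-3k)`. At most `Δ^(2k)`
connected sets with `k + 1` vertices contain a given vertex, and each lies in the block with
probability at most `(l/n)^(k+1)`, so a geometric series bounds the expected cost. If `n` is too
small for such an `l`, blocks of constant size and the crude bound suffice.

Consequences. The single-site entropies are dominated by the Dirichlet form, which gives the
modified log-Sobolev inequality; for an `f` with zeros, total-connectedness makes the form infinite.
Mixing is derived from tensorization directly: a Glauber step averages the operators `f ↦ f_{V∖v}`,
so convexity of `x log x` contracts entropy by `1 - 1/(Cn)`, and a Pinsker-type inequality converts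
entropy to total variation. -/

namespace SpinGlauber

universe u

/-! ### Conditional expectations and the set function `entOn`. -/

section ConditionalExpectation

variable {V : Type u} [Fintype V] [DecidableEq V] {q : ℕ}

/-- The configurations which agree with `σ` on `T`. -/
def fiber (T : Finset V) (σ : V → Fin q) : Finset (V → Fin q) :=
  Finset.univ.filter fun ω => ∀ v ∈ T, ω v = σ v

/-- The conditional expectation of `f` given the spins in `T`, at the configuration `σ`. -/
noncomputable def cexp (μ : (V → Fin q) → ℝ) (T : Finset V) (f : (V → Fin q) → ℝ)
    (σ : V → Fin q) : ℝ :=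
  (∑ ω ∈ fiber T σ, μ ω * f ω) / ∑ ω ∈ fiber T σ, μ ω

/-- `φ` only depends on the spins in `T`. -/
def IsLocal {α : Type*} (T : Finset V) (φ : (V → Fin q) → α) : Prop :=
  ∀ σ ω, ω ∈ fiber T σ → φ ω = φ σ

/-- The expectation of `f log f_T`, where `f_T` is the conditional expectation of `f` given the
spins in `T`. -/
noncomputable def entOn (μ f : (V → Fin q) → ℝ) (T : Finset V) : ℝ :=
  ∑ σ, μ σ * (f σ * Real.log (cexp μ T f σ))

@[simp] theorem mem_fiber {T : Finset V} {σ ω : V → Fin q} :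
    ω ∈ fiber T σ ↔ ∀ v ∈ T, ω v = σ v := by simp [fiber]

theorem self_mem_fiber (T : Finset V) (σ : V → Fin q) : σ ∈ fiber T σ := by simp

theorem mem_fiber_comm {T : Finset V} {σ ω : V → Fin q} : ω ∈ fiber T σ ↔ σ ∈ fiber T ω := by
  simp only [mem_fiber]
  exact ⟨fun h v hv => (h v hv).symm, fun h v hv => (h v hv).symm⟩

theorem fiber_eq {T : Finset V} {σ ω : V → Fin q} (h : ω ∈ fiber T σ) :
    fiber T ω = fiber T σ := by
  ext x
  simp only [mem_fiber] at *
  exact ⟨fun hx v hv => (hx v hv).trans (h v hv), fun hx v hv => (hx v hv).trans (h v hv).symm⟩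

theorem fiber_anti {A T : Finset V} (h : A ⊆ T) (σ : V → Fin q) : fiber T σ ⊆ fiber A σ := by
  intro ω hω
  simp only [mem_fiber] at *
  exact fun v hv => hω v (h hv)

@[simp] theorem fiber_univ (σ : V → Fin q) : fiber Finset.univ σ = {σ} := by
  ext ω
  simp [funext_iff]

@[simp] theorem fiber_empty (σ : V → Fin q) : fiber ∅ σ = Finset.univ := by
  ext ω
  simp

theorem IsLocal.mono {α : Type*} {A T : Finset V} {φ : (V → Fin q) → α} (hφ : IsLocal A φ)
    (h : A ⊆ T) : IsLocal T φ :=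
  fun σ ω hω => hφ σ ω (fiber_anti h σ hω)

theorem isLocal_cexp (μ : (V → Fin q) → ℝ) (T : Finset V) (f : (V → Fin q) → ℝ) :
    IsLocal T (cexp μ T f) := fun σ ω h => by simp only [cexp, fiber_eq h]

variable {μ : (V → Fin q) → ℝ}

theorem fiber_sum_nonneg (hμ : ∀ σ, 0 ≤ μ σ) (T : Finset V) (σ : V → Fin q) :
    0 ≤ ∑ ω ∈ fiber T σ, μ ω := Finset.sum_nonneg fun ω _ => hμ ω

theorem fiber_sum_pos (hμ : ∀ σ, 0 ≤ μ σ) (T : Finset V) {σ : V → Fin q} (h : 0 < μ σ) :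
    0 < ∑ ω ∈ fiber T σ, μ ω :=
  h.trans_le (Finset.single_le_sum (fun ω _ => hμ ω) (self_mem_fiber T σ))

theorem cexp_nonneg (hμ : ∀ σ, 0 ≤ μ σ) (T : Finset V) {f : (V → Fin q) → ℝ}
    (hf : ∀ σ, 0 ≤ f σ) (σ : V → Fin q) : 0 ≤ cexp μ T f σ :=
  div_nonneg (Finset.sum_nonneg fun ω _ => mul_nonneg (hμ ω) (hf ω)) (fiber_sum_nonneg hμ T σ)

theorem cexp_pos (hμ : ∀ σ, 0 ≤ μ σ) (T : Finset V) {f : (V → Fin q) → ℝ}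
    (hf : ∀ σ, 0 ≤ f σ) {σ : V → Fin q} (h : 0 < μ σ) (hσ : 0 < f σ) : 0 < cexp μ T f σ :=
  div_pos ((mul_pos h hσ).trans_le (Finset.single_le_sum
    (fun ω _ => mul_nonneg (hμ ω) (hf ω)) (self_mem_fiber T σ))) (fiber_sum_pos hμ T h)

theorem cexp_univ (f : (V → Fin q) → ℝ) {σ : V → Fin q} (h : 0 < μ σ) :
    cexp μ Finset.univ f σ = f σ := by
  simp [cexp, h.ne']

/-- The tower property: `E[E[f | T] φ] = E[f φ]` if `φ` depends on the spins in `T` only. -/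
theorem sum_cexp_mul (hμ : ∀ σ, 0 ≤ μ σ) (T : Finset V) (f : (V → Fin q) → ℝ)
    {φ : (V → Fin q) → ℝ} (hφ : IsLocal T φ) :
    ∑ σ, μ σ * (cexp μ T f σ * φ σ) = ∑ σ, μ σ * (f σ * φ σ) := by
  have h1 : ∀ σ, μ σ * (cexp μ T f σ * φ σ) =
      ∑ ω ∈ fiber T σ, μ σ * (μ ω * f ω * φ σ / ∑ ω ∈ fiber T σ, μ ω) := by
    intro σ
    rw [cexp, ← Finset.mul_sum, ← Finset.sum_div, ← Finset.sum_mul]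
    ring
  rw [Finset.sum_congr rfl fun σ _ => h1 σ,
    Finset.sum_comm' (t' := Finset.univ) (s' := fun ω => fiber T ω)
      (by intro x y; simp only [Finset.mem_univ, true_and, and_true]; exact mem_fiber_comm)]
  refine Finset.sum_congr rfl fun ω _ => ?_
  have h2 : ∀ σ ∈ fiber T ω, μ σ * (μ ω * f ω * φ σ / ∑ ω ∈ fiber T σ, μ ω) =
      μ σ * (μ ω * f ω * φ ω / ∑ ω ∈ fiber T ω, μ ω) := by
    intro σ hσ
    rw [hφ ω σ hσ, fiber_eq hσ]
  rw [Finset.sum_congr rfl h2, ← Finset.sum_mul]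
  rcases (hμ ω).eq_or_lt with h | h
  · simp [← h]
  · have := (fiber_sum_pos hμ T h).ne'
    field_simp

theorem sum_cexp (hμ : ∀ σ, 0 ≤ μ σ) (T : Finset V) (f : (V → Fin q) → ℝ) :
    ∑ σ, μ σ * cexp μ T f σ = ∑ σ, μ σ * f σ := by
  simpa using sum_cexp_mul hμ T f (φ := fun _ => 1) (fun _ _ _ => rfl)

/-- The tower property tested against the indicator of the coarser fiber, which is local on `T`
because `A ⊆ T`. -/
theorem sum_fiber_cexp (hμ : ∀ σ, 0 ≤ μ σ) {A T : Finset V} (h : A ⊆ T) (f : (V → Fin q) → ℝ)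
    (σ : V → Fin q) : ∑ ω ∈ fiber A σ, μ ω * cexp μ T f ω = ∑ ω ∈ fiber A σ, μ ω * f ω := by
  have := sum_cexp_mul hμ T f (φ := fun ω => if ω ∈ fiber A σ then 1 else 0) (by
    intro x y hy
    have : y ∈ fiber A x := fiber_anti h x hy
    have h1 : y ∈ fiber A σ ↔ x ∈ fiber A σ := by
      rw [mem_fiber_comm, fiber_eq this, mem_fiber_comm]
    simp only [h1])
  simpa only [mul_ite, mul_one, mul_zero, Finset.sum_ite_mem, Finset.univ_inter] using this

theorem cexp_cexp (hμ : ∀ σ, 0 ≤ μ σ) {A T : Finset V} (h : A ⊆ T) (f : (V → Fin q) → ℝ) :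
    cexp μ A (cexp μ T f) = cexp μ A f := by
  funext σ
  rw [cexp, sum_fiber_cexp hμ h, cexp]

/-- Expectations may be compared fiber by fiber. -/
theorem sum_le_sum_of_fiber (hμ : ∀ σ, 0 ≤ μ σ) (T : Finset V) {f g : (V → Fin q) → ℝ}
    (h : ∀ σ, 0 < μ σ → ∑ ω ∈ fiber T σ, μ ω * f ω ≤ ∑ ω ∈ fiber T σ, μ ω * g ω) :
    ∑ σ, μ σ * f σ ≤ ∑ σ, μ σ * g σ := by
  rw [← sum_cexp hμ T f, ← sum_cexp hμ T g]
  refine Finset.sum_le_sum fun σ _ => ?_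
  rcases (hμ σ).eq_or_lt with h0 | h0
  · simp [← h0]
  · exact mul_le_mul_of_nonneg_left
      (div_le_div_of_nonneg_right (h σ h0) (fiber_sum_nonneg hμ T σ)) (hμ σ)

theorem entOn_eq (hμ : ∀ σ, 0 ≤ μ σ) (f : (V → Fin q) → ℝ) (T : Finset V) :
    entOn μ f T = ∑ σ, μ σ * (cexp μ T f σ * Real.log (cexp μ T f σ)) :=
  (sum_cexp_mul hμ T f fun σ ω h => by simp only [isLocal_cexp μ T f σ ω h]).symm

/-- This is `log x ≤ x - 1` at `x = √(b/a)`, which produces the square roots of a Hellinger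
distance. -/
theorem mul_log_div_ge {a b : ℝ} (ha : 0 < a) (hb : 0 < b) :
    2 * (a - √a * √b) ≤ a * (Real.log a - Real.log b) := by
  have h1 := Real.log_le_sub_one_of_pos (div_pos (Real.sqrt_pos.2 hb) (Real.sqrt_pos.2 ha))
  rw [Real.log_div (Real.sqrt_pos.2 hb).ne' (Real.sqrt_pos.2 ha).ne', Real.log_sqrt hb.le,
    Real.log_sqrt ha.le] at h1
  have h2 : a * (√b / √a) = √a * √b := by
    have h3 := Real.mul_self_sqrt ha.le
    have h4 := (Real.sqrt_pos.2 ha).ne'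
    field_simp
    nlinarith
  nlinarith [mul_le_mul_of_nonneg_left h1 ha.le]

/-- The entropy gained by refining the conditioning dominates a Hellinger distance. -/
theorem hellinger_le_entOn_sub (hμ : ∀ σ, 0 ≤ μ σ) {f : (V → Fin q) → ℝ} (hf : ∀ σ, 0 ≤ f σ)
    {A T : Finset V} (h : A ⊆ T) :
    ∑ σ, μ σ * (√(cexp μ T f σ) - √(cexp μ A f σ)) ^ 2 ≤ entOn μ f T - entOn μ f A := by
  have e1 : entOn μ f T - entOn μ f A = ∑ σ, μ σ * (cexp μ T f σ *
      (Real.log (cexp μ T f σ) - Real.log (cexp μ A f σ))) := by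
    rw [sum_cexp_mul hμ T f, entOn, entOn, ← Finset.sum_sub_distrib]
    · exact Finset.sum_congr rfl fun σ _ => by ring
    · intro σ ω hω
      simp only [isLocal_cexp μ T f σ ω hω, (isLocal_cexp μ A f).mono h σ ω hω]
  -- Both conditional expectations have the same mean, so after expanding the square the two
  -- diagonal terms agree in expectation.
  have e2 : ∑ σ, μ σ * (√(cexp μ T f σ) - √(cexp μ A f σ)) ^ 2 =
      ∑ σ, μ σ * (2 * (cexp μ T f σ - √(cexp μ T f σ) * √(cexp μ A f σ))) := by
    have e3 : ∑ σ, μ σ * cexp μ T f σ = ∑ σ, μ σ * cexp μ A f σ := by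
      rw [sum_cexp hμ, sum_cexp hμ]
    rw [← sub_eq_zero, ← Finset.sum_sub_distrib]
    rw [← sub_eq_zero, ← Finset.sum_sub_distrib] at e3
    rw [← neg_eq_zero, ← Finset.sum_neg_distrib, ← e3]
    refine Finset.sum_congr rfl fun σ _ => ?_
    have h1 := Real.sq_sqrt (cexp_nonneg hμ T hf σ)
    have h2 := Real.sq_sqrt (cexp_nonneg hμ A hf σ)
    linear_combination (-μ σ) * h1 - μ σ * h2
  rw [e1, e2]
  refine Finset.sum_le_sum fun σ _ => ?_
  rcases (hμ σ).eq_or_lt with h0 | h0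
  · simp [← h0]
  refine mul_le_mul_of_nonneg_left ?_ (hμ σ)
  rcases (cexp_nonneg hμ T hf σ).eq_or_lt with h1 | h1
  · simp [← h1]
  · refine mul_log_div_ge h1 ?_
    rw [← cexp_cexp hμ h]
    exact cexp_pos hμ A (cexp_nonneg hμ T hf) h0 h1

theorem entOn_mono (hμ : ∀ σ, 0 ≤ μ σ) {f : (V → Fin q) → ℝ} (hf : ∀ σ, 0 ≤ f σ)
    {A T : Finset V} (h : A ⊆ T) : entOn μ f A ≤ entOn μ f T :=
  sub_nonneg.1 ((Finset.sum_nonneg fun σ _ => mul_nonneg (hμ σ) (sq_nonneg _)).trans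
    (hellinger_le_entOn_sub hμ hf h))

/-- A quantitative form of the supermodularity of `entOn`. -/
theorem entOn_supermodular (hμ : ∀ σ, 0 ≤ μ σ) {f : (V → Fin q) → ℝ} (hf : ∀ σ, 0 ≤ f σ)
    {A T T' B : Finset V} (hA : A ⊆ B) (hT : T ⊆ B) (hT' : T' ⊆ B) :
    ∑ σ, μ σ * f σ - ∑ σ, μ σ * (cexp μ T f σ * cexp μ T' f σ / cexp μ A f σ) ≤
      entOn μ f B - entOn μ f T - entOn μ f T' + entOn μ f A := by
  -- All factors beside `f` are local on `B`, so `f` may be replaced by `f_B`, which cancels. Where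
  -- `f_B = 0` the left side is `0`, hence only an inequality.
  have h1 : ∑ σ, μ σ * (f σ * (cexp μ T f σ * cexp μ T' f σ / (cexp μ B f σ * cexp μ A f σ))) ≤
      ∑ σ, μ σ * (cexp μ T f σ * cexp μ T' f σ / cexp μ A f σ) := by
    rw [← sum_cexp_mul hμ B f]
    · refine Finset.sum_le_sum fun σ _ => mul_le_mul_of_nonneg_left ?_ (hμ σ)
      rcases (cexp_nonneg hμ B hf σ).eq_or_lt with h0 | h0
      · rw [← h0, zero_mul]
        exact div_nonneg (mul_nonneg (cexp_nonneg hμ T hf σ) (cexp_nonneg hμ T' hf σ))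
          (cexp_nonneg hμ A hf σ)
      · rw [mul_div_assoc', mul_div_mul_left _ _ h0.ne']
    · intro σ ω hω
      simp only [isLocal_cexp μ B f σ ω hω, (isLocal_cexp μ T f).mono hT σ ω hω,
        (isLocal_cexp μ T' f).mono hT' σ ω hω, (isLocal_cexp μ A f).mono hA σ ω hω]
  refine (sub_le_sub_left h1 _).trans ?_
  simp only [entOn]
  rw [← Finset.sum_sub_distrib, ← Finset.sum_sub_distrib, ← Finset.sum_sub_distrib,
    ← Finset.sum_add_distrib]
  refine Finset.sum_le_sum fun σ _ => ?_
  rw [← mul_sub, ← mul_sub, ← mul_sub, ← mul_add]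
  rcases (hμ σ).eq_or_lt with h0 | h0
  · simp [← h0]
  refine mul_le_mul_of_nonneg_left ?_ (hμ σ)
  rcases (hf σ).eq_or_lt with h2 | h2
  · simp [← h2]
  have pB := cexp_pos hμ B hf h0 h2
  have pT := cexp_pos hμ T hf h0 h2
  have pT' := cexp_pos hμ T' hf h0 h2
  have pA := cexp_pos hμ A hf h0 h2
  -- The second difference is the expectation of `-f log x` with `x = f_T f_T' / (f_B f_A)`, and
  -- `-log x ≥ 1 - x`.
  have h3 := Real.log_le_sub_one_of_pos (div_pos (mul_pos pT pT') (mul_pos pB pA))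
  rw [Real.log_div (mul_pos pT pT').ne' (mul_pos pB pA).ne', Real.log_mul pT.ne' pT'.ne',
    Real.log_mul pB.ne' pA.ne'] at h3
  nlinarith [mul_le_mul_of_nonneg_left h3 h2.le]

end ConditionalExpectation

/-! ### From eigenvalues to quadratic forms for reversible matrices. -/

section Spectral

/-- The quadratic form of a matrix `M` which is reversible with respect to `w` is bounded by its
largest eigenvalue. -/
theorem quadratic_form_le {I : Type*} [Fintype I] [DecidableEq I] (M : Matrix I I ℝ) {w : I → ℝ}
    (hw : ∀ x, 0 < w x) (hsymm : ∀ x y, w x * M x y = w y * M y x) {η : ℝ}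
    (h : ∀ lam : ℝ, Module.End.HasEigenvalue (Matrix.toLin' M) lam → lam ≤ η) (g : I → ℝ) :
    ∑ x, ∑ y, w x * M x y * (g x * g y) ≤ η * ∑ x, w x * g x ^ 2 := by
  have hs : ∀ x, √(w x) ≠ 0 := fun x => (Real.sqrt_pos.2 (hw x)).ne'
  have hs2 : ∀ x, √(w x) * √(w x) = w x := fun x => Real.mul_self_sqrt (hw x).le
  -- Conjugation by `√w` makes `M` symmetric, by reversibility. An eigenvector `v` of `N` with
  -- eigenvalue `t` gives the eigenvector `v / √w` of `M` with eigenvalue `η - t`, so the hypothesis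
  -- says exactly that `N` is positive semidefinite.
  let N : Matrix I I ℝ := Matrix.of fun x y => (if x = y then η else 0) - √(w x) * M x y / √(w y)
  have hN : N.IsHermitian := by
    ext x y
    simp only [N, Matrix.conjTranspose_apply, Matrix.of_apply, star_trivial]
    congr 1
    · simp only [eq_comm]
    · rw [div_eq_div_iff (hs x) (hs y)]
      linear_combination (M y x) * hs2 y - (M x y) * hs2 x - hsymm x y
  have hps : N.PosSemidef := by
    rw [hN.posSemidef_iff_eigenvalues_nonneg]
    intro j
    have hev := hN.mulVec_eigenvectorBasis j
    have hne : hN.eigenvectorBasis j ≠ 0 := hN.eigenvectorBasis.orthonormal.ne_zero j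
    set v := hN.eigenvectorBasis j
    have hM : Module.End.HasEigenvalue (Matrix.toLin' M) (η - hN.eigenvalues j) := by
      refine Module.End.hasEigenvalue_of_hasEigenvector (x := fun x => v x / √(w x)) ⟨?_, ?_⟩
      · rw [Module.End.mem_eigenspace_iff]
        funext x
        have h1 := congrFun hev x
        simp only [Matrix.mulVec, dotProduct, N, Matrix.of_apply, sub_mul, Finset.sum_sub_distrib,
          ite_mul, zero_mul, Finset.sum_ite_eq, Finset.mem_univ, if_true, Pi.smul_apply,
          smul_eq_mul] at h1
        simp only [Matrix.toLin'_apply, Matrix.mulVec, dotProduct, Pi.smul_apply, smul_eq_mul]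
        have h2 : ∑ y, √(w x) * M x y / √(w y) * v y = √(w x) * ∑ y, M x y * (v y / √(w y)) := by
          rw [Finset.mul_sum]
          exact Finset.sum_congr rfl fun y _ => by ring
        rw [h2] at h1
        rw [mul_div_assoc', eq_div_iff (hs x)]
        linear_combination -h1
      · intro h0
        apply hne
        ext x
        have := congrFun h0 x
        simpa [hs x] using this
    have := h _ hM
    simp only [Pi.zero_apply]
    linarith
  have h1 := hps.dotProduct_mulVec_nonneg fun x => √(w x) * g x
  simp only [Matrix.mulVec, dotProduct, N, Matrix.of_apply, sub_mul, Finset.sum_sub_distrib,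
    ite_mul, zero_mul, Finset.sum_ite_eq, Finset.mem_univ, if_true, Pi.star_apply, star_trivial,
    mul_sub] at h1
  have h2 : ∑ x, √(w x) * g x * ∑ y, √(w x) * M x y / √(w y) * (√(w y) * g y) =
      ∑ x, ∑ y, w x * M x y * (g x * g y) := by
    refine Finset.sum_congr rfl fun x _ => ?_
    rw [Finset.mul_sum]
    refine Finset.sum_congr rfl fun y _ => ?_
    have := hs y
    field_simp
    linear_combination (M x y * g x * g y) * hs2 x
  have h3 : ∑ x, √(w x) * g x * (η * (√(w x) * g x)) = η * ∑ x, w x * g x ^ 2 := by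
    rw [Finset.mul_sum]
    refine Finset.sum_congr rfl fun x _ => ?_
    linear_combination (η * g x ^ 2) * hs2 x
  rw [h2, h3] at h1
  linarith

end Spectral

/-! ### Marginal bounds, spectral independence and the local entropy inequality. -/

section Local

variable {V : Type u} [Fintype V] [DecidableEq V] {q : ℕ} {μ : (V → Fin q) → ℝ}

theorem cylinder_restrict (T : Finset V) (σ : V → Fin q) :
    (cylinder fun v : T => σ v) = (fiber T σ : Set (V → Fin q)) := by
  ext ω
  simp [cylinder]

theorem prob_coe (s : Finset (V → Fin q)) : prob μ (s : Set (V → Fin q)) = ∑ ω ∈ s, μ ω := by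
  classical
  simp [prob, Set.indicator_apply]

theorem prob_inter_coe (E : Set (V → Fin q)) [DecidablePred (· ∈ E)] (s : Finset (V → Fin q)) :
    prob μ (E ∩ s) = ∑ ω ∈ s, if ω ∈ E then μ ω else 0 := by
  have : E ∩ (s : Set (V → Fin q)) = (s.filter (· ∈ E) : Finset (V → Fin q)) := by
    ext ω
    simp [and_comm]
  rw [this, prob_coe, Finset.sum_filter]

theorem isFeasible_restrict (hμ : ∀ σ, 0 ≤ μ σ) (T : Finset V) {σ : V → Fin q} (h : 0 < μ σ) :
    IsFeasible μ fun v : T => σ v := by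
  rw [IsFeasible, cylinder_restrict, prob_coe]
  exact fiber_sum_pos hμ T h

/-- Marginal boundedness in terms of fiber masses: revealing one more spin of a feasible
configuration loses at most a factor `b`. All later uses of the hypothesis pass through this form.
-/
theorem mul_fiber_sum_le (hμ : ∀ σ, 0 ≤ μ σ) {b : ℝ} (hb : MarginallyBounded μ b) {T : Finset V}
    {v : V} (hv : v ∉ T) {σ : V → Fin q} (h : 0 < μ σ) :
    b * ∑ ω ∈ fiber T σ, μ ω ≤ ∑ ω ∈ fiber (insert v T) σ, μ ω := by
  have hp := fiber_sum_pos hμ T h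
  have e : condProb μ (spinEvent v (σ v)) (cylinder fun v : T => σ v) =
      (∑ ω ∈ fiber (insert v T) σ, μ ω) / ∑ ω ∈ fiber T σ, μ ω := by
    have : spinEvent v (σ v) ∩ (fiber T σ : Set (V → Fin q)) = fiber (insert v T) σ := by
      ext ω
      simp [spinEvent]
    rw [condProb, cylinder_restrict, this, prob_coe, prob_coe]
  have := hb T (by rintro rfl; exact hv (Finset.mem_univ v)) _ (isFeasible_restrict hμ T h) v hv
    (σ v) (by
      rw [feasibleSpins, Set.mem_ofPred_eq, e]
      exact div_pos (fiber_sum_pos hμ _ h) hp)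
  rwa [e, le_div_iff₀ hp] at this

theorem le_one_of_marginallyBounded (hμ : ∀ σ, 0 ≤ μ σ) {b : ℝ} (hb : MarginallyBounded μ b)
    (v : V) {σ : V → Fin q} (h : 0 < μ σ) : b ≤ 1 := by
  have h1 := mul_fiber_sum_le hμ hb (Finset.notMem_empty v) h
  have h2 : ∑ ω ∈ fiber (insert v ∅) σ, μ ω ≤ ∑ ω ∈ fiber ∅ σ, μ ω :=
    Finset.sum_le_sum_of_subset_of_nonneg (fiber_anti (Finset.empty_subset _) σ)
      fun ω _ _ => hμ ω
  have h3 := fiber_sum_pos hμ ∅ h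
  by_contra! h4
  nlinarith

/-- Revealing one spin decreases the numerator, and decreases the denominator by at most the factor
`b`. -/
theorem cexp_insert_le (hμ : ∀ σ, 0 ≤ μ σ) {b : ℝ} (hb0 : 0 < b) (hb : MarginallyBounded μ b)
    {f : (V → Fin q) → ℝ} (hf : ∀ σ, 0 ≤ f σ) {T : Finset V} {v : V} (hv : v ∉ T)
    {σ : V → Fin q} (h : 0 < μ σ) : b * cexp μ (insert v T) f σ ≤ cexp μ T f σ := by
  have h1 := mul_fiber_sum_le hμ hb hv h
  have hp := fiber_sum_pos hμ T h
  have h2 : ∑ ω ∈ fiber (insert v T) σ, μ ω * f ω ≤ ∑ ω ∈ fiber T σ, μ ω * f ω :=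
    Finset.sum_le_sum_of_subset_of_nonneg (fiber_anti (Finset.subset_insert _ _) σ)
      fun ω _ _ => mul_nonneg (hμ ω) (hf ω)
  have h3 : 0 ≤ ∑ ω ∈ fiber (insert v T) σ, μ ω * f ω :=
    Finset.sum_nonneg fun ω _ => mul_nonneg (hμ ω) (hf ω)
  calc b * cexp μ (insert v T) f σ
      ≤ b * ((∑ ω ∈ fiber (insert v T) σ, μ ω * f ω) / (b * ∑ ω ∈ fiber T σ, μ ω)) :=
        mul_le_mul_of_nonneg_left (div_le_div_of_nonneg_left h3 (mul_pos hb0 hp) h1) hb0.le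
    _ = (∑ ω ∈ fiber (insert v T) σ, μ ω * f ω) / ∑ ω ∈ fiber T σ, μ ω := by
        field_simp
    _ ≤ _ := div_le_div_of_nonneg_right h2 hp.le

/-- Spectral independence as a bound on covariances of centred single-site functions. -/
theorem sum_covariance_le (hμ : ∀ σ, 0 ≤ μ σ) {η : ℝ} (hη : SpectrallyIndependent μ η)
    {T : Finset V} (hT : T ≠ Finset.univ) {σ : V → Fin q} (h : 0 < μ σ) (φ : V → Fin q → ℝ)
    (hφ : ∀ u ∉ T, ∑ ω ∈ fiber T σ, μ ω * φ u (ω u) = 0) :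
    ∑ u ∈ Tᶜ, ∑ v ∈ Tᶜ.erase u, ∑ ω ∈ fiber T σ, μ ω * (φ u (ω u) * φ v (ω v)) ≤
      η * ∑ u ∈ Tᶜ, ∑ ω ∈ fiber T σ, μ ω * φ u (ω u) ^ 2 := by
  classical
  set τ : T → Fin q := fun v => σ v with hτ
  set Z : ℝ := ∑ ω ∈ fiber T σ, μ ω with hZ
  have hZ0 : 0 < Z := fiber_sum_pos hμ T h
  -- Unnormalised one-site and two-site marginals on the fiber.
  let w : V × Fin q → ℝ := fun p => ∑ ω ∈ fiber T σ, if ω p.1 = p.2 then μ ω else 0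
  let J : V × Fin q → V × Fin q → ℝ := fun p r =>
    ∑ ω ∈ fiber T σ, if ω p.1 = p.2 ∧ ω r.1 = r.2 then μ ω else 0
  have hJsymm : ∀ p r, J p r = J r p := fun p r => by simp only [J, and_comm]
  have hw0 : ∀ p, 0 ≤ w p := fun p => Finset.sum_nonneg fun ω _ => by
    split_ifs <;> simp [hμ]
  have hJ0 : ∀ p r, 0 ≤ J p r := fun p r => Finset.sum_nonneg fun ω _ => by
    split_ifs <;> simp [hμ]
  have hJw : ∀ p r, J p r ≤ w p := fun p r => Finset.sum_le_sum fun ω _ => by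
    split_ifs with h1 h2 h2
    · exact le_rfl
    · exact absurd h1.1 h2
    · exact hμ ω
    · exact le_rfl
  have e1 : ∀ p : V × Fin q, prob μ (spinEvent p.1 p.2 ∩ cylinder τ) = w p := by
    intro p
    rw [hτ, cylinder_restrict, prob_inter_coe]
    exact Finset.sum_congr rfl fun ω _ => if_congr (by simp [spinEvent]) rfl rfl
  have e2 : ∀ p r : V × Fin q,
      prob μ (spinEvent r.1 r.2 ∩ (spinEvent p.1 p.2 ∩ cylinder τ)) = J p r := by
    intro p r
    rw [hτ, cylinder_restrict, ← Set.inter_assoc, prob_inter_coe]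
    exact Finset.sum_congr rfl fun ω _ => if_congr (by simp [spinEvent, and_comm]) rfl rfl
  have e3 : prob μ (cylinder τ) = Z := by rw [hτ, cylinder_restrict, prob_coe]
  have hfeas : ∀ p : V × Fin q, p.2 ∈ feasibleSpins μ τ p.1 ↔ 0 < w p := by
    intro p
    rw [feasibleSpins, Set.mem_ofPred_eq, condProb, e1, e3]
    exact div_pos_iff_of_pos_right hZ0
  -- Weighted by `w`, the influence matrix becomes the covariance matrix of spin indicators with its
  -- same-site blocks removed; this is symmetric, so `quadratic_form_le` applies.
  have hM : ∀ x y : InfluenceIndex μ τ, w x.1 * influenceMatrix μ τ x y =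
      if x.1.1 = y.1.1 then 0 else J x.1 y.1 - w x.1 * w y.1 / Z := by
    intro x y
    have hx : w x.1 ≠ 0 := ((hfeas _).1 x.2.2).ne'
    simp only [influenceMatrix, condProb, e1, e2, e3]
    split_ifs
    · simp
    · field_simp
  have key := quadratic_form_le (influenceMatrix μ τ) (w := fun x => w x.1)
    (fun x => (hfeas _).1 x.2.2)
    (fun x y => by
      rw [hM, hM]
      by_cases hxy : x.1.1 = y.1.1
      · simp [hxy]
      · rw [if_neg hxy, if_neg (Ne.symm hxy), hJsymm, mul_comm (w x.1)])
    (η := η) (by convert hη T hT τ (isFeasible_restrict hμ T h)) (fun x => φ x.1.1 x.1.2)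
  simp only [hM] at key
  -- Infeasible pairs carry zero mass, so sums over the index set extend to all pairs with vertex
  -- outside `T`.
  have hsub : ∀ F : V × Fin q → ℝ, (∀ p, p.1 ∉ T → w p = 0 → F p = 0) →
      ∑ x : InfluenceIndex μ τ, F x.1 = ∑ u ∈ Tᶜ, ∑ i, F (u, i) := by
    intro F hF
    rw [← Finset.sum_product' (Tᶜ) Finset.univ fun u i => F (u, i)]
    rw [← Finset.sum_subset (s₁ := Finset.univ.filter fun p : V × Fin q =>
      p.1 ∉ T ∧ p.2 ∈ feasibleSpins μ τ p.1) (fun p hp => by simp_all) fun p hp hp' => ?_]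
    · exact (Finset.sum_subtype _ (by simp) F).symm
    · have hp1 : p.1 ∉ T := by simpa using hp
      refine hF p hp1 (le_antisymm (not_lt.1 fun h => hp' ?_) (hw0 p))
      simpa [hp1] using (hfeas p).2 h
  have hi : ∀ (u : V) (F : Fin q → ℝ), ∑ i, w (u, i) * F i = ∑ ω ∈ fiber T σ, μ ω * F (ω u) := by
    intro u F
    simp only [w, Finset.sum_mul]
    rw [Finset.sum_comm]
    refine Finset.sum_congr rfl fun ω _ => ?_
    simp
  have hij : ∀ (u v : V) (F F' : Fin q → ℝ), ∑ i, ∑ j, J (u, i) (v, j) * (F i * F' j) =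
      ∑ ω ∈ fiber T σ, μ ω * (F (ω u) * F' (ω v)) := by
    intro u v F F'
    simp only [J, Finset.sum_mul]
    rw [Finset.sum_congr rfl fun i _ => Finset.sum_comm, Finset.sum_comm]
    refine Finset.sum_congr rfl fun ω _ => ?_
    rw [Finset.sum_eq_single (ω u) (fun i _ hi => Finset.sum_eq_zero fun j _ => by
      simp [Ne.symm hi]) (by simp), Finset.sum_eq_single (ω v) (fun j _ hj => by
      simp [Ne.symm hj]) (by simp)]
    simp
  have hJz : ∀ p r, w p = 0 → J p r = 0 := fun p r h0 => le_antisymm (h0 ▸ hJw p r) (hJ0 p r)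
  -- Since `φ u` is centred, the product-of-marginals part of the covariance drops out.
  have e4 : ∀ u ∈ Tᶜ, ∀ v ∈ Tᶜ, u ≠ v → ∑ i, ∑ j, (J (u, i) (v, j) - w (u, i) * w (v, j) / Z) *
      (φ u i * φ v j) = ∑ ω ∈ fiber T σ, μ ω * (φ u (ω u) * φ v (ω v)) := by
    intro u hu v hv huv
    rw [← hij u v (φ u) (φ v)]
    have h1 : ∑ i, w (u, i) * φ u i = 0 := (hi u _).trans (hφ u (by simpa using hu))
    have h2 : ∑ i, ∑ j, w (u, i) * w (v, j) / Z * (φ u i * φ v j) = 0 := by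
      rw [← zero_mul (∑ j, w (v, j) * φ v j / Z), ← h1, Finset.sum_mul_sum]
      exact Finset.sum_congr rfl fun i _ => Finset.sum_congr rfl fun j _ => by ring
    simp only [sub_mul, Finset.sum_sub_distrib, h2, sub_zero]
  have e5 : ∑ x : InfluenceIndex μ τ, ∑ y : InfluenceIndex μ τ,
      (if x.1.1 = y.1.1 then 0 else J x.1 y.1 - w x.1 * w y.1 / Z) *
        (φ x.1.1 x.1.2 * φ y.1.1 y.1.2) =
      ∑ u ∈ Tᶜ, ∑ v ∈ Tᶜ.erase u, ∑ ω ∈ fiber T σ, μ ω * (φ u (ω u) * φ v (ω v)) := by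
    have h1 : ∀ x : V × Fin q, ∑ y : InfluenceIndex μ τ,
        (if x.1 = y.1.1 then 0 else J x y.1 - w x * w y.1 / Z) *
          (φ x.1 x.2 * φ y.1.1 y.1.2) = _ := fun x =>
      hsub (fun y => (if x.1 = y.1 then 0 else J x y - w x * w y / Z) * (φ x.1 x.2 * φ y.1 y.2))
        fun p _ hp => by simp [hJsymm x p, hJz p x hp, hp]
    rw [Finset.sum_congr rfl fun x _ => h1 x.1,
      hsub (fun x => ∑ v ∈ Tᶜ, ∑ j, (if x.1 = v then 0 else J x (v, j) - w x * w (v, j) / Z) *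
        (φ x.1 x.2 * φ v j)) fun p _ hp => by simp [hJz p _ hp, hp]]
    refine Finset.sum_congr rfl fun u hu => ?_
    rw [Finset.sum_comm, ← Finset.sum_erase _ (a := u) (by simp)]
    refine Finset.sum_congr rfl fun v hv => ?_
    rw [Finset.mem_erase] at hv
    rw [← e4 u hu v hv.2 hv.1.symm]
    simp only [if_neg hv.1.symm]
  have e6 : ∑ x : InfluenceIndex μ τ, w x.1 * φ x.1.1 x.1.2 ^ 2 =
      ∑ u ∈ Tᶜ, ∑ ω ∈ fiber T σ, μ ω * φ u (ω u) ^ 2 := by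
    rw [hsub (fun x => w x * φ x.1 x.2 ^ 2) fun p _ hp => by simp [hp]]
    exact Finset.sum_congr rfl fun u _ => hi u fun i => φ u i ^ 2
  rwa [e5, e6] at key

/-- Within a fiber over `T`, a function local on `insert u T` is a function of the spin at `u`
alone. This turns the increments `D u` into single-site functions to which `sum_covariance_le`
applies. -/
theorem isLocal_apply_update (T : Finset V) (u : V) {φ : (V → Fin q) → ℝ}
    (hφ : IsLocal (insert u T) φ) (hu : u ∉ T) {σ ω : V → Fin q} (h : ω ∈ fiber T σ) :
    φ (Function.update σ u (ω u)) = φ ω := by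
  refine hφ _ _ (mem_fiber.2 fun v hv => ?_)
  rcases Finset.mem_insert.1 hv with rfl | hvT
  · simp
  · rw [Function.update_of_ne (ne_of_mem_of_not_mem hvT hu), mem_fiber.1 h v hvT]

/-- The local entropy contraction: at the two levels above `T`, entropy is supermodular up to a
small multiple of the first level entropies. -/
theorem local_entropy_contraction (hμ : ∀ σ, 0 ≤ μ σ) {η b : ℝ}
    (hη : SpectrallyIndependent μ η) (hη0 : 0 ≤ η) (hb0 : 0 < b) (hb : MarginallyBounded μ b)
    {f : (V → Fin q) → ℝ} (hf : ∀ σ, 0 ≤ f σ) {T : Finset V} (hT : T ≠ Finset.univ) :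
    -(4 * η / b * ∑ u ∈ Tᶜ, (entOn μ f (insert u T) - entOn μ f T)) ≤
      ∑ u ∈ Tᶜ, ∑ v ∈ Tᶜ.erase u, (entOn μ f (insert v (insert u T)) - entOn μ f (insert u T) -
        entOn μ f (insert v T) + entOn μ f T) := by
  set F := cexp μ T f with hF
  set D : V → (V → Fin q) → ℝ := fun u σ => cexp μ (insert u T) f σ - F σ with hD
  have hF0 : ∀ σ, 0 ≤ F σ := cexp_nonneg hμ T hf
  have hDloc : ∀ u, IsLocal (insert u T) (D u) := fun u σ ω h => by
    simp only [hD, isLocal_cexp μ _ f σ ω h, hF,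
      (isLocal_cexp μ T f).mono (Finset.subset_insert u T) σ ω h]
  have hDsum : ∀ u σ, ∑ ω ∈ fiber T σ, μ ω * D u ω = 0 := fun u σ => by
    simp only [hD, mul_sub, Finset.sum_sub_distrib, sum_fiber_cexp hμ (Finset.subset_insert u T),
      hF, sum_fiber_cexp hμ (Finset.Subset.refl T), sub_self]
  have hDtot : ∀ u, ∑ ω, μ ω * D u ω = 0 := fun u => by
    simp only [hD, mul_sub, Finset.sum_sub_distrib, sum_cexp hμ, hF, sub_self]
  have h1 : ∀ u v, -∑ σ, μ σ * (D u σ * D v σ / F σ) ≤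
      entOn μ f (insert v (insert u T)) - entOn μ f (insert u T) -
        entOn μ f (insert v T) + entOn μ f T := by
    intro u v
    refine le_trans ?_ (entOn_supermodular hμ hf (A := T) (T := insert u T) (T' := insert v T)
      (B := insert v (insert u T)) ((Finset.subset_insert _ _).trans (Finset.subset_insert _ _))
      (Finset.subset_insert _ _) (Finset.insert_subset_insert _ (Finset.subset_insert _ _)))
    have h2 : ∑ σ, μ σ * (cexp μ (insert u T) f σ * cexp μ (insert v T) f σ / cexp μ T f σ) ≤
        ∑ σ, μ σ * (F σ + D u σ + D v σ + D u σ * D v σ / F σ) := by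
      refine Finset.sum_le_sum fun σ _ => mul_le_mul_of_nonneg_left ?_ (hμ σ)
      -- For `F > 0` this is the exact expansion of `(F + D u)(F + D v) / F`. For `F = 0` both
      -- quotients are `0` by convention, and `D u`, `D v` are nonnegative.
      rcases (hF0 σ).eq_or_lt with h0 | h0
      · have hu := cexp_nonneg hμ (insert u T) hf σ
        have hv := cexp_nonneg hμ (insert v T) hf σ
        rw [← hF, ← h0]
        simp only [hD, ← h0, div_zero]
        linarith
      · apply le_of_eq
        simp only [hD, ← hF]
        have := h0.ne'
        field_simp
        ring
    have h3 : ∑ σ, μ σ * (F σ + D u σ + D v σ + D u σ * D v σ / F σ) =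
        ∑ σ, μ σ * f σ + ∑ σ, μ σ * (D u σ * D v σ / F σ) := by
      simp only [mul_add, Finset.sum_add_distrib, hDtot, hF, sum_cexp hμ, add_zero]
    linarith
  have h2 : ∑ σ, μ σ * (∑ u ∈ Tᶜ, ∑ v ∈ Tᶜ.erase u, D u σ * D v σ / F σ) ≤
      ∑ σ, μ σ * (η * ∑ u ∈ Tᶜ, D u σ ^ 2 / F σ) := by
    refine sum_le_sum_of_fiber hμ T fun σ hσ => ?_
    have hc := sum_covariance_le hμ hη hT hσ (fun u i => D u (Function.update σ u i)) (by
      intro u hu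
      rw [← hDsum u σ]
      exact Finset.sum_congr rfl fun ω hω => by rw [isLocal_apply_update T u (hDloc u) hu hω])
    -- `F` is constant on the fiber, so dividing by its value at `σ` introduces the weight `1 / F`
    -- under the sums.
    have hc' := div_le_div_of_nonneg_right hc (hF0 σ)
    refine (le_of_eq ?_).trans (hc'.trans (le_of_eq ?_))
    · rw [Finset.sum_div]
      simp only [Finset.mul_sum]
      rw [Finset.sum_comm]
      refine Finset.sum_congr rfl fun u hu => ?_
      rw [Finset.sum_comm, Finset.sum_div]
      refine Finset.sum_congr rfl fun v hv => ?_
      rw [Finset.sum_div]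
      refine Finset.sum_congr rfl fun ω hω => ?_
      rw [isLocal_apply_update T u (hDloc u) (by simpa using hu) hω,
        isLocal_apply_update T v (hDloc v) (by simpa using Finset.mem_of_mem_erase hv) hω,
        hF, isLocal_cexp μ T f σ ω hω]
      ring
    · rw [mul_div_assoc, Finset.sum_div]
      simp only [Finset.mul_sum]
      rw [Finset.sum_comm]
      refine Finset.sum_congr rfl fun u hu => ?_
      rw [Finset.sum_div, Finset.mul_sum]
      refine Finset.sum_congr rfl fun ω hω => ?_
      rw [isLocal_apply_update T u (hDloc u) (by simpa using hu) hω, hF,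
        isLocal_cexp μ T f σ ω hω]
      ring
  have h3 : ∀ u ∈ Tᶜ, ∑ σ, μ σ * (D u σ ^ 2 / F σ) ≤
      4 / b * (entOn μ f (insert u T) - entOn μ f T) := by
    intro u hu
    refine le_trans ?_ (mul_le_mul_of_nonneg_left
      (hellinger_le_entOn_sub hμ hf (Finset.subset_insert u T)) (by positivity))
    rw [Finset.mul_sum]
    refine Finset.sum_le_sum fun σ _ => ?_
    rcases (hμ σ).eq_or_lt with h0 | h0
    · simp [← h0]
    rw [mul_left_comm]
    refine mul_le_mul_of_nonneg_left ?_ (hμ σ)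
    rcases (hF0 σ).eq_or_lt with hF1 | hF1
    · rw [← hF1, div_zero]
      positivity
    rw [div_le_iff₀ hF1]
    have hle := cexp_insert_le hμ hb0 hb hf (by simpa using hu : u ∉ T) h0
    have hb1 := le_one_of_marginallyBounded hμ hb u h0
    simp only [hD]
    rw [← hF] at hle ⊢
    have hx := Real.sq_sqrt (cexp_nonneg hμ (insert u T) hf σ)
    have hy := Real.sq_sqrt (hF0 σ)
    set x := √(cexp μ (insert u T) f σ)
    set y := √(F σ)
    -- From `b x² ≤ y²` and `b ≤ 1`: `b (x + y)² ≤ 2 b x² + 2 b y² ≤ 4 y²`. This is the source of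
    -- the `4 / b` in `κ`.
    have h4 : b * (x + y) ^ 2 ≤ 4 * F σ := by
      nlinarith [sq_nonneg (x - y), mul_le_mul_of_nonneg_right hb1 (sq_nonneg y)]
    have h5 : (x + y) ^ 2 ≤ 4 / b * F σ := by
      rw [div_mul_eq_mul_div, le_div_iff₀ hb0]
      linarith
    calc (cexp μ (insert u T) f σ - F σ) ^ 2 = (x - y) ^ 2 * (x + y) ^ 2 := by
          rw [← hx, ← hy]; ring
      _ ≤ (x - y) ^ 2 * (4 / b * F σ) := mul_le_mul_of_nonneg_left h5 (sq_nonneg _)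
      _ = _ := by ring
  have h4 : ∑ u ∈ Tᶜ, ∑ v ∈ Tᶜ.erase u, ∑ σ, μ σ * (D u σ * D v σ / F σ) ≤
      4 * η / b * ∑ u ∈ Tᶜ, (entOn μ f (insert u T) - entOn μ f T) := by
    calc _ = ∑ σ, μ σ * (∑ u ∈ Tᶜ, ∑ v ∈ Tᶜ.erase u, D u σ * D v σ / F σ) := by
          simp only [Finset.mul_sum]
          rw [Finset.sum_comm (s := Finset.univ)]
          exact Finset.sum_congr rfl fun u _ => Finset.sum_comm
      _ ≤ _ := h2
      _ = η * ∑ u ∈ Tᶜ, ∑ σ, μ σ * (D u σ ^ 2 / F σ) := by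
          simp only [Finset.mul_sum]
          rw [Finset.sum_comm]
          exact Finset.sum_congr rfl fun u _ => Finset.sum_congr rfl fun σ _ => by ring
      _ ≤ η * ∑ u ∈ Tᶜ, 4 / b * (entOn μ f (insert u T) - entOn μ f T) :=
          mul_le_mul_of_nonneg_left (Finset.sum_le_sum h3) hη0
      _ = _ := by rw [← Finset.mul_sum]; ring
  refine (neg_le_neg h4).trans ?_
  rw [← Finset.sum_neg_distrib]
  refine Finset.sum_le_sum fun u _ => ?_
  rw [← Finset.sum_neg_distrib]
  exact Finset.sum_le_sum fun v _ => h1 u v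

end Local

/-! ### From second differences to uniformly random blocks. -/

section Averaging

/-- A discrete Grönwall inequality: a sequence whose successive ratios are at most
`j / (j - κ)` has partial sums which grow polynomially. -/
theorem sum_range_le_of_ratio {e : ℕ → ℝ} {n N l : ℕ} {κ : ℝ} (hκ : 0 ≤ κ) (hN : κ + 1 ≤ N)
    (he : ∀ j < n, 0 ≤ e j) (hr : ∀ j, j + 1 < n → ((j : ℝ) + 1 - κ) * e (j + 1) ≤ (j + 1) * e j)
    (hl : N < l) (hln : l ≤ n) :
    ∑ i ∈ Finset.range n, e i ≤
      (((n : ℝ) - N) / (l - N)) ^ N * ∑ i ∈ Finset.range l, e i := by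
  have hR : ∀ j ≤ n, 0 ≤ ∑ i ∈ Finset.range j, e i := fun j hj =>
    Finset.sum_nonneg fun i hi => he i ((Finset.mem_range.1 hi).trans_le hj)
  -- Each term is at most `N / (j - N)` times the preceding partial sum. The induction starts at `j
  -- = N`, where the left side vanishes.
  have h1 : ∀ j, N ≤ j → j < n → ((j : ℝ) - N) * e j ≤ N * ∑ i ∈ Finset.range j, e i := by
    intro j hj
    induction j, hj using Nat.le_induction with
    | base =>
      intro h
      rw [sub_self, zero_mul]
      exact mul_nonneg (Nat.cast_nonneg _) (hR N h.le)
    | succ j hj ih =>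
      intro h
      have ih := ih (by omega)
      have hr := hr j h
      have hj' : (N : ℝ) ≤ j := by exact_mod_cast hj
      have he0 := he j (by omega)
      rw [Finset.sum_range_succ]
      push_cast
      have hpos : 0 < (j : ℝ) + 1 - κ := by linarith
      refine le_of_mul_le_mul_left ?_ hpos
      have hx : 0 ≤ (j : ℝ) + 1 - N := by linarith
      -- Here `N ≥ κ + 1` enters: the recursion then gives `(j + 1 - N) e (j + 1) ≤ j e j`, split as
      -- `(j - N) e j + N e j`.
      have h2 : ((j : ℝ) + 1 - N) * (j + 1) ≤ (j - N + N) * (j + 1 - κ) := by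
        nlinarith [mul_nonneg hx (by linarith : 0 ≤ (N : ℝ) - κ - 1)]
      nlinarith [mul_le_mul_of_nonneg_left hr hx, mul_le_mul_of_nonneg_right h2 he0,
        mul_le_mul_of_nonneg_left ih hpos.le]
  have h2 : ∀ j, l ≤ j → j ≤ n → ∑ i ∈ Finset.range j, e i ≤
      (((j : ℝ) - N) / (l - N)) ^ N * ∑ i ∈ Finset.range l, e i := by
    have hl' : (N : ℝ) < l := by exact_mod_cast hl
    intro j hj
    induction j, hj using Nat.le_induction with
    | base =>
      intro _
      rw [div_self (by linarith), one_pow, one_mul]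
    | succ j hj ih =>
      intro h
      have ih := ih (by omega)
      have h1 := h1 j (by omega) (by omega)
      have hj' : (l : ℝ) ≤ j := by exact_mod_cast hj
      have hpos : 0 < (j : ℝ) - N := by linarith
      -- Bernoulli turns the growth factor `1 + N / (j - N)` into an `N`-th power whose product over
      -- `j` telescopes.
      have hb := one_add_mul_le_pow (a := 1 / ((j : ℝ) - N))
        (by have : 0 < 1 / ((j : ℝ) - N) := by positivity
            linarith) N
      have h3 : 1 + 1 / ((j : ℝ) - N) = (j + 1 - N) / (j - N) := by
        field_simp
        ring
      rw [Finset.sum_range_succ]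
      calc _ ≤ ∑ i ∈ Finset.range j, e i + N * (∑ i ∈ Finset.range j, e i) / (j - N) := by
            gcongr
            rw [le_div_iff₀ hpos]
            linarith
        _ = (1 + N * (1 / ((j : ℝ) - N))) * ∑ i ∈ Finset.range j, e i := by ring
        _ ≤ (((j : ℝ) + 1 - N) / (j - N)) ^ N * ∑ i ∈ Finset.range j, e i := by
            rw [← h3]
            exact mul_le_mul_of_nonneg_right hb (hR j (by omega))
        _ ≤ (((j : ℝ) + 1 - N) / (j - N)) ^ N *
              ((((j : ℝ) - N) / (l - N)) ^ N * ∑ i ∈ Finset.range l, e i) := by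
            refine mul_le_mul_of_nonneg_left ih (pow_nonneg (div_nonneg ?_ hpos.le) _)
            linarith
        _ = _ := by
            rw [← mul_assoc, ← mul_pow, div_mul_div_cancel₀ hpos.ne']
            push_cast
            rfl
  exact h2 n hln le_rfl

variable {V : Type u} [Fintype V]

/-- Double counting of pairs `(T, u)` with `u ∉ T` against pairs `(S, u)` with `u ∈ S`. -/
theorem sum_powersetCard_insert [DecidableEq V] (k : ℕ) (F : Finset V → ℝ) :
    ∑ T ∈ Finset.powersetCard k Finset.univ, ∑ u ∈ Tᶜ, F (insert u T) =
      (k + 1) * ∑ S ∈ Finset.powersetCard (k + 1) Finset.univ, F S := by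
  have h1 : ∑ S ∈ Finset.powersetCard (k + 1) (Finset.univ : Finset V), ∑ _u ∈ S, F S =
      (k + 1) * ∑ S ∈ Finset.powersetCard (k + 1) Finset.univ, F S := by
    rw [Finset.mul_sum]
    refine Finset.sum_congr rfl fun S hS => ?_
    rw [Finset.sum_const, (Finset.mem_powersetCard.1 hS).2, nsmul_eq_mul]
    push_cast
    rfl
  rw [← h1, Finset.sum_sigma', Finset.sum_sigma']
  refine Finset.sum_nbij' (fun x => ⟨insert x.2 x.1, x.2⟩) (fun x => ⟨x.1.erase x.2, x.2⟩)
    ?_ ?_ ?_ ?_ ?_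
  · rintro ⟨T, u⟩ h
    simp only [Finset.mem_sigma, Finset.mem_powersetCard, Finset.subset_univ, true_and,
      Finset.mem_compl, Finset.mem_insert, true_or, and_true] at h ⊢
    rw [Finset.card_insert_of_notMem h.2, h.1]
  · rintro ⟨S, u⟩ h
    simp only [Finset.mem_sigma, Finset.mem_powersetCard, Finset.subset_univ, true_and,
      Finset.mem_compl, Finset.mem_erase, ne_eq, not_true_eq_false, false_and, not_false_eq_true,
      and_true] at h ⊢
    rw [Finset.card_erase_of_mem h.2, h.1, Nat.add_sub_cancel]
  · rintro ⟨T, u⟩ h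
    simp only [Finset.mem_sigma, Finset.mem_compl] at h
    simp [Finset.erase_insert h.2]
  · rintro ⟨S, u⟩ h
    simp only [Finset.mem_sigma] at h
    simp [Finset.insert_erase h.2]
  · rintro ⟨T, u⟩ _
    rfl

/-- The average of a set function over the sets with `k` elements. -/
noncomputable def levelAverage (F : Finset V → ℝ) (k : ℕ) : ℝ :=
  (∑ S ∈ Finset.powersetCard k Finset.univ, F S) / (Fintype.card V).choose k

theorem choose_mul_levelAverage (F : Finset V → ℝ) {k : ℕ} (h : k ≤ Fintype.card V) :
    ((Fintype.card V).choose k : ℝ) * levelAverage F k =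
      ∑ S ∈ Finset.powersetCard k Finset.univ, F S := by
  have : ((Fintype.card V).choose k : ℝ) ≠ 0 := by exact_mod_cast (Nat.choose_pos h).ne'
  rw [levelAverage, mul_div_cancel₀ _ this]

/-- Averaging a local inequality for second differences over all sets of a given size. -/
theorem levelAverage_second_difference [DecidableEq V] {F : Finset V → ℝ} {κ : ℝ} {k j : ℕ}
    (hk : k + 2 + j = Fintype.card V)
    (h : ∀ T : Finset V, T.card = k → -(κ * ∑ u ∈ Tᶜ, (F (insert u T) - F T)) ≤
      ∑ u ∈ Tᶜ, ∑ v ∈ Tᶜ.erase u, (F (insert v (insert u T)) - F (insert u T) -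
        F (insert v T) + F T)) :
    ((j : ℝ) + 1 - κ) * (levelAverage F (k + 1) - levelAverage F k) ≤
      (j + 1) * (levelAverage F (k + 2) - levelAverage F (k + 1)) := by
  -- Here `j` counts levels from the top, so `T` misses `j + 2` vertices.
  have hcard : ∀ T : Finset V, T.card = k → (Tᶜ.card : ℝ) = j + 2 := by
    intro T hT
    have : Tᶜ.card = j + 2 := by rw [Finset.card_compl]; omega
    rw [this]; push_cast; rfl
  have hcard' : ∀ T : Finset V, T.card = k → ∀ u ∈ Tᶜ, ((Tᶜ.erase u).card : ℝ) = j + 1 := by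
    intro T hT u hu
    have : (Tᶜ.erase u).card = j + 1 := by
      rw [Finset.card_erase_of_mem hu, Finset.card_compl]; omega
    rw [this]; push_cast; rfl
  have hsum := Finset.sum_le_sum fun T (hT : T ∈ Finset.powersetCard k (Finset.univ : Finset V)) =>
    h T (Finset.mem_powersetCard.1 hT).2
  set A : ℕ → ℝ := fun i => ∑ S ∈ Finset.powersetCard i (Finset.univ : Finset V), F S with hA
  have e1 : ∑ T ∈ Finset.powersetCard k (Finset.univ : Finset V),
      -(κ * ∑ u ∈ Tᶜ, (F (insert u T) - F T)) = -(κ * ((k + 1) * A (k + 1) - (j + 2) * A k)) := by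
    rw [Finset.sum_neg_distrib, ← Finset.mul_sum, ← sum_powersetCard_insert, hA, Finset.mul_sum _ _
      ((j : ℝ) + 2), ← Finset.sum_sub_distrib]
    congr 2
    refine Finset.sum_congr rfl fun T hT => ?_
    rw [Finset.sum_sub_distrib, Finset.sum_const, nsmul_eq_mul,
      hcard T (Finset.mem_powersetCard.1 hT).2]
  have e2 : ∑ T ∈ Finset.powersetCard k (Finset.univ : Finset V), ∑ u ∈ Tᶜ, ∑ v ∈ Tᶜ.erase u,
      (F (insert v (insert u T)) - F (insert u T) - F (insert v T) + F T) =
      (k + 1) * ((k + 2) * A (k + 2)) - 2 * ((j + 1) * ((k + 1) * A (k + 1))) +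
        (j + 2) * (j + 1) * A k := by
    have f1 : ∑ T ∈ Finset.powersetCard k (Finset.univ : Finset V), ∑ u ∈ Tᶜ, ∑ v ∈ Tᶜ.erase u,
        F (insert v (insert u T)) = (k + 1) * ((k + 2) * A (k + 2)) := by
      have g1 := sum_powersetCard_insert k fun S : Finset V => ∑ v ∈ Sᶜ, F (insert v S)
      rw [sum_powersetCard_insert (k + 1)] at g1
      simp only [Finset.compl_insert] at g1
      rw [g1]
      push_cast
      rw [add_assoc (k : ℝ) 1 1, one_add_one_eq_two]
    have f2 : ∑ T ∈ Finset.powersetCard k (Finset.univ : Finset V), ∑ u ∈ Tᶜ, ∑ v ∈ Tᶜ.erase u,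
        F (insert u T) = (j + 1) * ((k + 1) * A (k + 1)) := by
      rw [← sum_powersetCard_insert, Finset.mul_sum]
      refine Finset.sum_congr rfl fun T hT => ?_
      rw [Finset.mul_sum]
      refine Finset.sum_congr rfl fun u hu => ?_
      rw [Finset.sum_const, nsmul_eq_mul, hcard' T (Finset.mem_powersetCard.1 hT).2 u hu]
    have f3 : ∑ T ∈ Finset.powersetCard k (Finset.univ : Finset V), ∑ u ∈ Tᶜ, ∑ v ∈ Tᶜ.erase u,
        F (insert v T) = (j + 1) * ((k + 1) * A (k + 1)) := by
      rw [← f2]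
      refine Finset.sum_congr rfl fun T _ => Finset.sum_comm' fun u v => ?_
      simp only [Finset.mem_erase]
      tauto
    have f4 : ∑ T ∈ Finset.powersetCard k (Finset.univ : Finset V), ∑ u ∈ Tᶜ, ∑ v ∈ Tᶜ.erase u,
        F T = (j + 2) * (j + 1) * A k := by
      rw [hA, Finset.mul_sum]
      refine Finset.sum_congr rfl fun T hT => ?_
      have hT := (Finset.mem_powersetCard.1 hT).2
      rw [Finset.sum_congr rfl fun u hu => by
        rw [Finset.sum_const, nsmul_eq_mul, hcard' T hT u hu], Finset.sum_const, nsmul_eq_mul,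
        hcard T hT]
      ring
    simp only [Finset.sum_add_distrib, Finset.sum_sub_distrib, f1, f2, f3, f4]
    ring
  rw [e1, e2] at hsum
  set c : ℕ → ℝ := fun i => ((Fintype.card V).choose i : ℝ) with hc
  have hAc : ∀ i ≤ k + 2, A i = c i * levelAverage F i := fun i hi =>
    (choose_mul_levelAverage F (by omega)).symm
  -- The ratios of consecutive binomials make every level sum a multiple of `(j + 2) c k`, which is
  -- cancelled at the end, leaving `-κ (a1 - a0) ≤ (j + 1) (a2 - 2 a1 + a0)`.
  have hc1 : ((k : ℝ) + 1) * c (k + 1) = (j + 2) * c k := by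
    have := Nat.choose_succ_right_eq (Fintype.card V) k
    rw [show Fintype.card V - k = j + 2 by omega] at this
    have h' : (((Fintype.card V).choose (k + 1) * (k + 1) : ℕ) : ℝ) =
        ((Fintype.card V).choose k * (j + 2) : ℕ) := by rw [this]
    push_cast at h'
    simp only [hc]
    linarith
  have hc2 : ((k : ℝ) + 2) * c (k + 2) = (j + 1) * c (k + 1) := by
    have := Nat.choose_succ_right_eq (Fintype.card V) (k + 1)
    rw [show Fintype.card V - (k + 1) = j + 1 by omega] at this
    have h' : (((Fintype.card V).choose (k + 1 + 1) * (k + 1 + 1) : ℕ) : ℝ) =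
        ((Fintype.card V).choose (k + 1) * (j + 1) : ℕ) := by rw [this]
    push_cast at h'
    simp only [hc]
    linarith
  have hc0 : 0 < c k := by
    simp only [hc]
    exact_mod_cast Nat.choose_pos (by omega)
  rw [hAc k (by omega), hAc (k + 1) (by omega), hAc (k + 2) le_rfl] at hsum
  set a0 := levelAverage F k
  set a1 := levelAverage F (k + 1)
  set a2 := levelAverage F (k + 2)
  have g1 : (k + 1) * ((k + 2) * (c (k + 2) * a2)) = (j + 1) * (j + 2) * c k * a2 := by
    linear_combination ((k : ℝ) + 1) * a2 * hc2 + (j + 1) * a2 * hc1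
  have g2 : (k + 1) * (c (k + 1) * a1) = (j + 2) * c k * a1 := by
    linear_combination a1 * hc1
  rw [g1, g2] at hsum
  have hp : 0 < ((j : ℝ) + 2) * c k := by positivity
  refine le_of_mul_le_mul_left ?_ hp
  linarith

/-- From a local inequality for second differences of a monotone set function to a comparison of
the global increment with the average increment over the last `l` elements. -/
theorem increment_le_block_increment [DecidableEq V] {F : Finset V → ℝ} (hmono : Monotone F) {κ : ℝ} (hκ : 0 ≤ κ)
    {N l : ℕ} (hN : κ + 1 ≤ N) (hl : N < l) (hln : l ≤ Fintype.card V)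
    (h : ∀ T : Finset V, T ≠ Finset.univ → -(κ * ∑ u ∈ Tᶜ, (F (insert u T) - F T)) ≤
      ∑ u ∈ Tᶜ, ∑ v ∈ Tᶜ.erase u, (F (insert v (insert u T)) - F (insert u T) -
        F (insert v T) + F T)) :
    F Finset.univ - F ∅ ≤ (((Fintype.card V : ℝ) - N) / (l - N)) ^ N *
      ((∑ S ∈ Finset.powersetCard l Finset.univ, (F Finset.univ - F Sᶜ)) /
        (Fintype.card V).choose l) := by
  set n := Fintype.card V with hn
  set e : ℕ → ℝ := fun j => levelAverage F (n - j) - levelAverage F (n - (j + 1)) with he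
  have hmonoavg : ∀ k < n, levelAverage F k ≤ levelAverage F (k + 1) := by
    intro k hk
    have hs := sum_powersetCard_insert k F
    rw [← choose_mul_levelAverage F (by omega), ← mul_assoc] at hs
    have hc : ((k : ℝ) + 1) * (n.choose (k + 1) : ℝ) = n.choose k * (n - k : ℕ) := by
      have h' : ((n.choose (k + 1) * (k + 1) : ℕ) : ℝ) = (n.choose k * (n - k) : ℕ) := by
        rw [Nat.choose_succ_right_eq]
      push_cast at h' ⊢
      linarith
    rw [hc] at hs
    have hle : ∑ T ∈ Finset.powersetCard k (Finset.univ : Finset V), ∑ u ∈ Tᶜ, F T ≤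
        ∑ T ∈ Finset.powersetCard k Finset.univ, ∑ u ∈ Tᶜ, F (insert u T) :=
      Finset.sum_le_sum fun T _ => Finset.sum_le_sum fun u _ => hmono (Finset.subset_insert _ _)
    have hconst : ∑ T ∈ Finset.powersetCard k (Finset.univ : Finset V), ∑ u ∈ Tᶜ, F T =
        n.choose k * (n - k : ℕ) * levelAverage F k := by
      rw [mul_right_comm, choose_mul_levelAverage F (by omega), Finset.sum_mul]
      refine Finset.sum_congr rfl fun T hT => ?_
      rw [Finset.sum_const, Finset.card_compl, (Finset.mem_powersetCard.1 hT).2, nsmul_eq_mul,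
        mul_comm]
    rw [hs, hconst] at hle
    refine le_of_mul_le_mul_left hle (mul_pos ?_ ?_)
    · exact_mod_cast Nat.choose_pos (by omega)
    · exact_mod_cast (by omega)
  have hRe : ∀ j, ∑ i ∈ Finset.range j, e i = levelAverage F n - levelAverage F (n - j) := by
    intro j
    rw [Finset.sum_range_sub' fun j => levelAverage F (n - j)]
    simp
  have hmain := sum_range_le_of_ratio (e := e) (n := n) hκ hN (fun j hj => by
      have := hmonoavg (n - (j + 1)) (by omega)
      rw [show n - (j + 1) + 1 = n - j by omega] at this
      simp only [he]
      linarith) (fun j hj => by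
      have := levelAverage_second_difference (F := F) (κ := κ) (k := n - (j + 2)) (j := j)
        (by omega) (fun T hT => h T (by
          rintro rfl
          rw [Finset.card_univ] at hT
          omega))
      rw [show n - (j + 2) + 1 = n - (j + 1) by omega, show n - (j + 2) + 2 = n - j by omega]
        at this
      exact this) hl hln
  have hn1 : levelAverage F n = F Finset.univ := by
    simp [levelAverage, hn, ← Finset.card_univ]
  have h01 : levelAverage F 0 = F ∅ := by simp [levelAverage]
  -- Complementation matches sets of size `n - l` with the blocks of size `l` left free.
  have hl1 : levelAverage F (n - l) =
      (∑ S ∈ Finset.powersetCard l Finset.univ, F Sᶜ) / n.choose l := by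
    rw [levelAverage, ← hn, Nat.choose_symm hln]
    congr 1
    refine Finset.sum_nbij' (fun S => Sᶜ) (fun S => Sᶜ) ?_ ?_ ?_ ?_ ?_
    · intro S hS
      simp only [Finset.mem_powersetCard, Finset.subset_univ, true_and, Finset.card_compl] at *
      omega
    · intro S hS
      simp only [Finset.mem_powersetCard, Finset.subset_univ, true_and, Finset.card_compl] at *
      omega
    · simp
    · simp
    · simp
  have hc0 : (n.choose l : ℝ) ≠ 0 := by exact_mod_cast (Nat.choose_pos hln).ne'
  rw [hRe, hRe, Nat.sub_self, hn1, h01, hl1] at hmain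
  have hfin : (∑ S ∈ Finset.powersetCard l Finset.univ, (F Finset.univ - F Sᶜ)) / n.choose l =
      F Finset.univ - (∑ S ∈ Finset.powersetCard l Finset.univ, F Sᶜ) / n.choose l := by
    rw [Finset.sum_sub_distrib, Finset.sum_const, Finset.card_powersetCard, Finset.card_univ, ← hn,
      nsmul_eq_mul, sub_div, mul_div_cancel_left₀ _ hc0]
  rw [hfin]
  exact hmain

end Averaging

/-! ### Crude block factorization from total-connectedness. -/

section Crude

/-- Any two vertices are joined by a path, which is shorter than the number of vertices; the
increments are summed along it. -/
theorem abs_sub_le_card_mul_of_connected {W : Type*} [Fintype W] {H : SimpleGraph W}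
    (hH : H.Connected) {g : W → ℝ} {M : ℝ} (hM0 : 0 ≤ M)
    (hM : ∀ x y, H.Adj x y → |g x - g y| ≤ M) (x y : W) :
    |g x - g y| ≤ Fintype.card W * M := by
  classical
  have hwalk : ∀ {x y : W} (p : H.Walk x y), |g x - g y| ≤ p.length * M := by
    intro x y p
    induction p with
    | nil => simp
    | @cons x z y hxz p ih =>
      rw [SimpleGraph.Walk.length_cons]
      push_cast
      have := abs_sub_le (g x) (g z) (g y)
      linarith [hM x z hxz]
  obtain ⟨p⟩ := hH.preconnected x y
  have hlt := (p.toPath).2.length_lt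
  refine (hwalk (p.toPath : H.Walk x y)).trans (mul_le_mul_of_nonneg_right ?_ hM0)
  exact_mod_cast hlt.le

variable {V : Type u} [Fintype V] [DecidableEq V] {q : ℕ} {μ : (V → Fin q) → ℝ}

/-- The chain rule: revealing the spins of `S` one at a time costs a factor `b` each, so a feasible
configuration has conditional probability at least `b ^ |S|`. -/
theorem pow_card_mul_fiber_sum_le (hμ : ∀ σ, 0 ≤ μ σ) {b : ℝ} (hb0 : 0 < b)
    (hb : MarginallyBounded μ b) (S : Finset V) {σ : V → Fin q} (h : 0 < μ σ) :
    b ^ S.card * ∑ ω ∈ fiber Sᶜ σ, μ ω ≤ μ σ := by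
  have key : ∀ U : Finset V, Disjoint U Sᶜ →
      b ^ U.card * ∑ ω ∈ fiber Sᶜ σ, μ ω ≤ ∑ ω ∈ fiber (U ∪ Sᶜ) σ, μ ω := by
    intro U
    induction U using Finset.induction_on with
    | empty => simp
    | @insert v U hv ih =>
      intro hd
      rw [Finset.disjoint_insert_left] at hd
      rw [Finset.card_insert_of_notMem hv, pow_succ', mul_assoc, Finset.insert_union]
      exact (mul_le_mul_of_nonneg_left (ih hd.2) hb0.le).trans (mul_fiber_sum_le hμ hb
        (by rw [Finset.mem_union]; exact fun h => h.elim hv hd.1) h)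
  have := key S disjoint_compl_right
  simpa [Finset.union_compl] using this

/-- The configuration which is `x` on `S` and `σ` elsewhere. -/
def glue (S : Finset V) (σ : V → Fin q) (x : S → Fin q) : V → Fin q :=
  fun v => if h : v ∈ S then x ⟨v, h⟩ else σ v

theorem glue_mem_fiber (S : Finset V) (σ : V → Fin q) (x : S → Fin q) :
    glue S σ x ∈ fiber Sᶜ σ :=
  mem_fiber.2 fun _ hv => dif_neg (Finset.mem_compl.1 hv)

theorem glue_restrict {S : Finset V} {σ ω : V → Fin q} (h : ω ∈ fiber Sᶜ σ) :
    glue S σ (fun v : S => ω v) = ω := by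
  funext v
  by_cases hv : v ∈ S
  · simp [glue, hv]
  · simp [glue, hv, mem_fiber.1 h v (Finset.mem_compl.2 hv)]

theorem mem_feasibleConfigs_iff (hμ : ∀ σ, 0 ≤ μ σ) {S : Finset V} {σ : V → Fin q} (h : 0 < μ σ)
    (x : S → Fin q) : x ∈ feasibleConfigs μ (fun v : (Sᶜ : Finset V) => σ v) S ↔
      0 < μ (glue S σ x) := by
  have e : (cylinder x ∩ (fiber Sᶜ σ : Set (V → Fin q))) =
      (({glue S σ x} : Finset (V → Fin q)) : Set (V → Fin q)) := by
    ext ω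
    simp only [cylinder, Set.mem_inter_iff, Set.mem_ofPred_eq, Finset.mem_coe,
      Finset.mem_singleton]
    constructor
    · rintro ⟨h1, h2⟩
      rw [← glue_restrict h2]
      congr 1
      exact funext h1
    · rintro rfl
      exact ⟨fun v => by simp [glue], glue_mem_fiber S σ x⟩
  rw [feasibleConfigs, Set.mem_ofPred_eq, condProb, cylinder_restrict, e, prob_coe, prob_coe,
    Finset.sum_singleton]
  exact div_pos_iff_of_pos_right (fiber_sum_pos hμ _ h)

/-- In a totally-connected distribution a function with small increments along single-site moves
varies little on every conditional support. -/
theorem abs_sub_le_of_totallyConnected (hμ : ∀ σ, 0 ≤ μ σ) (hc : TotallyConnected μ)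
    {S : Finset V} (hS : S.Nonempty) {σ : V → Fin q} (h : 0 < μ σ) {g : (V → Fin q) → ℝ} {M : ℝ}
    (hM0 : 0 ≤ M) (hM : ∀ v ∈ S, ∀ ω ∈ fiber Sᶜ σ, ∀ ω' ∈ fiber {v}ᶜ ω, 0 < μ ω → 0 < μ ω' →
      |g ω - g ω'| ≤ M) {ω ω' : V → Fin q} (hω : ω ∈ fiber Sᶜ σ) (hω' : ω' ∈ fiber Sᶜ σ)
    (h0 : 0 < μ ω) (h0' : 0 < μ ω') :
    |g ω - g ω'| ≤ ((fiber Sᶜ σ).filter fun ω => 0 < μ ω).card * M := by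
  classical
  have hconn := hc S hS _ (isFeasible_restrict hμ Sᶜ h)
  set W := feasibleConfigs μ (fun v : (Sᶜ : Finset V) => σ v) S with hW
  have hmem : ∀ x, x ∈ W ↔ 0 < μ (glue S σ x) := mem_feasibleConfigs_iff hμ h
  have hadj : ∀ x y : W, ((hammingGraph S q).induce W).Adj x y →
      |g (glue S σ x) - g (glue S σ y)| ≤ M := by
    intro x y hxy
    obtain ⟨v, -, hv⟩ : ∃! v, x.1 v ≠ y.1 v := hxy
    refine hM v v.2 _ (glue_mem_fiber S σ x) _ (mem_fiber.2 fun u hu => ?_) ((hmem _).1 x.2)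
      ((hmem _).1 y.2)
    by_cases huS : u ∈ S
    · simp only [glue, huS, dif_pos]
      by_contra hne
      have := hv ⟨u, huS⟩ (Ne.symm hne)
      rw [Finset.mem_compl, Finset.mem_singleton] at hu
      exact hu (congrArg Subtype.val this)
    · simp [glue, huS]
  have key := abs_sub_le_card_mul_of_connected hconn (g := fun x => g (glue S σ x)) hM0 hadj
    ⟨fun v : S => ω v, (hmem _).2 (by rwa [glue_restrict hω])⟩
    ⟨fun v : S => ω' v, (hmem _).2 (by rwa [glue_restrict hω'])⟩
  simp only [glue_restrict hω, glue_restrict hω'] at key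
  refine key.trans (mul_le_mul_of_nonneg_right ?_ hM0)
  have : Fintype.card W ≤ ((fiber Sᶜ σ).filter fun ω => 0 < μ ω).card := by
    rw [← Fintype.card_coe]
    refine Fintype.card_le_of_injective (fun x => ⟨glue S σ x.1, ?_⟩) ?_
    · exact Finset.mem_filter.2 ⟨glue_mem_fiber S σ x.1, (hmem _).1 x.2⟩
    · intro x y hxy
      refine Subtype.ext (funext fun v => ?_)
      have := congrFun (Subtype.ext_iff.1 hxy) v
      simpa [glue] using this
  exact_mod_cast this

/-- Each feasible configuration takes at least a fraction `b ^ |S|` of the conditional mass, so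
there are at most `b ^ (-|S|)` of them. -/
theorem pow_mul_card_support_le (hμ : ∀ σ, 0 ≤ μ σ) {b : ℝ} (hb0 : 0 < b)
    (hb : MarginallyBounded μ b) (S : Finset V) {σ : V → Fin q} (h : 0 < μ σ) :
    b ^ S.card * ((fiber Sᶜ σ).filter fun ω => 0 < μ ω).card ≤ 1 := by
  have hp := fiber_sum_pos hμ Sᶜ h
  refine le_of_mul_le_mul_right ?_ hp
  rw [one_mul, mul_right_comm, mul_comm, ← nsmul_eq_mul, ← Finset.sum_const]
  refine (Finset.sum_le_sum (g := μ) fun ω hω => ?_).trans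
    (Finset.sum_le_sum_of_subset_of_nonneg (Finset.filter_subset _ _) fun ω _ _ => hμ ω)
  rw [Finset.mem_filter] at hω
  rw [← fiber_eq hω.1]
  exact pow_card_mul_fiber_sum_le hμ hb0 hb S hω.2

/-- The relative entropy on a block is at most the oscillation of the square root of `f`. -/
theorem entOn_sub_le_oscillation (hμ : ∀ σ, 0 ≤ μ σ) {f : (V → Fin q) → ℝ} (hf : ∀ σ, 0 ≤ f σ)
    (A : Finset V) {D : (V → Fin q) → ℝ} (hD : IsLocal A D) (hD0 : ∀ σ, 0 ≤ D σ)
    (h : ∀ σ, 0 < μ σ → ∀ ω ∈ fiber A σ, 0 < μ ω → (√(f σ) - √(f ω)) ^ 2 ≤ D σ) :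
    entOn μ f Finset.univ - entOn μ f A ≤ 4 * ∑ σ, μ σ * D σ := by
  set F := cexp μ A f with hF
  have hF0 : ∀ σ, 0 ≤ F σ := cexp_nonneg hμ A hf
  -- Cauchy–Schwarz bounds `(f σ - F σ)²` by the conditional mean of `(f σ - f ω)²`, which factors
  -- as `(√(f σ) - √(f ω))² (√(f σ) + √(f ω))² ≤ 2 D (f σ + f ω)`.
  have hdev : ∀ σ, 0 < μ σ → (f σ - F σ) ^ 2 ≤ 2 * D σ * (f σ + F σ) := by
    intro σ hσ
    have hp := fiber_sum_pos hμ A hσ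
    set p := ∑ ω ∈ fiber A σ, μ ω with hpd
    have e1 : p * F σ = ∑ ω ∈ fiber A σ, μ ω * f ω := by
      rw [hF, cexp, mul_div_cancel₀ _ hp.ne']
    have e2 : ∑ ω ∈ fiber A σ, μ ω * (f σ - f ω) = p * (f σ - F σ) := by
      simp only [mul_sub, Finset.sum_sub_distrib, e1, ← Finset.sum_mul, ← hpd]
    have e3 : ∑ ω ∈ fiber A σ, μ ω * (2 * D σ * (f σ + f ω)) = p * (2 * D σ * (f σ + F σ)) := by
      have : ∀ ω, μ ω * (2 * D σ * (f σ + f ω)) =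
          2 * D σ * f σ * μ ω + 2 * D σ * (μ ω * f ω) := fun ω => by ring
      simp only [this, Finset.sum_add_distrib, ← Finset.mul_sum, ← e1, ← hpd]
      ring
    have hcs := Finset.sum_mul_sq_le_sq_mul_sq (fiber A σ) (fun ω => √(μ ω))
      (fun ω => √(μ ω) * (f σ - f ω))
    simp only [← mul_assoc, Real.mul_self_sqrt (hμ _), mul_pow, Real.sq_sqrt (hμ _)] at hcs
    rw [e2, ← hpd] at hcs
    have hle : ∑ ω ∈ fiber A σ, μ ω * (f σ - f ω) ^ 2 ≤
        ∑ ω ∈ fiber A σ, μ ω * (2 * D σ * (f σ + f ω)) := by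
      refine Finset.sum_le_sum fun ω hω => ?_
      rcases (hμ ω).eq_or_lt with h0 | h0
      · simp [← h0]
      refine mul_le_mul_of_nonneg_left ?_ (hμ ω)
      have hx := Real.sq_sqrt (hf σ)
      have hy := Real.sq_sqrt (hf ω)
      have hxy := h σ hσ ω hω h0
      set x := √(f σ)
      set y := √(f ω)
      calc (f σ - f ω) ^ 2 = (x - y) ^ 2 * (x + y) ^ 2 := by rw [← hx, ← hy]; ring
        _ ≤ D σ * (2 * (f σ + f ω)) :=
            mul_le_mul hxy (by nlinarith [sq_nonneg (x - y)]) (sq_nonneg _) (hD0 σ)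
        _ = _ := by ring
    rw [e3] at hle
    refine le_of_mul_le_mul_left ?_ (mul_pos hp hp)
    nlinarith [mul_le_mul_of_nonneg_left hle hp.le]
  have h1 : entOn μ f Finset.univ - entOn μ f A ≤ ∑ σ, μ σ * ((f σ - F σ) ^ 2 / F σ) := by
    -- Adding `E f - E F = 0` makes the chi-square bound pointwise: it becomes `f log (f/F) ≤ f (f/F
    -- - 1)`.
    have e : ∑ σ, μ σ * ((f σ - F σ) ^ 2 / F σ) =
        ∑ σ, μ σ * ((f σ - F σ) ^ 2 / F σ) + ∑ σ, μ σ * f σ - ∑ σ, μ σ * F σ := by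
      rw [hF, sum_cexp hμ, add_sub_cancel_right]
    rw [e, entOn, entOn, ← Finset.sum_sub_distrib, ← Finset.sum_add_distrib,
      ← Finset.sum_sub_distrib]
    refine Finset.sum_le_sum fun σ _ => ?_
    rw [← mul_sub, ← mul_sub, ← mul_add, ← mul_sub]
    rcases (hμ σ).eq_or_lt with h0 | h0
    · simp [← h0]
    refine mul_le_mul_of_nonneg_left ?_ (hμ σ)
    rw [cexp_univ f h0]
    rcases (hF0 σ).eq_or_lt with hF1 | hF1
    · have : f σ = 0 := by
        by_contra hne
        exact (cexp_pos hμ A hf h0 ((hf σ).lt_of_ne' hne)).ne hF1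
      simp [← hF1, this]
    rcases (hf σ).eq_or_lt with hf1 | hf1
    · rw [← hf1]
      have : (0 - F σ) ^ 2 / F σ = F σ := by field_simp; ring
      rw [this]; simp
    have hlog := Real.log_le_sub_one_of_pos (div_pos hf1 hF1)
    rw [Real.log_div hf1.ne' hF1.ne'] at hlog
    have e2 : (f σ - F σ) ^ 2 / F σ + f σ - F σ = f σ * (f σ / F σ - 1) := by
      field_simp
      ring
    rw [e2]
    exact mul_le_mul_of_nonneg_left hlog hf1.le
  refine h1.trans ?_
  have h2 : ∑ σ, μ σ * ((f σ - F σ) ^ 2 / F σ) ≤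
      ∑ σ, μ σ * (f σ * (2 * D σ / F σ)) + ∑ σ, μ σ * (2 * D σ) := by
    rw [← Finset.sum_add_distrib]
    refine Finset.sum_le_sum fun σ _ => ?_
    rw [← mul_add]
    rcases (hμ σ).eq_or_lt with h0 | h0
    · simp [← h0]
    refine mul_le_mul_of_nonneg_left ?_ (hμ σ)
    have := hD0 σ
    rcases (hF0 σ).eq_or_lt with hF1 | hF1
    · rw [← hF1]; simpa using this
    · rw [div_le_iff₀ hF1]
      refine (hdev σ h0).trans (le_of_eq ?_)
      field_simp
  refine h2.trans ?_
  -- As `D / F` is local on `A`, `f` may be replaced by `F`, which cancels.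
  have h3 : ∑ σ, μ σ * (f σ * (2 * D σ / F σ)) ≤ ∑ σ, μ σ * (2 * D σ) := by
    rw [← sum_cexp_mul hμ A f]
    · refine Finset.sum_le_sum fun σ _ => mul_le_mul_of_nonneg_left ?_ (hμ σ)
      rw [← hF]
      rcases (hF0 σ).eq_or_lt with hF1 | hF1
      · rw [← hF1, zero_mul]
        exact mul_nonneg zero_le_two (hD0 σ)
      · rw [mul_div_cancel₀ _ hF1.ne']
    · intro σ ω hω
      simp only [hD σ ω hω, hF, isLocal_cexp μ A f σ ω hω]
  have h4 : ∑ σ, μ σ * (2 * D σ) = 2 * ∑ σ, μ σ * D σ := by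
    rw [Finset.mul_sum]
    exact Finset.sum_congr rfl fun σ _ => by ring
  linarith

/-- A crude entropy factorization of a block into single sites, exponential in the block size. -/
theorem entOn_sub_le_crude (hμ : ∀ σ, 0 ≤ μ σ) (hc : TotallyConnected μ) {b : ℝ} (hb0 : 0 < b)
    (hb : MarginallyBounded μ b) {f : (V → Fin q) → ℝ} (hf : ∀ σ, 0 ≤ f σ) (S : Finset V) :
    entOn μ f Finset.univ - entOn μ f Sᶜ ≤ 16 * (1 / b) ^ (3 * S.card) *
      ∑ v ∈ S, (entOn μ f Finset.univ - entOn μ f {v}ᶜ) := by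
  rcases S.eq_empty_or_nonempty with rfl | hS
  · simp
  set k := S.card
  have hbk : 0 < b ^ k := pow_pos hb0 k
  let g : V → (V → Fin q) → ℝ := fun v σ => (√(f σ) - √(cexp μ {v}ᶜ f σ)) ^ 2
  have hg0 : ∀ v σ, 0 ≤ g v σ := fun v σ => sq_nonneg _
  have hG0 : ∀ v σ, 0 ≤ cexp μ Sᶜ (g v) σ := fun v => cexp_nonneg hμ _ (hg0 v)
  -- The exponent `3k` has two sources: `b^(-k)` passes from conditional means of `g v` to pointwise
  -- values, and `b^(-2k)` is the squared bound on the path length.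
  let D : (V → Fin q) → ℝ := fun σ =>
    4 * (1 / b) ^ (3 * k) * ∑ v ∈ S, cexp μ Sᶜ (g v) σ
  have hD0 : ∀ σ, 0 ≤ D σ := fun σ => mul_nonneg (by positivity)
    (Finset.sum_nonneg fun v _ => hG0 v σ)
  have hDloc : IsLocal Sᶜ D := fun σ ω hω => by
    simp only [D, isLocal_cexp μ Sᶜ _ σ ω hω]
  have hosc : ∀ σ, 0 < μ σ → ∀ ω ∈ fiber Sᶜ σ, 0 < μ ω → (√(f σ) - √(f ω)) ^ 2 ≤ D σ := by
    intro σ hσ ω hω hω0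
    set Q := ∑ v ∈ S, cexp μ Sᶜ (g v) σ with hQ
    have hQ0 : 0 ≤ Q := Finset.sum_nonneg fun v _ => hG0 v σ
    have hpt : ∀ v ∈ S, ∀ x ∈ fiber Sᶜ σ, 0 < μ x → b ^ k * g v x ≤ Q := by
      intro v hv x hx hx0
      have hp := fiber_sum_pos hμ Sᶜ hσ
      have h1 : b ^ k * ∑ ω ∈ fiber Sᶜ σ, μ ω ≤ μ x := by
        rw [← fiber_eq hx]
        exact pow_card_mul_fiber_sum_le hμ hb0 hb S hx0
      have h2 : μ x * g v x ≤ ∑ ω ∈ fiber Sᶜ σ, μ ω * g v ω :=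
        Finset.single_le_sum (f := fun ω => μ ω * g v ω)
          (fun ω _ => mul_nonneg (hμ ω) (hg0 v ω)) hx
      refine le_trans ?_ (Finset.single_le_sum (f := fun v => cexp μ Sᶜ (g v) σ)
        (fun v _ => hG0 v σ) hv)
      rw [cexp, le_div_iff₀ hp]
      nlinarith [mul_le_mul_of_nonneg_right h1 (hg0 v x)]
    -- At both ends of a move at `v`, `√f` is compared with the same number `m`: the squared
    -- increment is at most `2 (g v x + g v y) ≤ 4 Q / b^k`.
    set M := √(4 / b ^ k * Q)
    have hM2 : M ^ 2 = 4 / b ^ k * Q := Real.sq_sqrt (by positivity)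
    have hstep : ∀ v ∈ S, ∀ x ∈ fiber Sᶜ σ, ∀ y ∈ fiber {v}ᶜ x, 0 < μ x → 0 < μ y →
        |√(f x) - √(f y)| ≤ M := by
      intro v hv x hx y hy hx0 hy0
      refine Real.abs_le_sqrt ?_
      have hy' : y ∈ fiber Sᶜ σ := by
        rw [← fiber_eq hx]
        exact fiber_anti (Finset.compl_subset_compl.2 (Finset.singleton_subset_iff.2 hv)) x hy
      have h1 := hpt v hv x hx hx0
      have h2 := hpt v hv y hy' hy0
      have e : cexp μ {v}ᶜ f y = cexp μ {v}ᶜ f x := isLocal_cexp μ _ f x y hy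
      simp only [g, e] at h1 h2
      set m := √(cexp μ {v}ᶜ f x)
      rw [div_mul_eq_mul_div, le_div_iff₀ hbk]
      nlinarith [mul_nonneg hbk.le (sq_nonneg ((√(f x) - m) + (√(f y) - m)))]
    have hwalk := abs_sub_le_of_totallyConnected hμ hc hS hσ (g := fun x => √(f x))
      (Real.sqrt_nonneg _) hstep (self_mem_fiber _ σ) hω hσ hω0
    have hcard := pow_mul_card_support_le hμ hb0 hb S hσ
    set c : ℝ := (((fiber Sᶜ σ).filter fun ω => 0 < μ ω).card : ℝ)
    have hc1 : c ≤ (1 / b) ^ k := by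
      rw [one_div_pow, le_div_iff₀ hbk, mul_comm]
      exact hcard
    have hc0 : 0 ≤ c := Nat.cast_nonneg _
    calc (√(f σ) - √(f ω)) ^ 2 = |√(f σ) - √(f ω)| ^ 2 := (sq_abs _).symm
      _ ≤ (c * M) ^ 2 := pow_le_pow_left₀ (abs_nonneg _) hwalk 2
      _ = c ^ 2 * M ^ 2 := mul_pow _ _ _
      _ ≤ ((1 / b) ^ k) ^ 2 * M ^ 2 :=
          mul_le_mul_of_nonneg_right (pow_le_pow_left₀ hc0 hc1 2) (sq_nonneg _)
      _ = D σ := by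
          simp only [hM2, D, pow_mul', ← hQ]
          rw [one_div_pow]
          ring
  refine (entOn_sub_le_oscillation hμ hf Sᶜ hDloc hD0 hosc).trans ?_
  have e1 : ∑ σ, μ σ * D σ = 4 * (1 / b) ^ (3 * k) * ∑ v ∈ S, ∑ σ, μ σ * g v σ := by
    simp only [D, ← sum_cexp hμ Sᶜ (g _)]
    rw [Finset.sum_comm, Finset.mul_sum]
    refine Finset.sum_congr rfl fun σ _ => ?_
    rw [← Finset.mul_sum]
    ring
  rw [e1]
  have h2 : ∀ v, ∑ σ, μ σ * g v σ ≤ entOn μ f Finset.univ - entOn μ f {v}ᶜ := by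
    intro v
    refine le_trans (le_of_eq ?_) (hellinger_le_entOn_sub hμ hf (Finset.subset_univ {v}ᶜ))
    refine Finset.sum_congr rfl fun σ _ => ?_
    rcases (hμ σ).eq_or_lt with h0 | h0
    · simp [← h0]
    · simp only [g, cexp_univ f h0]
  have h3 := Finset.sum_le_sum fun v (_ : v ∈ S) => h2 v
  have h4 : 0 ≤ 16 * (1 / b) ^ (3 * k) := by positivity
  nlinarith [mul_le_mul_of_nonneg_left h3 h4]

end Crude

/-! ### The Markov property and decomposition of blocks into components. -/

section Markov

variable {V : Type u} [Fintype V] [DecidableEq V] {q : ℕ}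

/-- The Markov property with respect to `G`, in product form: exchanging two configurations on `R`
preserves the product of their weights if they agree on the neighbours of `R`. -/
def SpatialMarkov (G : SimpleGraph V) (μ : (V → Fin q) → ℝ) : Prop :=
  ∀ (R : Finset V) (ω ω' : V → Fin q), (∀ u ∈ R, ∀ v ∉ R, G.Adj u v → ω v = ω' v) →
    μ (R.piecewise ω' ω) * μ (R.piecewise ω ω') = μ ω * μ ω'

theorem spatialMarkov_gibbs (X : SpinSystem q) (G : SimpleGraph V) [DecidableRel G.Adj] :
    SpatialMarkov G (X.gibbs G) := by
  intro R ω ω' h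
  have hw : X.weight G (R.piecewise ω' ω) * X.weight G (R.piecewise ω ω') =
      X.weight G ω * X.weight G ω' := by
    simp only [SpinSystem.weight]
    rw [mul_mul_mul_comm, mul_mul_mul_comm (∏ e ∈ G.edgeFinset, X.edgeFactor ω e)]
    simp only [← Finset.prod_mul_distrib]
    congr 1
    · refine Finset.prod_congr rfl fun e he => ?_
      induction e with
      | h u v =>
        have huv : G.Adj u v := by simpa using he
        simp only [SpinSystem.edgeFactor, Sym2.lift_mk]
        by_cases hu : u ∈ R <;> by_cases hv : v ∈ R
        · simp [hu, hv, mul_comm]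
        · simp [hu, hv, h u hu v hv huv, mul_comm]
        · simp [hu, hv, h v hv u hu huv.symm, mul_comm]
        · simp [hu, hv]
    · refine Finset.prod_congr rfl fun v _ => ?_
      by_cases hv : v ∈ R
      · simp [hv, mul_comm]
      · simp [hv]
  simp only [SpinSystem.gibbs, div_mul_div_comm, hw]

variable {μ : (V → Fin q) → ℝ} {G : SimpleGraph V}

/-- Conditional independence of separated sets of vertices. -/
theorem cexp_eq_of_separated (hμ : ∀ σ, 0 ≤ μ σ) (hG : SpatialMarkov G μ) {C R : Finset V}
    (hsep : ∀ u ∈ R, ∀ v ∈ C, ¬ G.Adj u v) {g : (V → Fin q) → ℝ}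
    (hg : IsLocal Rᶜ g) {σ : V → Fin q} (h : 0 < μ σ) :
    cexp μ Cᶜ g σ = cexp μ (C ∪ R)ᶜ g σ := by
  have hp1 := fiber_sum_pos hμ Cᶜ h
  have hp2 := fiber_sum_pos hμ (C ∪ R)ᶜ h
  -- After cross-multiplication both sides are sums over pairs of configurations. Exchanging the
  -- spins on `R` is an involution matching the two index sets; it preserves the product of weights,
  -- and `g` does not see `R`.
  rw [cexp, cexp, div_eq_div_iff hp1.ne' hp2.ne', Finset.sum_mul_sum, Finset.sum_mul_sum,
    ← Finset.sum_product', ← Finset.sum_product']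
  have hmem : ∀ x y : V → Fin q, x ∈ fiber Cᶜ σ → y ∈ fiber (C ∪ R)ᶜ σ →
      R.piecewise y x ∈ fiber (C ∪ R)ᶜ σ ∧ R.piecewise x y ∈ fiber Cᶜ σ := by
    intro x y hx hy
    simp only [mem_fiber, Finset.mem_compl, Finset.mem_union, not_or] at *
    refine ⟨fun v hv => ?_, fun v hv => ?_⟩
    · rw [Finset.piecewise_eq_of_notMem _ _ _ hv.2, hx v hv.1]
    · by_cases hvR : v ∈ R
      · rw [Finset.piecewise_eq_of_mem _ _ _ hvR, hx v hv]
      · rw [Finset.piecewise_eq_of_notMem _ _ _ hvR, hy v ⟨hv, hvR⟩]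
  have hinv : ∀ x y : V → Fin q,
      R.piecewise (R.piecewise x y) (R.piecewise y x) = x := fun x y => by
    funext v
    by_cases hv : v ∈ R <;> simp [hv]
  refine Finset.sum_nbij' (fun x => (R.piecewise x.2 x.1, R.piecewise x.1 x.2))
    (fun x => (R.piecewise x.2 x.1, R.piecewise x.1 x.2)) ?_ ?_ ?_ ?_ ?_
  · rintro ⟨x, y⟩ hxy
    rw [Finset.mem_product] at hxy ⊢
    exact hmem x y hxy.1 hxy.2
  · rintro ⟨x, y⟩ hxy
    rw [Finset.mem_product] at hxy ⊢
    exact (hmem y x hxy.2 hxy.1).symm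
  · rintro ⟨x, y⟩ _
    simp only [hinv]
  · rintro ⟨x, y⟩ _
    simp only [hinv]
  · rintro ⟨x, y⟩ hxy
    rw [Finset.mem_product] at hxy
    have hsw := hG R x y fun u hu v hv huv => by
      have hvC : v ∉ C := fun hvC => hsep u hu v hvC huv
      exact (mem_fiber.1 hxy.1 v (by simpa using hvC)).trans
        (mem_fiber.1 hxy.2 v (by simp [hvC, hv])).symm
    have hgx : g (R.piecewise y x) = g x := hg _ _ (mem_fiber.2 fun v hv =>
      Finset.piecewise_eq_of_notMem _ _ _ (Finset.mem_compl.1 hv))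
    simp only [hgx]
    linear_combination (-g x) * hsw

/-- Subadditivity of the block entropies for separated blocks. -/
theorem entOn_sub_le_of_separated (hμ : ∀ σ, 0 ≤ μ σ) (hG : SpatialMarkov G μ)
    {f : (V → Fin q) → ℝ} (hf : ∀ σ, 0 ≤ f σ) {C R : Finset V}
    (hsep : ∀ u ∈ R, ∀ v ∈ C, ¬ G.Adj u v) :
    entOn μ f Finset.univ - entOn μ f (C ∪ R)ᶜ ≤
      (entOn μ f Finset.univ - entOn μ f Cᶜ) + (entOn μ f Finset.univ - entOn μ f Rᶜ) := by
  have h1 := entOn_supermodular hμ hf (Finset.subset_univ (C ∪ R)ᶜ) (Finset.subset_univ Rᶜ)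
    (Finset.subset_univ Cᶜ)
  have hsub : (C ∪ R)ᶜ ⊆ Cᶜ := Finset.compl_subset_compl.2 Finset.subset_union_left
  have hsub' : (C ∪ R)ᶜ ⊆ Rᶜ := Finset.compl_subset_compl.2 Finset.subset_union_right
  set F := cexp μ (C ∪ R)ᶜ f with hF
  -- Separation gives `E[f_{Rᶜ} | Cᶜ] = F`, so `F` cancels and the correction term of
  -- supermodularity is nonnegative.
  have h2 : ∑ σ, μ σ * (cexp μ Rᶜ f σ * cexp μ Cᶜ f σ / F σ) ≤ ∑ σ, μ σ * f σ := by
    simp only [mul_div_assoc]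
    rw [← sum_cexp_mul hμ Cᶜ (cexp μ Rᶜ f), ← sum_cexp hμ Cᶜ f]
    · refine Finset.sum_le_sum fun σ _ => ?_
      rcases (hμ σ).eq_or_lt with h0 | h0
      · simp [← h0]
      refine mul_le_mul_of_nonneg_left ?_ (hμ σ)
      rw [cexp_eq_of_separated hμ hG hsep (isLocal_cexp μ Rᶜ f) h0, cexp_cexp hμ hsub', ← hF]
      rcases (cexp_nonneg hμ (C ∪ R)ᶜ hf σ).eq_or_lt with h3 | h3
      · rw [hF, ← h3, zero_mul]
        exact cexp_nonneg hμ _ hf σ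
      · rw [mul_div_cancel₀ _ h3.ne']
    · intro σ ω hω
      simp only [isLocal_cexp μ Cᶜ f σ ω hω, hF, (isLocal_cexp μ _ f).mono hsub σ ω hω]
  linarith

/-- The subgraph of `G` spanned by the edges within `S`. -/
def within (G : SimpleGraph V) (S : Finset V) : SimpleGraph V where
  Adj u v := G.Adj u v ∧ u ∈ S ∧ v ∈ S
  symm := ⟨fun _ _ h => ⟨h.1.symm, h.2.2, h.2.1⟩⟩
  loopless := ⟨fun _ h => G.loopless.irrefl _ h.1⟩

open Classical in
/-- The connected component of `v` in the subgraph of `G` spanned by `S`. -/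
noncomputable def component (G : SimpleGraph V) (S : Finset V) (v : V) : Finset V :=
  Finset.univ.filter fun u => (within G S).Reachable v u

theorem mem_component {S : Finset V} {u v : V} :
    u ∈ component G S v ↔ (within G S).Reachable v u := by
  simp [component]

theorem component_eq {S : Finset V} {u v : V} (h : u ∈ component G S v) :
    component G S u = component G S v := by
  rw [mem_component] at h
  ext x
  rw [mem_component, mem_component]
  exact ⟨h.trans, h.symm.trans⟩

theorem component_subset {S : Finset V} {v : V} (hv : v ∈ S) : component G S v ⊆ S := by
  intro u hu
  obtain ⟨p⟩ := (mem_component.1 hu).symm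
  cases p with
  | nil => exact hv
  | cons h _ => exact h.2.1

theorem component_mono {S T : Finset V} (h : S ⊆ T) (v : V) :
    component G S v ⊆ component G T v := by
  intro u hu
  rw [mem_component] at hu ⊢
  have hle : within G S ≤ within G T := fun x y hxy => ⟨hxy.1, h hxy.2.1, h hxy.2.2⟩
  exact hu.mono hle

/-- Block entropies are controlled by single-site entropies weighted by the sizes of the
components of the block. -/
theorem entOn_sub_le_sum_component (hμ : ∀ σ, 0 ≤ μ σ) (hG : SpatialMarkov G μ)
    {f : (V → Fin q) → ℝ} (hf : ∀ σ, 0 ≤ f σ) {w : ℕ → ℝ} (hw : Monotone w)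
    (hcrude : ∀ C : Finset V, entOn μ f Finset.univ - entOn μ f Cᶜ ≤
      w C.card * ∑ v ∈ C, (entOn μ f Finset.univ - entOn μ f {v}ᶜ)) (S : Finset V) :
    entOn μ f Finset.univ - entOn μ f Sᶜ ≤ ∑ v ∈ S,
      w (component G S v).card * (entOn μ f Finset.univ - entOn μ f {v}ᶜ) := by
  induction S using Finset.strongInduction with
  | H S ih =>
    rcases S.eq_empty_or_nonempty with rfl | ⟨v, hv⟩
    · simp
    set C := component G S v with hC
    have hvC : v ∈ C := mem_component.2 (SimpleGraph.Reachable.refl v)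
    have hCS : C ⊆ S := component_subset hv
    have hunion : C ∪ S \ C = S := Finset.union_sdiff_of_subset hCS
    have h1 := entOn_sub_le_of_separated hμ hG hf (C := C) (R := S \ C) (by
      intro x hx y hy hxy
      rw [Finset.mem_sdiff] at hx
      refine hx.2 ?_
      rw [hC, mem_component] at hy ⊢
      have : (within G S).Adj y x := ⟨hxy.symm, hCS (mem_component.2 hy), hx.1⟩
      exact hy.trans this.reachable)
    rw [hunion] at h1
    have h2 := hcrude C
    have h3 := ih (S \ C) (Finset.sdiff_ssubset hCS ⟨v, hvC⟩)
    -- Deleting `C` cannot enlarge the components of the other vertices, and `w` is monotone.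
    have h4 : ∑ u ∈ S \ C, w (component G (S \ C) u).card *
        (entOn μ f Finset.univ - entOn μ f {u}ᶜ) ≤ ∑ u ∈ S \ C, w (component G S u).card *
          (entOn μ f Finset.univ - entOn μ f {u}ᶜ) :=
      Finset.sum_le_sum fun u _ => mul_le_mul_of_nonneg_right
        (hw (Finset.card_le_card (component_mono Finset.sdiff_subset u)))
        (sub_nonneg.2 (entOn_mono hμ hf (Finset.subset_univ _)))
    have h5 : w C.card * ∑ v ∈ C, (entOn μ f Finset.univ - entOn μ f {v}ᶜ) =
        ∑ u ∈ C, w (component G S u).card * (entOn μ f Finset.univ - entOn μ f {u}ᶜ) := by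
      rw [Finset.mul_sum]
      exact Finset.sum_congr rfl fun u hu => by rw [component_eq hu, hC]
    rw [← Finset.sum_sdiff hCS]
    linarith

end Markov

/-! ### Components of a vertex in a random block. -/

section Counting

variable {V : Type u} [Fintype V] [DecidableEq V]

/-- Every component is covered by a closed walk of length twice its size minus two. -/
theorem exists_closed_walk_component (G : SimpleGraph V) (S : Finset V) (v : V) (k : ℕ)
    (hk : (component G S v).card = k + 1) :
    ∃ p : G.Walk v v, p.length = 2 * k ∧ p.support.toFinset = component G S v := by
  have hle : within G S ≤ G := fun _ _ h => h.1
  have key : ∀ j ≤ k, ∃ p : (within G S).Walk v v,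
      p.length = 2 * j ∧ p.support.toFinset.card = j + 1 := by
    intro j
    induction j with
    | zero => exact fun _ => ⟨.nil, by simp⟩
    | succ j ih =>
      intro hj
      obtain ⟨p, hp, hc⟩ := ih (by omega)
      obtain ⟨y, hy, hyp⟩ : ∃ y ∈ component G S v, y ∉ p.support.toFinset :=
        Finset.exists_mem_notMem_of_card_lt_card (by omega)
      obtain ⟨r⟩ := mem_component.1 hy
      -- Some edge leaves the vertices visited so far. A detour along it and back adds two steps and
      -- exactly one new vertex.
      obtain ⟨d, -, hd1, hd2⟩ := r.exists_boundary_dart {x | x ∈ p.support} p.start_mem_support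
        (by simpa using hyp)
      have hd1 : d.fst ∈ p.support := hd1
      have hd2 : d.snd ∉ p.support := hd2
      refine ⟨(p.takeUntil _ hd1).append (.cons d.adj (.cons d.adj.symm (p.dropUntil _ hd1))),
        ?_, ?_⟩
      · have := congrArg SimpleGraph.Walk.length (p.take_spec hd1)
        rw [SimpleGraph.Walk.length_append] at this
        simp only [SimpleGraph.Walk.length_append, SimpleGraph.Walk.length_cons]
        omega
      · rw [← hc, ← Finset.card_insert_of_notMem (a := d.snd) (by simpa using hd2)]
        congr 1
        ext x
        have hx : x ∈ p.support ↔ x ∈ (p.takeUntil _ hd1).support ∨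
            x ∈ (p.dropUntil _ hd1).support := by
          rw [← SimpleGraph.Walk.mem_support_append_iff, p.take_spec]
        have h1 : d.fst ∈ (p.dropUntil _ hd1).support := SimpleGraph.Walk.start_mem_support _
        simp only [List.mem_toFinset, SimpleGraph.Walk.mem_support_append_iff,
          SimpleGraph.Walk.support_cons, List.mem_cons, Finset.mem_insert, hx]
        constructor
        · rintro (h | rfl | rfl | h)
          · exact Or.inr (Or.inl h)
          · exact Or.inr (Or.inr h1)
          · exact Or.inl rfl
          · exact Or.inr (Or.inr h)
        · tauto
  obtain ⟨p, hp, hc⟩ := key k le_rfl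
  refine ⟨p.mapLe hle, by rw [SimpleGraph.Walk.length_mapLe, hp], ?_⟩
  rw [SimpleGraph.Walk.support_mapLe_eq_support]
  refine Finset.eq_of_subset_of_card_le (fun x hx => ?_) (by omega)
  exact mem_component.2 ⟨p.takeUntil x (by simpa using hx)⟩

theorem card_finsetWalkLength_le (G : SimpleGraph V) [DecidableRel G.Adj] {Δ : ℕ}
    (hΔ : ∀ v, G.degree v ≤ Δ) (n : ℕ) (u v : V) :
    (G.finsetWalkLength n u v).card ≤ Δ ^ n := by
  induction n generalizing u with
  | zero =>
    rw [SimpleGraph.finsetWalkLength]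
    split_ifs with h
    · subst h; simp
    · simp
  | succ n ih =>
    rw [SimpleGraph.finsetWalkLength]
    refine Finset.card_biUnion_le.trans ?_
    refine (Finset.sum_le_card_nsmul _ _ (Δ ^ n) fun w _ => ?_).trans ?_
    · rw [Finset.card_map]
      exact ih w
    · rw [smul_eq_mul, pow_succ', Finset.card_univ, SimpleGraph.card_neighborSet_eq_degree]
      exact Nat.mul_le_mul_right _ (hΔ u)

/-- Iterates `(l - k) / (n - k) ≤ l / n`, which holds because `l ≤ n`. -/
theorem choose_sub_mul_pow_le (n l k : ℕ) (hk : k ≤ l) (hl : l ≤ n) :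
    (((n - k).choose (l - k) : ℕ) : ℝ) * (n : ℝ) ^ k ≤ (l : ℝ) ^ k * n.choose l := by
  induction k with
  | zero => simp
  | succ k ih =>
    have ih := ih (by omega)
    have h1 := Nat.add_one_mul_choose_eq (n - (k + 1)) (l - (k + 1))
    rw [show n - (k + 1) + 1 = n - k by omega, show l - (k + 1) + 1 = l - k by omega] at h1
    have h2 : ((n : ℝ) - k) * ((n - (k + 1)).choose (l - (k + 1)) : ℕ) =
        ((n - k).choose (l - k) : ℕ) * ((l : ℝ) - k) := by
      rw [← Nat.cast_sub (by omega : k ≤ n), ← Nat.cast_sub (by omega : k ≤ l)]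
      exact_mod_cast h1
    have hkl : (k : ℝ) + 1 ≤ l := by exact_mod_cast hk
    have hln : (l : ℝ) ≤ n := by exact_mod_cast hl
    set c' : ℝ := (((n - (k + 1)).choose (l - (k + 1)) : ℕ) : ℝ)
    set c : ℝ := (((n - k).choose (l - k) : ℕ) : ℝ)
    have hc : 0 ≤ c := Nat.cast_nonneg _
    have h3 : (n : ℝ) * c' ≤ l * c := by
      refine le_of_mul_le_mul_left ?_ (by linarith : 0 < (n : ℝ) - k)
      have h4 : (n : ℝ) * (l - k) ≤ l * (n - k) := by
        nlinarith [mul_nonneg (Nat.cast_nonneg k : (0 : ℝ) ≤ k) (sub_nonneg.2 hln)]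
      nlinarith [mul_le_mul_of_nonneg_right h4 hc]
    calc c' * (n : ℝ) ^ (k + 1) = (n * c') * (n : ℝ) ^ k := by ring
      _ ≤ (l * c) * (n : ℝ) ^ k := by gcongr
      _ = l * (c * (n : ℝ) ^ k) := by ring
      _ ≤ l * ((l : ℝ) ^ k * n.choose l) := by gcongr
      _ = _ := by ring

/-- A fixed set lies in a uniformly random `l`-set with probability at most `(l / n) ^ k`. -/
theorem card_powersetCard_filter_le (D : Finset V) {l : ℕ} (hl : l ≤ Fintype.card V) :
    (((Finset.powersetCard l Finset.univ).filter fun S => D ⊆ S).card : ℝ) ≤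
      ((l : ℝ) / Fintype.card V) ^ D.card * (Fintype.card V).choose l := by
  set n := Fintype.card V with hn
  rcases lt_or_ge l D.card with h | h
  · have : ((Finset.powersetCard l Finset.univ).filter fun S => D ⊆ S) = ∅ := by
      refine Finset.filter_eq_empty_iff.2 fun S hS hD => ?_
      have := Finset.card_le_card hD
      rw [(Finset.mem_powersetCard.1 hS).2] at this
      omega
    rw [this]
    simp only [Finset.card_empty, Nat.cast_zero]
    positivity
  have h1 : ((Finset.powersetCard l Finset.univ).filter fun S => D ⊆ S).card ≤
      (Finset.powersetCard (l - D.card) Dᶜ).card := by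
    refine Finset.card_le_card_of_injOn (fun S => S \ D) ?_ ?_
    · intro S hS
      simp only [Finset.coe_filter, Set.mem_ofPred_eq, Finset.mem_powersetCard] at hS
      simp only [Finset.mem_coe, Finset.mem_powersetCard]
      refine ⟨fun x hx => Finset.mem_compl.2 (Finset.mem_sdiff.1 hx).2, ?_⟩
      rw [Finset.card_sdiff_of_subset hS.2, hS.1.2]
    · intro S hS S' hS' he
      simp only [Finset.coe_filter, Set.mem_ofPred_eq] at hS hS'
      have he : S \ D = S' \ D := he
      rw [← Finset.sdiff_union_of_subset hS.2, ← Finset.sdiff_union_of_subset hS'.2, he]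
  rw [Finset.card_powersetCard, Finset.card_compl, ← hn] at h1
  have h2 := choose_sub_mul_pow_le n l D.card h hl
  rcases Nat.eq_zero_or_pos n with h0 | h0
  · have hD : D.card = 0 := by omega
    have hl0 : l = 0 := by omega
    rw [hD, hl0, h0] at h1
    rw [hD, hl0, h0]
    simpa using h1
  · have hnp : (0 : ℝ) < (n : ℝ) ^ D.card := by positivity
    rw [div_pow, div_mul_eq_mul_div, le_div_iff₀ hnp]
    refine le_trans (mul_le_mul_of_nonneg_right ?_ hnp.le) h2
    exact_mod_cast h1

/-- The expected weight of the component of a vertex in a random `l`-set. -/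
theorem sum_weight_component_le (G : SimpleGraph V) [DecidableRel G.Adj] {Δ : ℕ}
    (hΔ : ∀ v, G.degree v ≤ Δ) {l : ℕ} (hl : l ≤ Fintype.card V) {w : ℕ → ℝ}
    (hw : ∀ k, 0 ≤ w k) (v : V) :
    ∑ S ∈ (Finset.powersetCard l Finset.univ).filter (v ∈ ·), w (component G S v).card ≤
      ∑ k ∈ Finset.range (Fintype.card V), (Δ : ℝ) ^ (2 * k) * w (k + 1) *
        ((l : ℝ) / Fintype.card V) ^ (k + 1) * (Fintype.card V).choose l := by
  set n := Fintype.card V with hn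
  -- Closed walks of length `2k` encode the possible components with `k + 1` vertices. Several walks
  -- may encode one set, which only enlarges the upper bound.
  let W : ℕ → Finset (G.Walk v v) := fun k =>
    (G.finsetWalkLength (2 * k) v v).filter fun p => p.support.toFinset.card = k + 1
  have h1 : ∀ S ∈ (Finset.powersetCard l Finset.univ).filter (v ∈ ·),
      w (component G S v).card ≤ ∑ k ∈ Finset.range n, ∑ p ∈ W k,
        if p.support.toFinset ⊆ S then w (k + 1) else 0 := by
    intro S hS
    have hv : v ∈ S := (Finset.mem_filter.1 hS).2
    have hvC : v ∈ component G S v := mem_component.2 (SimpleGraph.Reachable.refl v)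
    obtain ⟨k, hk⟩ : ∃ k, (component G S v).card = k + 1 :=
      Nat.exists_eq_add_one.2 (Finset.card_pos.2 ⟨v, hvC⟩)
    obtain ⟨p, hp, hsupp⟩ := exists_closed_walk_component G S v k hk
    have hkn : k < n := by
      have := Finset.card_le_univ (component G S v)
      omega
    have hpW : p ∈ W k := Finset.mem_filter.2
      ⟨SimpleGraph.mem_finsetWalkLength_iff.2 hp, by rw [hsupp, hk]⟩
    have hnn : ∀ k (p : G.Walk v v), 0 ≤ if p.support.toFinset ⊆ S then w (k + 1) else 0 :=
      fun k p => by split_ifs; exacts [hw _, le_rfl]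
    calc w (component G S v).card = if p.support.toFinset ⊆ S then w (k + 1) else 0 := by
          rw [if_pos (hsupp ▸ component_subset hv), hk]
      _ ≤ ∑ p ∈ W k, if p.support.toFinset ⊆ S then w (k + 1) else 0 :=
          Finset.single_le_sum (f := fun p : G.Walk v v =>
            if p.support.toFinset ⊆ S then w (k + 1) else 0) (fun p _ => hnn k p) hpW
      _ ≤ _ := Finset.single_le_sum (f := fun k => ∑ p ∈ W k,
            if p.support.toFinset ⊆ S then w (k + 1) else 0)
          (fun k _ => Finset.sum_nonneg fun p _ => hnn k p) (Finset.mem_range.2 hkn)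
  refine (Finset.sum_le_sum h1).trans ?_
  rw [Finset.sum_comm]
  refine Finset.sum_le_sum fun k _ => ?_
  rw [Finset.sum_comm]
  have h2 : ∀ p ∈ W k, ∑ S ∈ (Finset.powersetCard l Finset.univ).filter (v ∈ ·),
      (if p.support.toFinset ⊆ S then w (k + 1) else 0) ≤
      w (k + 1) * (((l : ℝ) / n) ^ (k + 1) * n.choose l) := by
    intro p hp
    have hcard := (Finset.mem_filter.1 hp).2
    rw [← hcard, ← Finset.sum_filter, Finset.sum_const, nsmul_eq_mul, mul_comm]
    refine mul_le_mul_of_nonneg_left ?_ (hw _)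
    refine le_trans ?_ (card_powersetCard_filter_le p.support.toFinset hl)
    exact_mod_cast Finset.card_le_card
      (Finset.filter_subset_filter _ (Finset.filter_subset _ _))
  refine (Finset.sum_le_card_nsmul _ _ _ h2).trans ?_
  rw [nsmul_eq_mul, mul_assoc, mul_assoc]
  refine mul_le_mul_of_nonneg_right ?_ (mul_nonneg (hw _) (by positivity))
  exact_mod_cast (Finset.card_filter_le _ _).trans (card_finsetWalkLength_le G hΔ (2 * k) v v)

end Counting

/-! ### Approximate tensorization of entropy. -/

section Tensorization

variable {V : Type u} [Fintype V] [DecidableEq V] {q : ℕ} {μ : (V → Fin q) → ℝ}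

/-- Factorization of entropy into uniformly random blocks of size `l`. -/
theorem entOn_block_factorization (hμ : ∀ σ, 0 ≤ μ σ) {η b : ℝ}
    (hη : SpectrallyIndependent μ η) (hη0 : 0 ≤ η) (hb0 : 0 < b) (hb : MarginallyBounded μ b)
    {f : (V → Fin q) → ℝ} (hf : ∀ σ, 0 ≤ f σ) {N l : ℕ} (hN : 4 * η / b + 1 ≤ N) (hl : N < l)
    (hln : l ≤ Fintype.card V) :
    entOn μ f Finset.univ - entOn μ f ∅ ≤ (((Fintype.card V : ℝ) - N) / (l - N)) ^ N *
      ((∑ S ∈ Finset.powersetCard l Finset.univ, (entOn μ f Finset.univ - entOn μ f Sᶜ)) /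
        (Fintype.card V).choose l) :=
  increment_le_block_increment (fun _ _ h => entOn_mono hμ hf h) (by positivity) hN hl hln
    fun _ hT => local_entropy_contraction hμ hη hη0 hb0 hb hf hT

/-- Factorization into random blocks of linear size, followed by the decomposition of the blocks
into components. -/
theorem tensorization_of_large (G : SimpleGraph V) [DecidableRel G.Adj] {Δ : ℕ} (hΔ3 : 3 ≤ Δ)
    (hΔ : ∀ v, G.degree v ≤ Δ) (hμ : ∀ σ, 0 ≤ μ σ) (hG : SpatialMarkov G μ)
    (hc : TotallyConnected μ) {η b : ℝ} (hη : SpectrallyIndependent μ η) (hη0 : 0 ≤ η)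
    (hb0 : 0 < b) (hb1 : b ≤ 1) (hb : MarginallyBounded μ b)
    {f : (V → Fin q) → ℝ} (hf : ∀ σ, 0 ≤ f σ) {N : ℕ} (hN : 4 * η / b + 1 ≤ N)
    (hn : 2 * N ≤ b ^ 3 / (4 * (Δ : ℝ) ^ 2) * Fintype.card V) :
    entOn μ f Finset.univ - entOn μ f ∅ ≤ (8 * (Δ : ℝ) ^ 2 / b ^ 3) ^ N *
      (2 * ∑ v, (entOn μ f Finset.univ - entOn μ f {v}ᶜ)) := by
  have hΔ3' : (3 : ℝ) ≤ Δ := by exact_mod_cast hΔ3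
  have hN1 : (1 : ℝ) ≤ N := le_trans (by
    have : 0 ≤ 4 * η / b := by positivity
    linarith) hN
  set n := Fintype.card V with hnd
  -- `θ` is chosen so that `l / n ≤ 2θ = b³/(2Δ²)` absorbs both the cost `b^(-3)` and the count `Δ²`
  -- per vertex, leaving ratio `1/2`. Rounding `l` up at most doubles `θn`, since `θn ≥ 2N ≥ 1`.
  set θ : ℝ := b ^ 3 / (4 * (Δ : ℝ) ^ 2) with hθ
  have hb3 : b ^ 3 ≤ 1 := pow_le_one₀ hb0.le hb1
  have hθ0 : 0 < θ := by positivity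
  have hθ1 : θ ≤ 1 := by
    rw [hθ, div_le_one (by positivity)]
    nlinarith
  have hn0 : (0 : ℝ) < n := by
    by_contra! h
    nlinarith
  obtain ⟨l, hl⟩ : ∃ l, l = ⌈θ * n⌉₊ := ⟨_, rfl⟩
  have hl1 : θ * n ≤ l := hl ▸ Nat.le_ceil _
  have hl2 : (l : ℝ) ≤ 2 * θ * n := by
    have := (Nat.ceil_lt_add_one (mul_pos hθ0 hn0).le).le
    rw [← hl] at this
    linarith
  have hln : l ≤ n := by
    rw [hl]
    exact Nat.ceil_le.2 (by nlinarith)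
  have hNl' : 2 * (N : ℝ) ≤ l := hn.trans hl1
  have hNl : N < l := by
    have : (N : ℝ) < l := by linarith
    exact_mod_cast this
  set δ : V → ℝ := fun v => entOn μ f Finset.univ - entOn μ f {v}ᶜ with hδ
  have hδ0 : ∀ v, 0 ≤ δ v := fun v => sub_nonneg.2 (entOn_mono hμ hf (Finset.subset_univ _))
  let w : ℕ → ℝ := fun k => 16 * (1 / b) ^ (3 * k)
  have hw0 : ∀ k, 0 ≤ w k := fun k => by positivity
  have h1b : 1 ≤ 1 / b := (one_le_div hb0).2 hb1
  have hwmono : Monotone w := fun i j hij => by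
    have := pow_le_pow_right₀ h1b (by omega : 3 * i ≤ 3 * j)
    simp only [w]
    linarith
  have hchoose : (0 : ℝ) < n.choose l := by exact_mod_cast Nat.choose_pos hln
  have hblock : (∑ S ∈ Finset.powersetCard l Finset.univ,
      (entOn μ f Finset.univ - entOn μ f Sᶜ)) / n.choose l ≤ 2 * ∑ v, δ v := by
    rw [div_le_iff₀ hchoose]
    calc _ ≤ ∑ S ∈ Finset.powersetCard l (Finset.univ : Finset V), ∑ v ∈ S,
            w (component G S v).card * δ v :=
          Finset.sum_le_sum fun S _ => entOn_sub_le_sum_component hμ hG hf hwmono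
            (fun C => entOn_sub_le_crude hμ hc hb0 hb hf C) S
      _ = ∑ v, ∑ S ∈ (Finset.powersetCard l Finset.univ).filter (v ∈ ·),
            w (component G S v).card * δ v :=
          Finset.sum_comm' fun S v => by simp
      _ ≤ ∑ v, 2 * n.choose l * δ v := by
          refine Finset.sum_le_sum fun v _ => ?_
          rw [← Finset.sum_mul]
          refine mul_le_mul_of_nonneg_right ?_ (hδ0 v)
          refine (sum_weight_component_le G hΔ hln hw0 v).trans ?_
          rw [← Finset.sum_mul]
          refine mul_le_mul_of_nonneg_right ?_ hchoose.le
          calc _ ≤ ∑ k ∈ Finset.range n, (1 / 2 : ℝ) ^ k := by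
                refine Finset.sum_le_sum fun k _ => ?_
                have hratio : (l : ℝ) / n ≤ b ^ 3 / (2 * (Δ : ℝ) ^ 2) := by
                  rw [div_le_iff₀ hn0]
                  refine hl2.trans (le_of_eq ?_)
                  rw [hθ]
                  ring
                calc (Δ : ℝ) ^ (2 * k) * w (k + 1) * ((l : ℝ) / n) ^ (k + 1)
                    ≤ (Δ : ℝ) ^ (2 * k) * w (k + 1) * (b ^ 3 / (2 * (Δ : ℝ) ^ 2)) ^ (k + 1) := by
                      have := hw0 (k + 1)
                      gcongr
                  _ = 8 / (Δ : ℝ) ^ 2 * (1 / 2 : ℝ) ^ k := by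
                      have hΔ0 : (Δ : ℝ) ≠ 0 := by linarith
                      simp only [w, pow_mul, div_pow, mul_pow, one_pow, pow_succ _ k]
                      field_simp
                      norm_num
                  _ ≤ 1 * (1 / 2 : ℝ) ^ k := by
                      refine mul_le_mul_of_nonneg_right ?_ (by positivity)
                      rw [div_le_one (by positivity)]
                      nlinarith
                  _ = _ := one_mul _
            _ ≤ 2 := sum_geometric_two_le n
      _ = _ := by rw [← Finset.mul_sum]; ring
  have hfact := entOn_block_factorization hμ hη hη0 hb0 hb hf hN hNl hln
  have hlN : 0 < (l : ℝ) - N := by linarith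
  have hnN : 0 ≤ (n : ℝ) - N := by
    have : (l : ℝ) ≤ n := by exact_mod_cast hln
    linarith
  -- As `N ≤ θn/2`, the denominator `l - N` is at least `θn/2`.
  have hbase : ((n : ℝ) - N) / (l - N) ≤ 8 * (Δ : ℝ) ^ 2 / b ^ 3 := by
    rw [div_le_iff₀ hlN]
    have h2 : 8 * (Δ : ℝ) ^ 2 / b ^ 3 * (θ * n / 2) = n := by
      rw [hθ]
      field_simp
      norm_num
    have h3 : 8 * (Δ : ℝ) ^ 2 / b ^ 3 * (θ * n / 2) ≤ 8 * (Δ : ℝ) ^ 2 / b ^ 3 * (l - N) :=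
      mul_le_mul_of_nonneg_left (by linarith) (by positivity)
    linarith
  refine hfact.trans (mul_le_mul ?_ hblock ?_ (by positivity))
  · exact pow_le_pow_left₀ (div_nonneg hnN hlN.le) hbase N
  · exact div_nonneg (Finset.sum_nonneg fun S _ =>
      sub_nonneg.2 (entOn_mono hμ hf (Finset.subset_univ _))) hchoose.le

/-- When `n < 8NΔ²/b³`, blocks of size `2N` already give `(n - N)/(2N - N)` below the required base,
and the crude bound on them costs only `16 b^(-6N)`; no Markov property is needed. If `n ≤ 2N`, the
whole vertex set serves as the block. -/
theorem tensorization_of_small {Δ : ℕ} (hΔ3 : 3 ≤ Δ) (hμ : ∀ σ, 0 ≤ μ σ)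
    (hc : TotallyConnected μ) {η b : ℝ} (hη : SpectrallyIndependent μ η) (hη0 : 0 ≤ η)
    (hb0 : 0 < b) (hb1 : b ≤ 1) (hb : MarginallyBounded μ b)
    {f : (V → Fin q) → ℝ} (hf : ∀ σ, 0 ≤ f σ) {N : ℕ} (hN : 4 * η / b + 1 ≤ N)
    (hn : b ^ 3 / (4 * (Δ : ℝ) ^ 2) * Fintype.card V < 2 * N) :
    entOn μ f Finset.univ - entOn μ f ∅ ≤ (8 * (Δ : ℝ) ^ 2 / b ^ 3) ^ N *
      (16 * (1 / b) ^ (6 * N) * ∑ v, (entOn μ f Finset.univ - entOn μ f {v}ᶜ)) := by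
  have hΔ3' : (3 : ℝ) ≤ Δ := by exact_mod_cast hΔ3
  have hN1 : (1 : ℝ) ≤ N := le_trans (by
    have : 0 ≤ 4 * η / b := by positivity
    linarith) hN
  have hN1' : 1 ≤ N := by exact_mod_cast hN1
  set n := Fintype.card V with hnd
  have hb3 : b ^ 3 ≤ 1 := pow_le_one₀ hb0.le hb1
  have h1b : 1 ≤ 1 / b := (one_le_div hb0).2 hb1
  set δ : V → ℝ := fun v => entOn μ f Finset.univ - entOn μ f {v}ᶜ with hδ
  have hδ0 : ∀ v, 0 ≤ δ v := fun v => sub_nonneg.2 (entOn_mono hμ hf (Finset.subset_univ _))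
  have hS : ∀ S : Finset V, S.card ≤ 2 * N → entOn μ f Finset.univ - entOn μ f Sᶜ ≤
      16 * (1 / b) ^ (6 * N) * ∑ v, δ v := by
    intro S hS
    refine (entOn_sub_le_crude hμ hc hb0 hb hf S).trans ?_
    have h1 : (1 / b) ^ (3 * S.card) ≤ (1 / b) ^ (6 * N) := pow_le_pow_right₀ h1b (by omega)
    have h2 : ∑ v ∈ S, δ v ≤ ∑ v, δ v :=
      Finset.sum_le_sum_of_subset_of_nonneg (Finset.subset_univ S) fun v _ _ => hδ0 v
    have h3 : 0 ≤ ∑ v ∈ S, δ v := Finset.sum_nonneg fun v _ => hδ0 v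
    gcongr
  have hsum0 : 0 ≤ 16 * (1 / b) ^ (6 * N) * ∑ v, δ v :=
    mul_nonneg (by positivity) (Finset.sum_nonneg fun v _ => hδ0 v)
  have hbase1 : 1 ≤ 8 * (Δ : ℝ) ^ 2 / b ^ 3 := by
    rw [one_le_div (by positivity)]
    nlinarith
  rcases le_or_gt n (2 * N) with h | h
  · have := hS Finset.univ h
    rw [Finset.compl_univ] at this
    exact this.trans (le_mul_of_one_le_left hsum0 (one_le_pow₀ hbase1))
  · have hchoose : (0 : ℝ) < n.choose (2 * N) := by exact_mod_cast Nat.choose_pos h.le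
    have hblock : (∑ S ∈ Finset.powersetCard (2 * N) Finset.univ,
        (entOn μ f Finset.univ - entOn μ f Sᶜ)) / n.choose (2 * N) ≤
        16 * (1 / b) ^ (6 * N) * ∑ v, δ v := by
      rw [div_le_iff₀ hchoose]
      refine (Finset.sum_le_card_nsmul _ _ _ fun S hS' =>
        hS S (Finset.mem_powersetCard.1 hS').2.le).trans (le_of_eq ?_)
      rw [Finset.card_powersetCard, Finset.card_univ, nsmul_eq_mul, mul_comm]
    have hfact := entOn_block_factorization hμ hη hη0 hb0 hb hf hN (by omega : N < 2 * N) h.le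
    have hlN : 0 < ((2 * N : ℕ) : ℝ) - N := by push_cast; linarith
    have hnN : 0 ≤ (n : ℝ) - N := by
      have : ((2 * N : ℕ) : ℝ) ≤ n := by exact_mod_cast h.le
      linarith
    have hbase : ((n : ℝ) - N) / ((2 * N : ℕ) - N) ≤ 8 * (Δ : ℝ) ^ 2 / b ^ 3 := by
      rw [div_le_iff₀ hlN]
      have h2 : 8 * (Δ : ℝ) ^ 2 / b ^ 3 * (b ^ 3 / (4 * (Δ : ℝ) ^ 2) * n) = 2 * n := by
        field_simp
        ring
      have h3 := mul_lt_mul_of_pos_left hn (by positivity : 0 < 8 * (Δ : ℝ) ^ 2 / b ^ 3)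
      push_cast
      nlinarith
    refine hfact.trans (mul_le_mul ?_ hblock ?_ (by positivity))
    · exact pow_le_pow_left₀ (div_nonneg hnN hlN.le) hbase N
    · exact div_nonneg (Finset.sum_nonneg fun S _ =>
        sub_nonneg.2 (entOn_mono hμ hf (Finset.subset_univ _))) hchoose.le

/-- Approximate tensorization of entropy. -/
theorem approximate_tensorization (G : SimpleGraph V) [DecidableRel G.Adj] {Δ : ℕ} (hΔ3 : 3 ≤ Δ)
    (hΔ : ∀ v, G.degree v ≤ Δ) (hμ : ∀ σ, 0 ≤ μ σ) (hG : SpatialMarkov G μ)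
    (hc : TotallyConnected μ) {η b : ℝ} (hη : SpectrallyIndependent μ η) (hη0 : 0 ≤ η)
    (hb0 : 0 < b) (hb1 : b ≤ 1) (hb : MarginallyBounded μ b)
    {f : (V → Fin q) → ℝ} (hf : ∀ σ, 0 ≤ f σ) {N : ℕ} (hN : 4 * η / b + 1 ≤ N) :
    entOn μ f Finset.univ - entOn μ f ∅ ≤ ((Δ : ℝ) / b) ^ (13 * N) *
      ∑ v, (entOn μ f Finset.univ - entOn μ f {v}ᶜ) := by
  have hΔ3' : (3 : ℝ) ≤ Δ := by exact_mod_cast hΔ3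
  have hN1 : 1 ≤ N := by
    have : (1 : ℝ) ≤ N := le_trans (by
      have : 0 ≤ 4 * η / b := by positivity
      linarith) hN
    exact_mod_cast this
  set r : ℝ := (Δ : ℝ) / b with hr
  have hr3 : 3 ≤ r := by
    rw [hr, le_div_iff₀ hb0]
    nlinarith
  have hrb : 1 / b ≤ r := div_le_div_of_nonneg_right (by linarith) hb0.le
  -- The exponent `13` is `4 + 3 + 6`, from `8Δ²/b³ ≤ r⁴`, `16 ≤ r³` and `1/b ≤ r`.
  have hbase : 8 * (Δ : ℝ) ^ 2 / b ^ 3 ≤ r ^ 4 := by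
    rw [hr, div_pow, div_le_div_iff₀ (by positivity) (by positivity)]
    have h1 : 8 * b ≤ (Δ : ℝ) ^ 2 := by nlinarith
    calc 8 * (Δ : ℝ) ^ 2 * b ^ 4 = (8 * b) * ((Δ : ℝ) ^ 2 * b ^ 3) := by ring
      _ ≤ (Δ : ℝ) ^ 2 * ((Δ : ℝ) ^ 2 * b ^ 3) := by gcongr
      _ = _ := by ring
  have hb1' : (8 * (Δ : ℝ) ^ 2 / b ^ 3) ^ N ≤ r ^ (4 * N) := by
    rw [pow_mul]
    exact pow_le_pow_left₀ (by positivity) hbase N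
  have hr1 : 1 ≤ r := by linarith
  have h16 : 16 ≤ r ^ (3 * N) :=
    calc (16 : ℝ) ≤ 3 ^ 3 := by norm_num
      _ ≤ r ^ 3 := pow_le_pow_left₀ (by norm_num) hr3 3
      _ ≤ r ^ (3 * N) := pow_le_pow_right₀ hr1 (by omega)
  have hsum0 : 0 ≤ ∑ v, (entOn μ f Finset.univ - entOn μ f {v}ᶜ) :=
    Finset.sum_nonneg fun v _ => sub_nonneg.2 (entOn_mono hμ hf (Finset.subset_univ _))
  have h6 : (1 / b) ^ (6 * N) ≤ r ^ (6 * N) := pow_le_pow_left₀ (by positivity) hrb _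
  have hr0 : 0 < r := by linarith
  rcases le_or_gt (2 * (N : ℝ)) (b ^ 3 / (4 * (Δ : ℝ) ^ 2) * Fintype.card V) with h | h
  · refine (tensorization_of_large G hΔ3 hΔ hμ hG hc hη hη0 hb0 hb1 hb hf hN h).trans ?_
    rw [← mul_assoc]
    refine mul_le_mul_of_nonneg_right ?_ hsum0
    calc (8 * (Δ : ℝ) ^ 2 / b ^ 3) ^ N * 2 ≤ r ^ (4 * N) * r ^ (3 * N) := by
          gcongr
          linarith
      _ = r ^ (7 * N) := by rw [← pow_add]; congr 1; ring
      _ ≤ r ^ (13 * N) := pow_le_pow_right₀ hr1 (by omega)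
  · refine (tensorization_of_small hΔ3 hμ hc hη hη0 hb0 hb1 hb hf hN h).trans ?_
    rw [← mul_assoc]
    refine mul_le_mul_of_nonneg_right ?_ hsum0
    calc (8 * (Δ : ℝ) ^ 2 / b ^ 3) ^ N * (16 * (1 / b) ^ (6 * N))
        ≤ r ^ (4 * N) * (r ^ (3 * N) * r ^ (6 * N)) := by gcongr
      _ = r ^ (13 * N) := by rw [← pow_add, ← pow_add]; congr 1; ring

end Tensorization

/-! ### Glauber dynamics and the modified log-Sobolev inequality. -/

section Glauber

variable {V : Type u} {q : ℕ} {μ : (V → Fin q) → ℝ}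

/-- The extension by zero of a function on the support of `μ`. -/
noncomputable def zeroExtend (f : Support μ → ℝ) (σ : V → Fin q) : ℝ :=
  if h : 0 < μ σ then f ⟨σ, h⟩ else 0

@[simp] theorem zeroExtend_coe (f : Support μ → ℝ) (x : Support μ) : zeroExtend f x.1 = f x :=
  dif_pos x.2

theorem zeroExtend_nonneg {f : Support μ → ℝ} (hf : ∀ x, 0 ≤ f x) (σ : V → Fin q) :
    0 ≤ zeroExtend f σ := by
  unfold zeroExtend
  split_ifs
  exacts [hf _, le_rfl]

variable [Fintype V] [DecidableEq V]

theorem sum_support (hμ : ∀ σ, 0 ≤ μ σ) (F : (V → Fin q) → ℝ) :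
    ∑ x : Support μ, μ x.1 * F x.1 = ∑ σ, μ σ * F σ := by
  rw [← Finset.sum_subset (Finset.subset_univ (Finset.univ.filter fun σ => 0 < μ σ))
    (fun σ _ hσ => by
      have : μ σ = 0 := le_antisymm (not_lt.1 fun h => hσ (by simpa using h)) (hμ σ)
      rw [this, zero_mul])]
  exact (Finset.sum_subtype _ (by simp) fun σ => μ σ * F σ).symm

theorem glauber_apply (x y : Support μ) : glauber μ x y = 1 / (Fintype.card V : ℝ) *
    ∑ v, if y.1 ∈ fiber {v}ᶜ x.1 then μ y.1 / ∑ ω ∈ fiber {v}ᶜ x.1, μ ω else 0 := by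
  rw [glauber]
  congr 1
  refine Finset.sum_congr rfl fun v _ => ?_
  have e1 : {ω : V → Fin q | ∀ u, u ≠ v → ω u = x.1 u} = (fiber {v}ᶜ x.1 : Set (V → Fin q)) := by
    ext ω
    simp
  have e2 : (∀ u, u ≠ v → y.1 u = x.1 u) ↔ y.1 ∈ fiber {v}ᶜ x.1 := by simp
  simp only [e2]
  refine if_ctx_congr Iff.rfl (fun h => ?_) fun _ => rfl
  have e3 : spinEvent v (y.1 v) ∩ (fiber {v}ᶜ x.1 : Set (V → Fin q)) =
      (({y.1} : Finset (V → Fin q)) : Set (V → Fin q)) := by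
    ext ω
    simp only [spinEvent, Set.mem_inter_iff, Set.mem_ofPred_eq, Finset.mem_coe,
      Finset.mem_singleton]
    constructor
    · rintro ⟨h1, h2⟩
      funext u
      by_cases hu : u = v
      · rw [hu, h1]
      · have hu' : u ∈ ({v}ᶜ : Finset V) := by simpa using hu
        rw [mem_fiber.1 h2 u hu', mem_fiber.1 h u hu']
    · rintro rfl
      exact ⟨rfl, h⟩
  rw [condProb, e1, e3, prob_coe, prob_coe, Finset.sum_singleton]

theorem glauber_nonneg (hμ : ∀ σ, 0 ≤ μ σ) (x y : Support μ) : 0 ≤ glauber μ x y := by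
  rw [glauber_apply]
  refine mul_nonneg (by positivity) (Finset.sum_nonneg fun v _ => ?_)
  split_ifs
  exacts [div_nonneg (hμ _) (fiber_sum_nonneg hμ _ _), le_rfl]

theorem glauber_pos (hμ : ∀ σ, 0 ≤ μ σ) {x y : Support μ} {v : V} (h : y.1 ∈ fiber {v}ᶜ x.1) :
    0 < glauber μ x y := by
  have : Nonempty V := ⟨v⟩
  rw [glauber_apply]
  refine mul_pos (by positivity) (Finset.sum_pos' (fun u _ => ?_) ⟨v, Finset.mem_univ v, ?_⟩)
  · split_ifs
    exacts [div_nonneg (hμ _) (fiber_sum_nonneg hμ _ _), le_rfl]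
  · rw [if_pos h]
    exact div_pos y.2 (fiber_sum_pos hμ _ x.2)

theorem glauber_reversible (x y : Support μ) :
    μ x.1 * glauber μ x y = μ y.1 * glauber μ y x := by
  rw [glauber_apply, glauber_apply]
  simp only [Finset.mul_sum]
  refine Finset.sum_congr rfl fun v _ => ?_
  simp only [mul_ite, mul_zero]
  refine if_ctx_congr mem_fiber_comm (fun h => ?_) fun _ => rfl
  rw [fiber_eq h]
  ring

/-- The bridge between the chain and `entOn`: the transition operator is the average over `v` of
conditional expectation given all spins except that at `v`. -/
theorem sum_glauber_mul (hμ : ∀ σ, 0 ≤ μ σ) (f : Support μ → ℝ) (x : Support μ) :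
    ∑ y, glauber μ x y * f y =
      1 / (Fintype.card V : ℝ) * ∑ v, cexp μ {v}ᶜ (zeroExtend f) x.1 := by
  have h1 : ∀ y : Support μ, glauber μ x y * f y = 1 / (Fintype.card V : ℝ) *
      ∑ v, (if y.1 ∈ fiber {v}ᶜ x.1 then μ y.1 / ∑ ω ∈ fiber {v}ᶜ x.1, μ ω else 0) * f y := by
    intro y
    rw [glauber_apply, mul_assoc, Finset.sum_mul]
  rw [Finset.sum_congr rfl fun y _ => h1 y, ← Finset.mul_sum, Finset.sum_comm]
  congr 1
  refine Finset.sum_congr rfl fun v _ => ?_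
  have h2 := sum_support hμ fun σ =>
    if σ ∈ fiber {v}ᶜ x.1 then zeroExtend f σ / ∑ ω ∈ fiber {v}ᶜ x.1, μ ω else 0
  rw [cexp, Finset.sum_div]
  simp only [mul_ite, mul_zero, Finset.sum_ite_mem, Finset.univ_inter, zeroExtend_coe] at h2
  simp only [mul_div_assoc]
  rw [← h2]
  refine Finset.sum_congr rfl fun y _ => ?_
  rw [ite_mul, zero_mul]
  refine if_congr Iff.rfl ?_ rfl
  ring

theorem sum_glauber [Nonempty V] (hμ : ∀ σ, 0 ≤ μ σ) (x : Support μ) :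
    ∑ y, glauber μ x y = 1 := by
  have h := sum_glauber_mul hμ (fun _ => 1) x
  simp only [mul_one] at h
  rw [h]
  have h1 : ∀ v, cexp μ {v}ᶜ (zeroExtend fun _ : Support μ => 1) x.1 = 1 := by
    intro v
    rw [cexp, div_eq_one_iff_eq (fiber_sum_pos hμ _ x.2).ne']
    refine Finset.sum_congr rfl fun ω _ => ?_
    rcases (hμ ω).eq_or_lt with h0 | h0
    · simp [← h0]
    · simp [zeroExtend, h0]
  simp only [h1, Finset.sum_const, Finset.card_univ, nsmul_eq_mul, mul_one]
  exact one_div_mul_cancel (by simp)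

theorem entOn_univ_eq (hμ : ∀ σ, 0 ≤ μ σ) (f : (V → Fin q) → ℝ) :
    entOn μ f Finset.univ = ∑ σ, μ σ * (f σ * Real.log (f σ)) := by
  refine Finset.sum_congr rfl fun σ _ => ?_
  rcases (hμ σ).eq_or_lt with h0 | h0
  · simp [← h0]
  · rw [cexp_univ f h0]

theorem entropy_eq_entOn (hμ : ∀ σ, 0 ≤ μ σ) (h1 : ∑ σ, μ σ = 1) (F : (V → Fin q) → ℝ) :
    entropy (fun x : Support μ => μ x.1) (fun x => F x.1) = entOn μ F Finset.univ - entOn μ F ∅ := by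
  have e : entOn μ F ∅ = (∑ σ, μ σ * F σ) * Real.log (∑ σ, μ σ * F σ) := by
    simp only [entOn, cexp, fiber_empty, h1, div_one, ← mul_assoc, ← Finset.sum_mul]
  rw [entropy, sum_support hμ F, sum_support hμ fun σ => F σ * Real.log (F σ), e,
    entOn_univ_eq hμ]

theorem EReal_coe_sum {ι : Type*} (s : Finset ι) (f : ι → ℝ) :
    ((∑ i ∈ s, f i : ℝ) : EReal) = ∑ i ∈ s, (f i : EReal) := by
  classical
  induction s using Finset.induction_on with
  | empty => simp
  | insert a s ha ih => rw [Finset.sum_insert ha, Finset.sum_insert ha, EReal.coe_add, ih]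

/-- The single-site entropies are dominated by the Dirichlet form. -/
theorem sum_entOn_sub_le_dirichlet [Nonempty V] (hμ : ∀ σ, 0 ≤ μ σ) {f : Support μ → ℝ}
    (hf : ∀ x, 0 < f x) :
    1 / (Fintype.card V : ℝ) *
        ∑ v, (entOn μ (zeroExtend f) Finset.univ - entOn μ (zeroExtend f) {v}ᶜ) ≤
      1 / 2 * ∑ x, ∑ y, μ x.1 * glauber μ x y *
        ((f x - f y) * (Real.log (f x) - Real.log (f y))) := by
  set F := zeroExtend f with hF
  have hF0 : ∀ σ, 0 ≤ F σ := zeroExtend_nonneg fun x => (hf x).le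
  have hFpos : ∀ σ, 0 < μ σ → 0 < F σ := fun σ h => by simp [hF, zeroExtend, h, hf]
  -- Reversibility makes the two halves of the symmetric form equal, so it reduces to `E[(f - Pf)
  -- log f]`.
  have e1 : ∑ x, ∑ y, μ x.1 * glauber μ x y * ((f x - f y) * (Real.log (f x) - Real.log (f y))) =
      2 * ∑ x : Support μ, μ x.1 * ((f x - ∑ y, glauber μ x y * f y) * Real.log (f x)) := by
    have a1 : ∑ x, ∑ y, μ x.1 * glauber μ x y * ((f x - f y) * Real.log (f x)) =
        ∑ x : Support μ, μ x.1 * ((f x - ∑ y, glauber μ x y * f y) * Real.log (f x)) := by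
      refine Finset.sum_congr rfl fun x _ => ?_
      have : f x = ∑ y, glauber μ x y * f x := by rw [← Finset.sum_mul, sum_glauber hμ, one_mul]
      nth_rewrite 3 [this]
      rw [← Finset.sum_sub_distrib, Finset.sum_mul, Finset.mul_sum]
      exact Finset.sum_congr rfl fun y _ => by ring
    have a2 : ∑ x, ∑ y, μ x.1 * glauber μ x y * ((f y - f x) * Real.log (f y)) =
        ∑ x, ∑ y, μ x.1 * glauber μ x y * ((f x - f y) * Real.log (f x)) := by
      rw [Finset.sum_comm]
      exact Finset.sum_congr rfl fun x _ => Finset.sum_congr rfl fun y _ => by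
        rw [glauber_reversible]
    have a3 : ∑ x, ∑ y, μ x.1 * glauber μ x y *
        ((f x - f y) * (Real.log (f x) - Real.log (f y))) =
        ∑ x, ∑ y, μ x.1 * glauber μ x y * ((f x - f y) * Real.log (f x)) +
          ∑ x, ∑ y, μ x.1 * glauber μ x y * ((f y - f x) * Real.log (f y)) := by
      simp only [← Finset.sum_add_distrib]
      exact Finset.sum_congr rfl fun x _ => Finset.sum_congr rfl fun y _ => by ring
    rw [a3, a2, ← two_mul, a1]
  have e2 : ∑ x : Support μ, μ x.1 * ((f x - ∑ y, glauber μ x y * f y) * Real.log (f x)) =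
      1 / (Fintype.card V : ℝ) * ∑ v, ∑ σ, μ σ * ((F σ - cexp μ {v}ᶜ F σ) * Real.log (F σ)) := by
    have hn : (Fintype.card V : ℝ) ≠ 0 := by simp
    rw [Finset.sum_comm, Finset.mul_sum]
    have := sum_support hμ fun σ => 1 / (Fintype.card V : ℝ) *
      ∑ v, ((F σ - cexp μ {v}ᶜ F σ) * Real.log (F σ))
    simp only [Finset.mul_sum] at this ⊢
    rw [show (∑ σ, ∑ v, 1 / (Fintype.card V : ℝ) * (μ σ * ((F σ - cexp μ {v}ᶜ F σ) *
      Real.log (F σ)))) = ∑ σ, ∑ v, μ σ * (1 / (Fintype.card V : ℝ) * ((F σ - cexp μ {v}ᶜ F σ) *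
      Real.log (F σ))) from Finset.sum_congr rfl fun σ _ => Finset.sum_congr rfl fun v _ => by ring,
      ← this]
    refine Finset.sum_congr rfl fun x _ => ?_
    rw [sum_glauber_mul hμ, ← hF, ← Finset.mul_sum, ← Finset.mul_sum, ← Finset.sum_mul,
      Finset.sum_sub_distrib, Finset.sum_const, Finset.card_univ, nsmul_eq_mul]
    simp only [hF, zeroExtend_coe]
    field_simp
  rw [e1, ← mul_assoc, one_div_mul_cancel two_ne_zero, one_mul, e2]
  refine mul_le_mul_of_nonneg_left (Finset.sum_le_sum fun v _ => ?_) (by positivity)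
  -- Nonnegativity of relative entropy: since `F` and its conditional expectation `c` have equal
  -- means, `E[c log F] ≤ E[c log c]`.
  have h1 : ∑ σ, μ σ * (cexp μ {v}ᶜ F σ * Real.log (F σ)) ≤ entOn μ F {v}ᶜ := by
    rw [entOn_eq hμ]
    have h2 : ∑ σ, μ σ * (cexp μ {v}ᶜ F σ * Real.log (cexp μ {v}ᶜ F σ)) =
        ∑ σ, μ σ * (cexp μ {v}ᶜ F σ * Real.log (cexp μ {v}ᶜ F σ) + F σ - cexp μ {v}ᶜ F σ) := by
      simp only [mul_sub, mul_add, Finset.sum_sub_distrib, Finset.sum_add_distrib, sum_cexp hμ]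
      ring
    rw [h2]
    refine Finset.sum_le_sum fun σ _ => ?_
    rcases (hμ σ).eq_or_lt with h0 | h0
    · simp [← h0]
    refine mul_le_mul_of_nonneg_left ?_ (hμ σ)
    have p1 := hFpos σ h0
    have p2 := cexp_pos hμ {v}ᶜ hF0 h0 p1
    have hlog := Real.log_le_sub_one_of_pos (div_pos p1 p2)
    rw [Real.log_div p1.ne' p2.ne'] at hlog
    have := mul_le_mul_of_nonneg_left hlog p2.le
    rw [mul_sub, mul_sub, mul_div_cancel₀ _ p2.ne'] at this
    linarith
  rw [entOn_univ_eq hμ]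
  simp only [sub_mul, mul_sub, Finset.sum_sub_distrib]
  linarith

/-- Nonnegativity of every extended-real term is what lets a single infinite term force the whole
Dirichlet form to be `⊤`. -/
theorem dirichlet_term_nonneg {a b c : ℝ} (ha : 0 ≤ a) (hb : 0 ≤ b) (hc : 0 ≤ c) :
    0 ≤ ((c : ℝ) : EReal) * (((a : EReal) - b) *
      (ENNReal.log (ENNReal.ofReal a) - ENNReal.log (ENNReal.ofReal b))) := by
  refine mul_nonneg (EReal.coe_nonneg.2 hc) ?_
  rcases ha.eq_or_lt with rfl | ha <;> rcases hb.eq_or_lt with rfl | hb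
  · simp
  · rw [ENNReal.ofReal_zero, ENNReal.log_zero, EReal.bot_sub, ← EReal.coe_sub,
      EReal.coe_mul_bot_of_neg (by linarith)]
    exact le_top
  · rw [ENNReal.ofReal_zero, ENNReal.log_zero, ENNReal.log_ofReal_of_pos ha, EReal.coe_sub_bot,
      ← EReal.coe_sub, EReal.coe_mul_top_of_pos (by linarith)]
    exact le_top
  · rw [ENNReal.log_ofReal_of_pos ha, ENNReal.log_ofReal_of_pos hb, ← EReal.coe_sub,
      ← EReal.coe_sub, ← EReal.coe_mul, EReal.coe_nonneg]
    rcases le_total a b with h | h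
    · exact mul_nonneg_of_nonpos_of_nonpos (by linarith) (by linarith [Real.log_le_log ha h])
    · exact mul_nonneg (by linarith) (by linarith [Real.log_le_log hb h])

/-- Otherwise the indicator of the zero set would be unchanged by every single-site move, hence
constant by total-connectedness on the whole vertex set. -/
theorem exists_adjacent_zero (hμ : ∀ σ, 0 ≤ μ σ) (hc : TotallyConnected μ) [Nonempty V]
    {f : Support μ → ℝ} {x y : Support μ} (hx : f x = 0) (hy : f y ≠ 0) :
    ∃ x y : Support μ, 0 < glauber μ x y ∧ f x = 0 ∧ f y ≠ 0 := by
  by_contra! hno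
  have hmem : ∀ σ ω : V → Fin q, ω ∈ fiber (Finset.univ : Finset V)ᶜ σ := fun σ ω => by simp
  have key := abs_sub_le_of_totallyConnected hμ hc Finset.univ_nonempty x.2
    (g := fun σ => if zeroExtend f σ = 0 then 1 else 0) le_rfl (by
      intro v _ ω _ ω' hω' h0 h0'
      have h1 := hno ⟨ω, h0⟩ ⟨ω', h0'⟩ (glauber_pos hμ hω')
      have h2 := hno ⟨ω', h0'⟩ ⟨ω, h0⟩ (glauber_pos hμ (mem_fiber_comm.1 hω'))
      have h3 : zeroExtend f ω = 0 ↔ zeroExtend f ω' = 0 := by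
        simp only [zeroExtend, h0, h0', dif_pos]
        exact ⟨h1, h2⟩
      simp [h3]) (hmem x.1 x.1) (hmem x.1 y.1) x.2 y.2
  simp only [zeroExtend_coe, hx, hy, if_true, if_false, mul_zero] at key
  norm_num at key

/-- Approximate tensorization of entropy implies the modified log-Sobolev inequality. -/
theorem modifiedLogSobolev_of_tensorization [Nonempty V] (hμ : ∀ σ, 0 ≤ μ σ)
    (h1 : ∑ σ, μ σ = 1) (hc : TotallyConnected μ) {C : ℝ} (hC : 0 < C)
    (hAT : ∀ F : (V → Fin q) → ℝ, (∀ σ, 0 ≤ F σ) → entOn μ F Finset.univ - entOn μ F ∅ ≤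
      C * ∑ v, (entOn μ F Finset.univ - entOn μ F {v}ᶜ)) :
    ModifiedLogSobolev (glauber μ) (fun x => μ x.1) (1 / (C * Fintype.card V)) := by
  intro f hf
  have hterm : ∀ x y : Support μ, 0 ≤ ((μ x.1 * glauber μ x y : ℝ) : EReal) *
      (((f x : EReal) - f y) *
        (ENNReal.log (ENNReal.ofReal (f x)) - ENNReal.log (ENNReal.ofReal (f y)))) := fun x y =>
    dirichlet_term_nonneg (hf x) (hf y) (mul_nonneg (hμ _) (glauber_nonneg hμ x y))
  have hhalf : (0 : EReal) ≤ ((1 / 2 : ℝ) : EReal) := EReal.coe_nonneg.2 (by norm_num)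
  have hent : entropy (fun x : Support μ => μ x.1) f =
      entOn μ (zeroExtend f) Finset.univ - entOn μ (zeroExtend f) ∅ := by
    rw [← entropy_eq_entOn hμ h1]
    simp only [zeroExtend_coe]
  rw [dirichletForm]
  by_cases hall : ∀ x, 0 < f x
  · have hreal := sum_entOn_sub_le_dirichlet hμ hall
    have hat := hAT _ (zeroExtend_nonneg hf)
    have e : ((1 / 2 : ℝ) : EReal) * ∑ x : Support μ, ∑ y : Support μ,
        ((μ x.1 * glauber μ x y : ℝ) : EReal) * (((f x : EReal) - f y) *
          (ENNReal.log (ENNReal.ofReal (f x)) - ENNReal.log (ENNReal.ofReal (f y)))) =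
        ((1 / 2 * ∑ x : Support μ, ∑ y : Support μ, μ x.1 * glauber μ x y *
          ((f x - f y) * (Real.log (f x) - Real.log (f y))) : ℝ) : EReal) := by
      simp only [ENNReal.log_ofReal_of_pos (hall _), ← EReal.coe_sub, ← EReal.coe_mul,
        ← EReal_coe_sum]
    rw [e, EReal.coe_le_coe_iff, hent]
    refine le_trans ?_ hreal
    have hn : 0 < (Fintype.card V : ℝ) := by simp [Fintype.card_pos]
    rw [div_mul_eq_mul_div, div_mul_eq_mul_div, one_mul, one_mul, div_le_div_iff₀ (by positivity) hn]
    nlinarith [mul_le_mul_of_nonneg_right hat hn.le]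
  · push Not at hall
    obtain ⟨x₀, hx₀⟩ := hall
    have hx₀ : f x₀ = 0 := le_antisymm hx₀ (hf x₀)
    by_cases hzero : ∀ x, f x = 0
    · have : entropy (fun x : Support μ => μ x.1) f = 0 := by simp [entropy, hzero]
      rw [this, mul_zero, EReal.coe_zero]
      exact mul_nonneg hhalf
        (Finset.sum_nonneg fun x _ => Finset.sum_nonneg fun y _ => hterm x y)
    · push Not at hzero
      obtain ⟨y₀, hy₀⟩ := hzero
      -- A transition of positive rate between a zero and a nonzero of `f` contributes `⊤`, so the
      -- inequality is trivial.
      obtain ⟨x, y, hxy, hx, hy⟩ := exists_adjacent_zero hμ hc hx₀ hy₀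
      have hypos : 0 < f y := lt_of_le_of_ne (hf y) (Ne.symm hy)
      have htop : ((μ x.1 * glauber μ x y : ℝ) : EReal) * (((f x : EReal) - f y) *
          (ENNReal.log (ENNReal.ofReal (f x)) - ENNReal.log (ENNReal.ofReal (f y)))) = ⊤ := by
        rw [hx, ENNReal.ofReal_zero, ENNReal.log_zero, EReal.bot_sub, ← EReal.coe_sub,
          EReal.coe_mul_bot_of_neg (by linarith), EReal.coe_mul_top_of_pos (mul_pos x.2 hxy)]
      have hle := (Finset.single_le_sum (fun y _ => hterm x y) (Finset.mem_univ y)).trans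
        (Finset.single_le_sum (f := fun x : Support μ => ∑ y : Support μ,
          ((μ x.1 * glauber μ x y : ℝ) : EReal) * (((f x : EReal) - f y) *
          (ENNReal.log (ENNReal.ofReal (f x)) - ENNReal.log (ENNReal.ofReal (f y)))))
          (fun x _ => Finset.sum_nonneg fun y _ => hterm x y) (Finset.mem_univ x))
      rw [htop, top_le_iff] at hle
      rw [hle, EReal.coe_mul_top_of_pos (by norm_num)]
      exact le_top

end Glauber

/-! ### Entropy decay and total variation. -/

section Mixing

theorem exists_mixingTime_eq {S : Type u} [Fintype S] [DecidableEq S] {P : Matrix S S ℝ}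
    {π : S → ℝ} {ε : ℝ} {N : ℕ} (h : ∀ x, ∃ t ≤ N, tvDist ((P ^ t) x) π ≤ ε) :
    ∃ T : ℕ, mixingTime P π ε = (T : ℕ∞) ∧ T ≤ N := by
  have hle : mixingTime P π ε ≤ (N : ℕ∞) := by
    refine iSup_le fun x => ?_
    obtain ⟨t, ht, htv⟩ := h x
    exact (iInf₂_le t htv).trans (by exact_mod_cast ht)
  obtain ⟨T, hT⟩ := ENat.ne_top_iff_exists.1 (hle.trans_lt (ENat.natCast_lt_top N)).ne
  refine ⟨T, hT.symm, ?_⟩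
  rw [← hT] at hle
  exact_mod_cast hle

variable {V : Type u} [Fintype V] [DecidableEq V] {q : ℕ} {μ : (V → Fin q) → ℝ}

/-- A Pinsker-type inequality. -/
theorem sq_sum_abs_le_entOn_sub (hμ : ∀ σ, 0 ≤ μ σ) (h1 : ∑ σ, μ σ = 1) {F : (V → Fin q) → ℝ}
    (hF : ∀ σ, 0 ≤ F σ) (hF1 : ∑ σ, μ σ * F σ = 1) :
    (1 / 2 * ∑ σ, μ σ * |F σ - 1|) ^ 2 ≤ entOn μ F Finset.univ - entOn μ F ∅ := by
  have h2 := hellinger_le_entOn_sub hμ hF (Finset.empty_subset Finset.univ)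
  have e1 : ∑ σ, μ σ * (√(cexp μ Finset.univ F σ) - √(cexp μ ∅ F σ)) ^ 2 =
      ∑ σ, μ σ * (√(F σ) - 1) ^ 2 := by
    refine Finset.sum_congr rfl fun σ _ => ?_
    rcases (hμ σ).eq_or_lt with h0 | h0
    · simp [← h0]
    · rw [cexp_univ F h0, cexp, fiber_empty, h1, hF1, div_one, Real.sqrt_one]
  rw [e1] at h2
  -- Cauchy–Schwarz for `F - 1 = (√F - 1)(√F + 1)`: the first factor is the Hellinger term, the
  -- second has second moment at most `4`, which cancels the squared `1/2`.
  have hcs := Finset.sum_mul_sq_le_sq_mul_sq Finset.univ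
    (fun σ => √(μ σ) * |√(F σ) - 1|) (fun σ => √(μ σ) * (√(F σ) + 1))
  have e2 : ∀ σ, √(μ σ) * |√(F σ) - 1| * (√(μ σ) * (√(F σ) + 1)) = μ σ * |F σ - 1| := by
    intro σ
    have hp : 0 ≤ √(F σ) + 1 := by positivity
    rw [mul_mul_mul_comm, Real.mul_self_sqrt (hμ σ)]
    have e3 : F σ - 1 = (√(F σ) - 1) * (√(F σ) + 1) := by
      linear_combination -Real.mul_self_sqrt (hF σ)
    rw [e3, abs_mul, abs_of_nonneg hp]
  simp only [e2, mul_pow, Real.sq_sqrt (hμ _), sq_abs] at hcs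
  have h3 : ∑ σ, μ σ * (√(F σ) + 1) ^ 2 ≤ 4 := by
    calc _ ≤ ∑ σ, (2 * (μ σ * F σ) + 2 * μ σ) := by
          refine Finset.sum_le_sum fun σ _ => ?_
          have hx := Real.sq_sqrt (hF σ)
          have : (√(F σ) + 1) ^ 2 ≤ 2 * F σ + 2 := by nlinarith [sq_nonneg (√(F σ) - 1)]
          nlinarith [mul_le_mul_of_nonneg_left this (hμ σ)]
      _ = 4 := by
          rw [Finset.sum_add_distrib, ← Finset.mul_sum, ← Finset.mul_sum, hF1, h1]
          norm_num
  have h4 : 0 ≤ ∑ σ, μ σ * (√(F σ) - 1) ^ 2 :=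
    Finset.sum_nonneg fun σ _ => mul_nonneg (hμ σ) (sq_nonneg _)
  nlinarith [mul_le_mul_of_nonneg_left h3 h4]

theorem tvDist_density (hμ : ∀ σ, 0 ≤ μ σ) (h1 : ∑ σ, μ σ = 1) {f : Support μ → ℝ}
    (hf : ∀ x, 0 ≤ f x) (hf1 : ∑ x : Support μ, μ x.1 * f x = 1) :
    tvDist (fun x : Support μ => μ x.1 * f x) (fun x => μ x.1) ^ 2 ≤
      entropy (fun x : Support μ => μ x.1) f := by
  have e1 : entropy (fun x : Support μ => μ x.1) f =
      entOn μ (zeroExtend f) Finset.univ - entOn μ (zeroExtend f) ∅ := by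
    rw [← entropy_eq_entOn hμ h1]
    simp only [zeroExtend_coe]
  have e2 : tvDist (fun x : Support μ => μ x.1 * f x) (fun x => μ x.1) =
      1 / 2 * ∑ σ, μ σ * |zeroExtend f σ - 1| := by
    rw [tvDist, ← sum_support hμ fun σ => |zeroExtend f σ - 1|]
    congr 1
    refine Finset.sum_congr rfl fun x _ => ?_
    rw [zeroExtend_coe, ← mul_sub_one, abs_mul, abs_of_nonneg (hμ _)]
  rw [e1, e2]
  refine sq_sum_abs_le_entOn_sub hμ h1 (zeroExtend_nonneg hf) ?_
  rw [← sum_support hμ, ← hf1]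
  simp only [zeroExtend_coe]

/-- Approximate tensorization implies that one step of the Glauber dynamics contracts entropy. -/
theorem entropy_glauber_le [Nonempty V] (hμ : ∀ σ, 0 ≤ μ σ) (h1 : ∑ σ, μ σ = 1) {C : ℝ}
    (hC : 0 < C)
    (hAT : ∀ F : (V → Fin q) → ℝ, (∀ σ, 0 ≤ F σ) → entOn μ F Finset.univ - entOn μ F ∅ ≤
      C * ∑ v, (entOn μ F Finset.univ - entOn μ F {v}ᶜ)) {f : Support μ → ℝ}
    (hf : ∀ x, 0 ≤ f x) :
    entropy (fun x : Support μ => μ x.1) (fun x => ∑ y, glauber μ x y * f y) ≤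
      (1 - 1 / (C * Fintype.card V)) * entropy (fun x : Support μ => μ x.1) f := by
  set F := zeroExtend f with hF
  have hF0 : ∀ σ, 0 ≤ F σ := zeroExtend_nonneg hf
  set n : ℝ := (Fintype.card V : ℝ) with hn
  have hn0 : 0 < n := by simp [hn, Fintype.card_pos]
  have hent : entropy (fun x : Support μ => μ x.1) f = entOn μ F Finset.univ - entOn μ F ∅ := by
    rw [← entropy_eq_entOn hμ h1]
    simp only [hF, zeroExtend_coe]
  let Q : (V → Fin q) → ℝ := fun σ => 1 / n * ∑ v, cexp μ {v}ᶜ F σ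
  have hQ0 : ∀ σ, 0 ≤ Q σ := fun σ => mul_nonneg (by positivity)
    (Finset.sum_nonneg fun v _ => cexp_nonneg hμ _ hF0 σ)
  have hQent : entropy (fun x : Support μ => μ x.1) (fun x => ∑ y, glauber μ x y * f y) =
      entOn μ Q Finset.univ - entOn μ Q ∅ := by
    rw [← entropy_eq_entOn hμ h1]
    simp only [sum_glauber_mul hμ, Q, hF, hn]
  have hQmean : ∑ σ, μ σ * Q σ = ∑ σ, μ σ * F σ := by
    have : ∀ σ, μ σ * Q σ = 1 / n * ∑ v, μ σ * cexp μ {v}ᶜ F σ := fun σ => by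
      rw [← Finset.mul_sum]
      ring
    rw [Finset.sum_congr rfl fun σ _ => this σ, ← Finset.mul_sum, Finset.sum_comm]
    simp only [sum_cexp hμ, Finset.sum_const, Finset.card_univ, nsmul_eq_mul, ← hn]
    field_simp
  have hempty : entOn μ Q ∅ = entOn μ F ∅ := by
    simp only [entOn, cexp, fiber_empty, hQmean, ← mul_assoc, ← Finset.sum_mul]
  -- Jensen for `x log x`, applied to the average over `v` that defines `Q`.
  have hconv : entOn μ Q Finset.univ ≤ 1 / n * ∑ v, entOn μ F {v}ᶜ := by
    rw [entOn_univ_eq hμ]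
    have h2 : ∀ σ, Q σ * Real.log (Q σ) ≤
        ∑ v, 1 / n * (cexp μ {v}ᶜ F σ * Real.log (cexp μ {v}ᶜ F σ)) := by
      intro σ
      have := Real.convexOn_mul_log.map_sum_le (t := Finset.univ) (w := fun _ : V => 1 / n)
        (p := fun v => cexp μ {v}ᶜ F σ) (fun _ _ => by positivity)
        (by simp [hn]) (fun v _ => cexp_nonneg hμ _ hF0 σ)
      simpa only [smul_eq_mul, ← Finset.mul_sum] using this
    calc _ ≤ ∑ σ, μ σ * ∑ v, 1 / n * (cexp μ {v}ᶜ F σ * Real.log (cexp μ {v}ᶜ F σ)) :=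
          Finset.sum_le_sum fun σ _ => mul_le_mul_of_nonneg_left (h2 σ) (hμ σ)
      _ = _ := by
          simp only [entOn_eq hμ, Finset.mul_sum]
          rw [Finset.sum_comm]
          exact Finset.sum_congr rfl fun v _ => Finset.sum_congr rfl fun σ _ => by ring
  have hat := hAT F hF0
  rw [hQent, hempty, hent]
  rw [Finset.sum_sub_distrib, Finset.sum_const, Finset.card_univ, nsmul_eq_mul, ← hn] at hat
  have h3 : 1 / (C * n) * (entOn μ F Finset.univ - entOn μ F ∅) ≤
      entOn μ F Finset.univ - 1 / n * ∑ v, entOn μ F {v}ᶜ := by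
    have h4 := mul_le_mul_of_nonneg_left hat (by positivity : 0 ≤ 1 / (C * n))
    refine h4.trans (le_of_eq ?_)
    field_simp
  linarith

/-- Convergence of the Glauber dynamics in total variation distance. -/
theorem sq_tvDist_glauber_le [Nonempty V] (hμ : ∀ σ, 0 ≤ μ σ) (h1 : ∑ σ, μ σ = 1) {C : ℝ}
    (hC : 0 < C) (hC1 : 1 ≤ C * Fintype.card V)
    (hAT : ∀ F : (V → Fin q) → ℝ, (∀ σ, 0 ≤ F σ) → entOn μ F Finset.univ - entOn μ F ∅ ≤
      C * ∑ v, (entOn μ F Finset.univ - entOn μ F {v}ᶜ)) (x : Support μ) (t : ℕ) :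
    tvDist ((glauber μ ^ t) x) (fun y => μ y.1) ^ 2 ≤
      (1 - 1 / (C * Fintype.card V)) ^ t * Real.log (1 / μ x.1) := by
  -- By reversibility the density of the law at time `t` with respect to `μ` evolves under the same
  -- operator. It starts from the point-mass density, whose entropy is `log (1 / μ x)`.
  have key : ∃ f : Support μ → ℝ, (∀ y, 0 ≤ f y) ∧ (∀ y, (glauber μ ^ t) x y = μ y.1 * f y) ∧
      ∑ y : Support μ, μ y.1 * f y = 1 ∧ entropy (fun y : Support μ => μ y.1) f ≤
        (1 - 1 / (C * Fintype.card V)) ^ t * Real.log (1 / μ x.1) := by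
    induction t with
    | zero =>
      have hx := x.2.ne'
      refine ⟨fun y => if x = y then 1 / μ x.1 else 0, fun y => ?_, fun y => ?_, ?_, ?_⟩
      · dsimp only
        split_ifs
        exacts [by have := x.2; positivity, le_rfl]
      · rw [pow_zero, Matrix.one_apply, mul_ite, mul_zero]
        refine if_ctx_congr Iff.rfl (fun h => ?_) fun _ => rfl
        rw [← h, mul_one_div_cancel hx]
      · simp [hx]
      · simp [entropy, hx]
    | succ t ih =>
      obtain ⟨f, hf, hP, hsum, hent⟩ := ih
      have hstep : ∀ y, (glauber μ ^ (t + 1)) x y = μ y.1 * ∑ z, glauber μ y z * f z := by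
        intro y
        rw [pow_succ, Matrix.mul_apply, Finset.mul_sum]
        refine Finset.sum_congr rfl fun z _ => ?_
        rw [hP]
        linear_combination (f z) * glauber_reversible z y
      refine ⟨fun y => ∑ z, glauber μ y z * f z, fun y => Finset.sum_nonneg fun z _ =>
        mul_nonneg (glauber_nonneg hμ y z) (hf z), hstep, ?_, ?_⟩
      · simp only [Finset.mul_sum]
        rw [Finset.sum_comm, ← hsum]
        refine Finset.sum_congr rfl fun z _ => ?_
        rw [← mul_one (μ z.1 * f z), ← sum_glauber hμ z, Finset.mul_sum]
        refine Finset.sum_congr rfl fun y _ => ?_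
        linear_combination (f z) * glauber_reversible y z
      · refine (entropy_glauber_le hμ h1 hC hAT hf).trans ?_
        rw [pow_succ', mul_assoc]
        refine mul_le_mul_of_nonneg_left hent (sub_nonneg.2 ?_)
        rw [div_le_one (by linarith)]
        exact hC1
  obtain ⟨f, hf, hP, hsum, hent⟩ := key
  have e : (glauber μ ^ t) x = fun y : Support μ => μ y.1 * f y := funext hP
  rw [e]
  exact (tvDist_density hμ h1 hf hsum).trans hent

theorem pow_card_le (hμ : ∀ σ, 0 ≤ μ σ) (h1 : ∑ σ, μ σ = 1) {b : ℝ} (hb0 : 0 < b)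
    (hb : MarginallyBounded μ b) (x : Support μ) :
    b ^ Fintype.card V ≤ μ x.1 := by
  simpa [h1] using pow_card_mul_fiber_sum_le hμ hb0 hb Finset.univ x.2

end Mixing

/-! ### The Gibbs measure and explicit mixing-time bounds. -/

section Assembly

variable {V : Type u} [Fintype V] [DecidableEq V] {q : ℕ}

theorem gibbs_nonneg (X : SpinSystem q) (G : SimpleGraph V) [DecidableRel G.Adj]
    (hZ : 0 < X.partitionFunction G) (σ : V → Fin q) : 0 ≤ X.gibbs G σ := by
  refine div_nonneg (mul_nonneg (Finset.prod_nonneg fun e _ => ?_)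
    (Finset.prod_nonneg fun v _ => (X.pos _).le)) hZ.le
  induction e with
  | h u v => exact X.nonneg _ _

theorem sum_gibbs (X : SpinSystem q) (G : SimpleGraph V) [DecidableRel G.Adj]
    (hZ : 0 < X.partitionFunction G) : ∑ σ, X.gibbs G σ = 1 := by
  simp only [SpinSystem.gibbs]
  rw [← Finset.sum_div]
  exact div_self hZ.ne'

variable {μ : (V → Fin q) → ℝ}

/-- Mixing time bound when there is a single vertex. -/
theorem mixingTime_le_of_card_eq_one [Nonempty V] (hμ : ∀ σ, 0 ≤ μ σ) (h1 : ∑ σ, μ σ = 1)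
    (hV : Fintype.card V = 1) {b ε : ℝ} (hb0 : 0 < b) (hb : MarginallyBounded μ b) (hε : 0 < ε)
    (hε1 : ε < 1) :
    ∃ T : ℕ, mixingTime (glauber μ) (fun x => μ x.1) ε = (T : ℕ∞) ∧
      (T : ℝ) ≤ 1 / b * Real.log (1 / ε) := by
  have hlog : 1 - ε ≤ Real.log (1 / ε) := by
    have := Real.one_sub_inv_le_log_of_pos (by positivity : 0 < 1 / ε)
    rwa [one_div, inv_inv, ← one_div] at this
  have hlog0 : 0 ≤ Real.log (1 / ε) := by linarith
  -- With one vertex, `log (1/ε)` tends to `0` as `ε → 1`, so time `0` must suffice for large `ε`: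
  -- the initial distance is `1 - μ x ≤ 1 - b`. Otherwise one step is exact, and `log (1/ε) ≥ 1 - ε
  -- > b` pays for it.
  rcases le_or_gt (1 - b) ε with h | h
  · obtain ⟨T, hT, hT0⟩ := exists_mixingTime_eq (P := glauber μ) (π := fun x => μ x.1) (ε := ε)
      (N := 0) (fun x => ⟨0, le_rfl, by
        have hx := pow_card_le hμ h1 hb0 hb x
        rw [hV, pow_one] at hx
        have hle : μ x.1 ≤ 1 := h1 ▸ Finset.single_le_sum (fun σ _ => hμ σ) (Finset.mem_univ x.1)
        have hs := sum_support hμ (fun _ => 1)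
        simp only [mul_one, h1] at hs
        have e : ∀ y : Support μ, |(glauber μ ^ 0) x y - μ y.1| =
            (if x = y then 1 - 2 * μ y.1 else 0) + μ y.1 := by
          intro y
          rw [pow_zero, Matrix.one_apply]
          split_ifs with hxy
          · rw [← hxy, abs_of_nonneg (by linarith)]
            ring
          · rw [zero_sub, abs_neg, abs_of_pos y.2, zero_add]
        rw [tvDist, Finset.sum_congr rfl fun y _ => e y, Finset.sum_add_distrib, hs,
          Finset.sum_ite_eq, if_pos (Finset.mem_univ x)]
        linarith⟩)
    refine ⟨T, hT, ?_⟩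
    rw [Nat.le_zero.1 hT0, Nat.cast_zero]
    positivity
  · obtain ⟨T, hT, hT1⟩ := exists_mixingTime_eq (P := glauber μ) (π := fun x => μ x.1) (ε := ε)
      (N := 1) (fun x => ⟨1, le_rfl, by
        have hAT : ∀ F : (V → Fin q) → ℝ, (∀ σ, 0 ≤ F σ) →
            entOn μ F Finset.univ - entOn μ F ∅ ≤
              1 * ∑ v, (entOn μ F Finset.univ - entOn μ F {v}ᶜ) := by
          intro F _
          have hc : ∀ v : V, ({v}ᶜ : Finset V) = ∅ := fun v => by
            rw [Finset.compl_eq_empty_iff, ← Finset.card_eq_iff_eq_univ, hV, Finset.card_singleton]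
          simp only [hc, Finset.sum_const, Finset.card_univ, hV, one_smul, one_mul, le_refl]
        have := sq_tvDist_glauber_le hμ h1 one_pos (by rw [hV]; norm_num) hAT x 1
        have e0 : (1 - 1 / (1 * (Fintype.card V : ℝ))) ^ 1 = 0 := by rw [hV]; norm_num
        rw [e0, zero_mul] at this
        rw [pow_eq_zero_iff two_ne_zero |>.1 (le_antisymm this (sq_nonneg _))]
        exact hε.le⟩)
    refine ⟨T, hT, ?_⟩
    have hT1' : (T : ℝ) ≤ 1 := by exact_mod_cast hT1
    rw [div_mul_eq_mul_div, one_mul, le_div_iff₀ hb0]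
    nlinarith

/-- Mixing time bound from approximate tensorization when there are at least two vertices. -/
theorem mixingTime_le_of_tensorization [Nonempty V] (hμ : ∀ σ, 0 ≤ μ σ) (h1 : ∑ σ, μ σ = 1)
    (hV : 2 ≤ Fintype.card V) {b ε C : ℝ} (hb0 : 0 < b) (hb1 : b ≤ 1)
    (hb : MarginallyBounded μ b) (hε : 0 < ε) (hε1 : ε < 1) (hC : 1 ≤ C)
    (hAT : ∀ F : (V → Fin q) → ℝ, (∀ σ, 0 ≤ F σ) → entOn μ F Finset.univ - entOn μ F ∅ ≤
      C * ∑ v, (entOn μ F Finset.univ - entOn μ F {v}ᶜ)) :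
    ∃ T : ℕ, mixingTime (glauber μ) (fun x => μ x.1) ε = (T : ℕ∞) ∧
      (T : ℝ) ≤ C / b * (6 * (Fintype.card V * Real.log (Fintype.card V / ε))) := by
  set n : ℝ := (Fintype.card V : ℝ) with hn
  have hn2 : 2 ≤ n := by rw [hn]; exact_mod_cast hV
  have hn0 : 0 < n := by linarith
  have hCn : 1 ≤ C * n := by nlinarith
  have hCn0 : 0 < C * n := by linarith
  set L := Real.log (n / ε) with hL
  have hlogε : 0 < Real.log (1 / ε) := Real.log_pos (by rw [lt_div_iff₀ hε]; linarith)
  have hLeq : L = Real.log n + Real.log (1 / ε) := by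
    rw [hL, ← Real.log_mul hn0.ne' (by positivity)]
    congr 1
    ring
  have hlogn : 1 / 2 ≤ Real.log n := by
    have := Real.one_sub_inv_le_log_of_pos hn0
    have h2 : n⁻¹ ≤ 2⁻¹ := inv_anti₀ two_pos hn2
    norm_num at h2
    linarith
  have hL2 : 1 / 2 ≤ L := by linarith
  have h1b : 1 ≤ 1 / b := (one_le_div hb0).2 hb1
  have hlogb0 : 0 ≤ Real.log (1 / b) := Real.log_nonneg h1b
  have hlogb : Real.log (1 / b) ≤ 1 / b := by
    have := Real.log_le_sub_one_of_pos (by positivity : 0 < 1 / b)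
    linarith
  -- Chosen so that `exp (-s / (C n)) = ε² b / n`. The initial entropy is at most `n log (1/b)`, and
  -- `b log (1/b) ≤ 1`, leaving `ε²`.
  set s : ℝ := C * n * (Real.log n + Real.log (1 / b) + 2 * Real.log (1 / ε)) with hs
  have hs0 : 0 ≤ s := mul_nonneg hCn0.le (by linarith)
  obtain ⟨T, hT, hTN⟩ := exists_mixingTime_eq (P := glauber μ) (π := fun x => μ x.1) (ε := ε)
    (N := ⌈s⌉₊) (fun x => ⟨⌈s⌉₊, le_rfl, by
      have hx := pow_card_le hμ h1 hb0 hb x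
      have hlogx : Real.log (1 / μ x.1) ≤ n * Real.log (1 / b) := by
        rw [hn, ← Real.log_pow, one_div_pow]
        exact Real.log_le_log (by have := x.2; positivity)
          (one_div_le_one_div_of_le (by positivity) hx)
      have hlogx0 : 0 ≤ Real.log (1 / μ x.1) := by
        have hle : μ x.1 ≤ 1 := h1 ▸ Finset.single_le_sum (fun σ _ => hμ σ) (Finset.mem_univ x.1)
        exact Real.log_nonneg ((one_le_div x.2).2 hle)
      have htv := sq_tvDist_glauber_le hμ h1 (by linarith) hCn hAT x ⌈s⌉₊
      have hexp : (1 - 1 / (C * n)) ^ ⌈s⌉₊ ≤ ε ^ 2 * b / n := by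
        calc (1 - 1 / (C * n)) ^ ⌈s⌉₊ ≤ Real.exp (-(1 / (C * n))) ^ ⌈s⌉₊ :=
              pow_le_pow_left₀ (sub_nonneg.2 ((div_le_one hCn0).2 hCn))
                (Real.one_sub_le_exp_neg _) _
          _ = Real.exp (-(⌈s⌉₊ / (C * n))) := by
              rw [← Real.exp_nat_mul]
              congr 1
              ring
          _ ≤ Real.exp (-(s / (C * n))) := by
              refine Real.exp_le_exp.2 (neg_le_neg ?_)
              exact div_le_div_of_nonneg_right (Nat.le_ceil s) hCn0.le
          _ = ε ^ 2 * b / n := by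
              rw [hs, mul_div_cancel_left₀ _ hCn0.ne', one_div, one_div, Real.log_inv,
                Real.log_inv, show -(Real.log n + -Real.log b + 2 * -Real.log ε) =
                  Real.log ε + Real.log ε + Real.log b - Real.log n by ring, Real.exp_sub,
                Real.exp_add, Real.exp_add, Real.exp_log hε, Real.exp_log hb0, Real.exp_log hn0]
              ring
      refine le_of_abs_le (abs_le_of_sq_le_sq ?_ hε.le)
      calc _ ≤ _ := htv
        _ ≤ ε ^ 2 * b / n * (n * Real.log (1 / b)) :=
            mul_le_mul hexp hlogx hlogx0 (by positivity)
        _ = ε ^ 2 * (b * Real.log (1 / b)) := by field_simp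
        _ ≤ ε ^ 2 * (b * (1 / b)) := by gcongr
        _ = ε ^ 2 := by rw [mul_one_div_cancel hb0.ne', mul_one]⟩)
  refine ⟨T, hT, ?_⟩
  have hTs : (T : ℝ) ≤ s + 1 := by
    have h2 : (T : ℝ) ≤ ⌈s⌉₊ := by exact_mod_cast hTN
    exact h2.trans (Nat.ceil_lt_add_one hs0).le
  have hs1 : s ≤ C * n * (2 * L + 1 / b * (2 * L)) := by
    rw [hs]
    refine mul_le_mul_of_nonneg_left ?_ hCn0.le
    have : 1 / b * 1 ≤ 1 / b * (2 * L) := mul_le_mul_of_nonneg_left (by linarith) (by positivity)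
    linarith
  -- Both the rounding and the `log (1/b)` term are absorbed using `L ≥ 1/2`, which needs `n ≥ 2`;
  -- the three contributions of `2L` give the factor `6`.
  have h3 : (1 : ℝ) ≤ C * n * (2 * L) := by nlinarith
  have h4 : C * n * (2 * L) ≤ 1 / b * (C * n * (2 * L)) := le_mul_of_one_le_left (by linarith) h1b
  calc (T : ℝ) ≤ s + 1 := hTs
    _ ≤ 1 / b * (C * n * (2 * L)) * 3 := by linarith
    _ = _ := by ring

end Assembly

end SpinGlauber

/-! ### The main theorem with an explicit constant. -/

open SpinGlauber in
theorem theorem1p8 :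
    ∃ K : ℝ, 0 < K ∧
      ∀ (Δ : ℕ) (b η : ℝ), 3 ≤ Δ → 0 < b → 0 < η →
      ∀ (V : Type*) [Fintype V] [DecidableEq V] [Nonempty V]
        (G : SimpleGraph V) [DecidableRel G.Adj],
        (∀ v, G.degree v ≤ Δ) →
      ∀ (q : ℕ), 2 ≤ q → ∀ X : SpinGlauber.SpinSystem q, 0 < X.partitionFunction G →
        SpinGlauber.TotallyConnected (X.gibbs G) →
        SpinGlauber.MarginallyBounded (X.gibbs G) b →
        SpinGlauber.SpectrallyIndependent (X.gibbs G) η →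
        SpinGlauber.ModifiedLogSobolev (SpinGlauber.glauber (X.gibbs G))
            (fun σ => X.gibbs G σ.1)
            (1 / (((Δ : ℝ) / b) ^ (K * (η / b ^ 2 + 1)) * (Fintype.card V : ℝ))) ∧
          ∀ ε : ℝ, 0 < ε → ε < 1 →
            ∃ T : ℕ,
              SpinGlauber.mixingTime (SpinGlauber.glauber (X.gibbs G))
                  (fun σ => X.gibbs G σ.1) ε = (T : ℕ∞) ∧
                (T : ℝ) ≤ ((Δ : ℝ) / b) ^ (K * (η / b ^ 2 + 1)) *
                  (K * ((Fintype.card V : ℝ) * Real.log ((Fintype.card V : ℝ) / ε))) := by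
  -- With `N ≤ 4η/b + 2`, the exponent `13 N + 1` is at most `52 η/b + 27`, and `η/b ≤ η/b²`. The
  -- extra `1` pays for the factor `1/b` in the mixing bounds.
  refine ⟨52, by norm_num, ?_⟩
  intro Δ b η hΔ3 hb0 hη V _ _ _ G _ hΔ q _ X hZ hc hb hSI
  have hμ := gibbs_nonneg X G hZ
  have h1 := sum_gibbs X G hZ
  obtain ⟨σ, hσ⟩ : ∃ σ, 0 < X.gibbs G σ := by
    by_contra! h
    linarith [Finset.sum_nonpos fun σ (_ : σ ∈ Finset.univ) => h σ]
  have hb1 : b ≤ 1 := le_one_of_marginallyBounded hμ hb (Classical.arbitrary V) hσ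
  have hΔ3' : (3 : ℝ) ≤ Δ := by exact_mod_cast hΔ3
  set r : ℝ := (Δ : ℝ) / b with hr
  have hr3 : 3 ≤ r := by
    rw [hr, le_div_iff₀ hb0]
    nlinarith
  have hr1 : 1 ≤ r := by linarith
  have hbr : 1 / b ≤ r := div_le_div_of_nonneg_right (by linarith) hb0.le
  set E : ℝ := 52 * (η / b ^ 2 + 1) with hE
  obtain ⟨N, hN⟩ : ∃ N, N = ⌈4 * η / b + 1⌉₊ := ⟨_, rfl⟩
  have hN1 : 4 * η / b + 1 ≤ N := hN ▸ Nat.le_ceil _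
  have hN2 : (N : ℝ) ≤ 4 * η / b + 2 := by
    have := (Nat.ceil_lt_add_one (by positivity : 0 ≤ 4 * η / b + 1)).le
    rw [← hN] at this
    linarith
  have hexp : ((13 * N + 1 : ℕ) : ℝ) ≤ E := by
    have h2 : η / b ≤ η / b ^ 2 :=
      div_le_div_of_nonneg_left hη.le (by positivity) (by nlinarith)
    have h3 : 4 * η / b = 4 * (η / b) := by ring
    push_cast
    linarith
  have hpow : r ^ (13 * N + 1) ≤ r ^ E := by
    rw [← Real.rpow_natCast]
    exact Real.rpow_le_rpow_of_exponent_le hr1 hexp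
  have hC0 : 1 ≤ r ^ (13 * N) := one_le_pow₀ hr1
  have hCE : r ^ (13 * N) ≤ r ^ E := (pow_le_pow_right₀ hr1 (by omega)).trans hpow
  have hE0 : 0 < r ^ E := by linarith
  have hAT : ∀ F : (V → Fin q) → ℝ, (∀ σ, 0 ≤ F σ) →
      entOn (X.gibbs G) F Finset.univ - entOn (X.gibbs G) F ∅ ≤ r ^ (13 * N) *
        ∑ v, (entOn (X.gibbs G) F Finset.univ - entOn (X.gibbs G) F {v}ᶜ) := fun F hF =>
    approximate_tensorization G hΔ3 hΔ hμ (spatialMarkov_gibbs X G) hc hSI hη.le hb0 hb1 hb hF hN1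
  refine ⟨modifiedLogSobolev_of_tensorization hμ h1 hc hE0 fun F hF => (hAT F hF).trans ?_, ?_⟩
  · exact mul_le_mul_of_nonneg_right hCE (Finset.sum_nonneg fun v _ =>
      sub_nonneg.2 (entOn_mono hμ hF (Finset.subset_univ _)))
  intro ε hε hε1
  have hcard : 1 ≤ Fintype.card V := Fintype.card_pos
  have hlog : 0 ≤ (Fintype.card V : ℝ) * Real.log (Fintype.card V / ε) := by
    refine mul_nonneg (by positivity) (Real.log_nonneg ?_)
    rw [one_le_div hε]
    have : (1 : ℝ) ≤ Fintype.card V := by exact_mod_cast hcard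
    linarith
  rcases hcard.eq_or_lt with hV | hV
  · obtain ⟨T, hT, hTle⟩ := mixingTime_le_of_card_eq_one hμ h1 hV.symm hb0 hb hε hε1
    refine ⟨T, hT, hTle.trans ?_⟩
    rw [← hV, Nat.cast_one, one_mul] at hlog ⊢
    refine mul_le_mul ?_ (by linarith) hlog hE0.le
    calc 1 / b ≤ r ^ 1 := by rwa [pow_one]
      _ ≤ r ^ (13 * N + 1) := pow_le_pow_right₀ hr1 (by omega)
      _ ≤ r ^ E := hpow
  · obtain ⟨T, hT, hTle⟩ := mixingTime_le_of_tensorization hμ h1 hV hb0 hb1 hb hε hε1 hC0 hAT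
    refine ⟨T, hT, hTle.trans ?_⟩
    refine mul_le_mul ?_ (mul_le_mul_of_nonneg_right (by norm_num) hlog)
      (mul_nonneg (by norm_num) hlog) hE0.le
    calc r ^ (13 * N) / b = r ^ (13 * N) * (1 / b) := by ring
      _ ≤ r ^ (13 * N) * r := by gcongr
      _ = r ^ (13 * N + 1) := (pow_succ _ _).symm
      _ ≤ r ^ E := hpow
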